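/- Let $Q\in L^1_{\mathrm{loc}}]0,\infty[$ be complex valued, let $m,k\in\mathbb C$ with $\Re(m)\ge 0$, $m\neq 0$, $\Re(k)\ge 0$, let $\varepsilon\ge 0$ and suppose that $\int_0^1 x^{1-\varepsilon}|Q(x)|\,dx<\infty$ (that is, $Q\in\mathscr L^{(0)}_\varepsilon$). Let $n$ be a nonnegative integer with $\frac{\varepsilon}{2}(n+1)\ge\Re(m)$. Consider the equation $$-f''(x)+\Big(\big(m^2-\tfrac14\big)\tfrac1{x^2}+Q(x)\Big)f(x)=-k^2f(x)\qquad\text{for a.e. } x\in\,]0,\infty[, \tag{1}$$ for $f\in AC^1]0,\infty[$ (differentiable, with locally absolutely continuous derivative). For $x>0$ put $u^0_{\mu}(x,k)=x^{\frac12+\mu}\sum_{j\ge0}\frac{(k^2x^2/4)^j}{j!\,\Gamma(\mu+j+1)}$ for $\mu\in\mathbb C$ (equal to $(2/k)^{\mu}\sqrt x\,I_{\mu}(kx)$ if $k\ne0$), and $v^0_m(x,k)=(k/2)^m\sqrt x\,K_m(kx)$ if $k\neq0$, $v^0_m(x,0)=\frac12\Gamma(m)x^{\frac12-m}$, where $I_\mu$,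 $K_m$ are the modified Bessel and Macdonald functions. Let $G^{0(1)}_{\bowtie}=G^{0(1)}_{\bowtie}(-k^2)$ and $G^0_\to$ be the integral operators on functions on $]0,\infty[$ with kernels $$G^{0(1)}_{\bowtie}(x,y)=\begin{cases} v^0_m(x,k)u^0_m(y,k), & y\le x\le 1,\\ u^0_m(x,k)v^0_m(y,k), & x<y\le 1,\\ 0,&\text{otherwise,}\end{cases}\qquad G^0_\to(x,y)=\begin{cases} v^0_m(x,k)u^0_m(y,k)-u^0_m(x,k)v^0_m(y,k), & y\le x,\\ 0,&y>x,\end{cases}$$ and set $$u^{0[n]}_{-m}(x,k)=\sum_{j=0}^n\big(-G^{0(1)}_{\bowtie}(-k^2)Q\big)^ju^0_{-m}(x,k).$$ (a) The functions $(G^{0(1)}_{\bowtie}Q)^ju^0_{-m}(\cdot,k)$, $j\ge0$, on $]0,\infty[$ and $G^0_\to Q(G^{0(1)}_{\bowtie}Q)^nu^0_{-m}(\cdot,k)$ on $]0,1[$ are given by absolutely convergent integrals, and $u^{0[n]}_{-m}(\cdot,k)$ is differentiable on $]0,1[$. There is a unique solution $u^{[n]}_{-m}(\cdot,k)\in AC^1]0,\infty[$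 of (1) such that, as $x\to0$, $$u^{[n]}_{-m}(x,k)-u^{0[n]}_{-m}(x,k)=o\big(x^{\frac12+\Re(m)}\big),\qquad \partial_xu^{[n]}_{-m}(x,k)-\partial_xu^{0[n]}_{-m}(x,k)=o\big(x^{-\frac12+\Re(m)}\big).$$ On $]0,1[$ it is given by $$u^{[n]}_{-m}(\cdot,k)=u^{0[n]}_{-m}(\cdot,k)+(-1)^{n+1}\big(1+G^0_\to Q\big)^{-1}G^0_\to Q\big(G^{0(1)}_{\bowtie}Q\big)^nu^0_{-m}(\cdot,k),$$ where $r=(1+G^0_\to Q)^{-1}F$ denotes the unique solution of $r+G^0_\to Qr=F$ on $]0,1[$ among the measurable functions with $x^{-\frac12-\Re(m)}r\in L^\infty]0,1[$. (b) If moreover $\Re(m)<1$, then for every $k'\in\mathbb C$ with $\Re(k')\ge0$, in particular for $k'=0$, there is a unique solution $g\in AC^1]0,\infty[$ of (1) (with the parameter $k$) such that, as $x\to0$, $$g(x)-u^{0[n]}_{-m}(x,k')=o\big(x^{\frac12+\Re(m)}\big),\qquad \partial_xg(x)-\partial_xu^{0[n]}_{-m}(x,k')=o\big(x^{-\frac12+\Re(m)}\big).$$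 -/

import Mathlib

open MeasureTheory Set Filter Topology Asymptotics

noncomputable section

namespace PerturbedBessel

/-- The normalized hypergeometric function `𝐅_m(w) = ∑ₙ wⁿ / (n! Γ(m+n+1))`. The summand is `0`
when `m + n + 1` is a pole of `Γ` (there `Complex.Gamma` is `0` and so is its inverse), as it should
be for the entire function `1/Γ`. -/
def hypF (m w : ℂ) : ℂ :=
  ∑' n : ℕ, w ^ n * ((n.factorial : ℂ) * Complex.Gamma (m + n + 1))⁻¹

/-- The unperturbed solution `u⁰_m(x,k) = x^{1/2+m} 𝐅_m(k²x²/4)`, that is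
`(2/k)^m √x I_m(kx)` for `k ≠ 0` and `x^{1/2+m}/Γ(m+1)` for `k = 0`. -/
def u0 (m k : ℂ) (x : ℝ) : ℂ :=
  (x : ℂ) ^ (1 / 2 + m) * hypF m (k ^ 2 * (x : ℂ) ^ 2 / 4)

/-- The function `(k/2)^m √x K_m(kx)` for `k ≠ 0` and `m ∉ ℤ`, with the Macdonald function
`K_m = π (I_{-m} - I_m) / (2 sin(π m))`. -/
def v0NonInt (m k : ℂ) (x : ℝ) : ℂ :=
  (Real.pi : ℂ) / (2 * Complex.sin (Real.pi * m)) *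
    (u0 (-m) k x - (k / 2) ^ (2 * m) * u0 m k x)

open Classical in
/-- The unperturbed solution `v⁰_m(x,k)`: it is `(k/2)^m √x K_m(kx)` for `k ≠ 0`, where for an
integer `m` the Macdonald function is the limit of the formula for non-integer orders, and
`Γ(m) x^{1/2-m} / 2` for `k = 0`. -/
def v0 (m k : ℂ) (x : ℝ) : ℂ :=
  if k = 0 then Complex.Gamma m * (x : ℂ) ^ (1 / 2 - m) / 2
  else if ∃ N : ℤ, m = N then limUnder (𝓝[≠] m) (fun μ : ℂ => v0NonInt μ k x)
  else v0NonInt m k x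

/-- The kernel of the two-sided Green operator of the unperturbed Bessel operator plus `k²`. -/
def twoSidedKernel (m k : ℂ) (x y : ℝ) : ℂ :=
  if y ≤ x then v0 m k x * u0 m k y else u0 m k x * v0 m k y

/-- The two-sided kernel compressed to `]0,a[`. -/
def twoSidedKernelOn (a : ℝ) (m k : ℂ) (x y : ℝ) : ℂ :=
  if x ≤ a ∧ y ≤ a then twoSidedKernel m k x y else 0

/-- The kernel of the forward Green operator of the unperturbed Bessel operator plus `k²`. -/
def forwardKernel (m k : ℂ) (x y : ℝ) : ℂ :=
  if y ≤ x then v0 m k x * u0 m k y - u0 m k x * v0 m k y else 0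

/-- The operator `f ↦ G(Q f)` on functions on `]0,∞[`, for a kernel `G`. -/
def greenQ (G : ℝ → ℝ → ℂ) (Q f : ℝ → ℂ) : ℝ → ℂ :=
  fun x => ∫ y in Ioi (0 : ℝ), G x y * (Q y * f y)

/-- The integral defining `(G(Q f))(x)` converges absolutely. -/
def GreenQDefinedAt (G : ℝ → ℝ → ℂ) (Q f : ℝ → ℂ) (x : ℝ) : Prop :=
  IntegrableOn (fun y => G x y * (Q y * f y)) (Ioi (0 : ℝ))

/-- The `j`-th iterate `(G Q)^j u⁰_{-m}(·,k)` with the two-sided kernel compressed to `]0,1[`. -/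
def iter (m k : ℂ) (Q : ℝ → ℂ) (j : ℕ) : ℝ → ℂ :=
  (greenQ (twoSidedKernelOn 1 m k) Q)^[j] (u0 (-m) k)

/-- The truncated series `u^{0[n]}_{-m}(x,k) = ∑_{j ≤ n} (-G Q)^j u⁰_{-m}(x,k)`. -/
def trunc (m k : ℂ) (Q : ℝ → ℂ) (n : ℕ) : ℝ → ℂ :=
  fun x => ∑ j ∈ Finset.range (n + 1),
    ((fun f : ℝ → ℂ => -greenQ (twoSidedKernelOn 1 m k) Q f)^[j] (u0 (-m) k)) x

/-- The class `𝓛^{(0)}_ε`: `Q ∈ L¹_loc ]0,∞[` with `∫₀¹ x^{1-ε} |Q(x)| dx < ∞`. -/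
def PotentialClass (ε : ℝ) : Set (ℝ → ℂ) :=
  {Q | LocallyIntegrableOn Q (Ioi (0 : ℝ)) ∧
    IntegrableOn (fun x : ℝ => x ^ (1 - ε) * ‖Q x‖) (Ioo (0 : ℝ) 1)}

/-- `f ∈ AC¹]0,∞[`: `f` is differentiable on `]0,∞[` and its derivative is absolutely continuous
on every compact subinterval. -/
def IsAC1 (f : ℝ → ℂ) : Prop :=
  (∀ x : ℝ, 0 < x → DifferentiableAt ℝ f x) ∧
    ∀ a b : ℝ, 0 < a → a ≤ b → AbsolutelyContinuousOnInterval (deriv f) a b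

/-- `f ∈ AC¹]0,∞[` solves `-f'' + ((m² - 1/4)/x² + Q) f = -k² f` almost everywhere. -/
def IsEigensolution (m k : ℂ) (Q f : ℝ → ℂ) : Prop :=
  IsAC1 f ∧ ∀ᵐ x : ℝ, 0 < x →
    -deriv (deriv f) x + ((m ^ 2 - 1 / 4) / (x : ℂ) ^ 2 + Q x) * f x = -k ^ 2 * f x

/-- `f - h = o(x^{1/2+Re m})` and `f' - h' = o(x^{-1/2+Re m})` as `x → 0+`. -/
def AgreesNearZero (m : ℂ) (f h : ℝ → ℂ) : Prop :=
  ((fun x => f x - h x) =o[𝓝[>] (0 : ℝ)] fun x : ℝ => x ^ (1 / 2 + m.re)) ∧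
  ((fun x => deriv f x - deriv h x) =o[𝓝[>] (0 : ℝ)] fun x : ℝ => x ^ (-1 / 2 + m.re))

/-- `r = (1 + G_→ Q)^{-1} F` in the weighted space `L^∞(]0,1[, x^{1/2+Re m})`. -/
def IsForwardResolvent (m k : ℂ) (Q F r : ℝ → ℂ) : Prop :=
  AEStronglyMeasurable r (volume.restrict (Ioo (0 : ℝ) 1)) ∧
  (∃ C : ℝ, ∀ᵐ x ∂volume.restrict (Ioo (0 : ℝ) 1), ‖r x‖ ≤ C * x ^ (1 / 2 + m.re)) ∧
  ∀ x ∈ Ioo (0 : ℝ) 1, r x + greenQ (forwardKernel m k) Q r x = F x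

end PerturbedBessel

end

/-! Put `ρ = Re m`. The equation is a perturbation by `Q` of `f'' = V f` with `V = (m² - 1/4)/x² +
k²`, which has solutions `u` of order `x^{1/2+ρ}` and `v` of order `x^{1/2-ρ}` at `0`, with
Wronskian `v u' - v' u = 1`. All the analysis uses only such a `FundamentalSystem`; Bessel functions
enter only through `exists_fundamentalSystem`.

The truncated series is an approximate solution. In `-∂² + V + Q` applied to `∑ (-G Q)^j u_{-m}`
everything telescopes except `(-1)^n Q (G Q)^n u_{-m}` (`solvesWith_extTrunc`). Each application of
the two-sided operator improves the order at `0` by `x^ε`, until the order `x^{1/2+ρ}` of `u` is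
reached (`norm_twoSidedOp_le`, `extIter_bound`). The condition `ε(n+1)/2 ≥ ρ` is exactly what makes
the residual integrable against `x^{1/2-ρ}` by this count (`admissible_mul_extIter`).

For such a residual the forward Green operator gives a function that is `o(x^{1/2+ρ})`, with
derivative `o(x^{-1/2+ρ})` (`forwardOp_isLittleO`). The remaining error is removed by a Volterra
equation, whose Neumann series converges because the `j`-th term carries a factor `(C ∫₀ˣ y|Q|)^j /
j!` (`exists_eq_sub_forwardOp`, `exists_correction`).

For uniqueness, the difference `d` of two solutions has Wronskians with `u` and `v` that vanish at
`0`. Integrating them gives `d = -G_→ Q d`, and the factorial bound forces `d = 0`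
(`eq_zero_of_isLittleO`).

Replacing `k` by `k'` in the series adds to the residual a multiple of the series itself, which is
`O(x^{1/2-ρ})`. Against the weight `x^{1/2-ρ}` this leaves `x^{1-2ρ}`, integrable at `0` when `ρ <
1`. -/

namespace PerturbedBessel

/-! ### Absolutely continuous complex-valued functions. -/

section AbsoluteContinuity

theorem absolutelyContinuousOnInterval_of_dist_le {X : Type*} [PseudoMetricSpace X]
    {f : ℝ → ℂ} {g : ℝ → X} {a b : ℝ}
    (hg : AbsolutelyContinuousOnInterval g a b)
    (h : ∀ x ∈ uIcc a b, ∀ y ∈ uIcc a b, dist (f x) (f y) ≤ dist (g x) (g y)) :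
    AbsolutelyContinuousOnInterval f a b := by
  refine squeeze_zero' (Eventually.of_forall fun E => Finset.sum_nonneg fun i _ => dist_nonneg) ?_ hg
  have : ∀ᶠ E in (AbsolutelyContinuousOnInterval.totalLengthFilter ⊓
      𝓟 (AbsolutelyContinuousOnInterval.disjWithin a b)),
      E ∈ AbsolutelyContinuousOnInterval.disjWithin a b :=
    mem_inf_of_right (mem_principal_self _)
  filter_upwards [this] with E hE
  exact Finset.sum_le_sum fun i hi => h _ (hE.1 i hi).1 _ (hE.1 i hi).2

theorem absolutelyContinuousOnInterval_congr {f g : ℝ → ℂ} {a b : ℝ}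
    (hf : AbsolutelyContinuousOnInterval f a b) (h : EqOn f g (uIcc a b)) :
    AbsolutelyContinuousOnInterval g a b :=
  absolutelyContinuousOnInterval_of_dist_le hf fun x hx y hy => by rw [h hx, h hy]

/-- The increments are dominated by those of the real primitive of `‖f‖`, which is absolutely
continuous. -/
theorem absolutelyContinuousOnInterval_integral {f : ℝ → ℂ} {a b : ℝ}
    (hf : IntervalIntegrable f volume a b) :
    AbsolutelyContinuousOnInterval (fun x => ∫ t in a..x, f t) a b := by
  refine absolutelyContinuousOnInterval_of_dist_le
    (hf.norm.absolutelyContinuousOnInterval_intervalIntegral left_mem_uIcc) ?_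
  intro x hx y hy
  have hx' : IntervalIntegrable f volume a x := hf.mono_set (uIcc_subset_uIcc left_mem_uIcc hx)
  have hy' : IntervalIntegrable f volume a y := hf.mono_set (uIcc_subset_uIcc left_mem_uIcc hy)
  rw [dist_eq_norm, Real.dist_eq, intervalIntegral.integral_interval_sub_left hx' hy',
    intervalIntegral.integral_interval_sub_left hx'.norm hy'.norm]
  exact intervalIntegral.norm_integral_le_abs_integral_norm

/-- Subtracting the primitive of `f'` leaves an absolutely continuous function with derivative zero
almost everywhere, hence a constant. -/
theorem integral_eq_sub_of_absolutelyContinuousOnInterval {f f' : ℝ → ℂ} {a b : ℝ}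
    (hf : AbsolutelyContinuousOnInterval f a b) (hf' : IntervalIntegrable f' volume a b)
    (h : ∀ᵐ x, x ∈ uIcc a b → HasDerivAt f (f' x) x) :
    f b - f a = ∫ x in a..b, f' x := by
  obtain ⟨C, hC⟩ := (hf.sub
    (absolutelyContinuousOnInterval_integral hf')).const_of_ae_hasDerivAt_zero (by
      filter_upwards [h, hf'.ae_hasDerivAt_integral] with x h1 h2 hx
      simpa using (h1 hx).sub (h2 hx a left_mem_uIcc))
  have h1 := hC b right_mem_uIcc
  have h2 := hC a left_mem_uIcc
  simp only [Pi.sub_apply, intervalIntegral.integral_same, sub_zero] at h1 h2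
  rw [h2, ← h1]; ring

end AbsoluteContinuity

/-! ### Calculus of primitives on the open half-line. -/

/-- `F` is a primitive of the locally integrable function `f` on `]0,∞[`. -/
def IsLocalPrimitive (f F : ℝ → ℂ) : Prop :=
  LocallyIntegrableOn f (Ioi 0) ∧
    ∀ a b : ℝ, 0 < a → 0 < b → F b - F a = ∫ x in a..b, f x

theorem uIcc_subset_Ioi {a b : ℝ} (ha : 0 < a) (hb : 0 < b) : uIcc a b ⊆ Ioi 0 :=
  fun _ hx => lt_of_lt_of_le (lt_min ha hb) hx.1

theorem intervalIntegrable_of_locallyIntegrableOn {f : ℝ → ℂ} (hf : LocallyIntegrableOn f (Ioi 0))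
    {a b : ℝ} (ha : 0 < a) (hb : 0 < b) : IntervalIntegrable f volume a b :=
  (hf.integrableOn_compact_subset (uIcc_subset_Ioi ha hb) isCompact_uIcc).intervalIntegrable

/-- The half-line is exhausted by the countably many intervals `[1/(n+1), n+1]`. -/
theorem ae_pos_of_forall_Icc {p : ℝ → Prop}
    (h : ∀ a b : ℝ, 0 < a → a ≤ b → ∀ᵐ x : ℝ, x ∈ Icc a b → p x) : ∀ᵐ x : ℝ, 0 < x → p x := by
  have : ∀ᵐ x : ℝ, ∀ n : ℕ, x ∈ Icc (1 / ((n : ℝ) + 1)) ((n : ℝ) + 1) → p x :=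
    ae_all_iff.2 fun n => h _ _ (by positivity) (by
      rw [div_le_iff₀ (by positivity)]
      nlinarith [(Nat.cast_nonneg n : (0 : ℝ) ≤ n)])
  filter_upwards [this] with x hx h0
  obtain ⟨n, hn⟩ := exists_nat_gt (max x (1 / x))
  refine hx n ⟨?_, by linarith [le_max_left x (1 / x)]⟩
  have h1 : 1 / x < n := lt_of_le_of_lt (le_max_right _ _) hn
  rw [div_le_iff₀ (by positivity)]
  rw [div_lt_iff₀ h0] at h1
  nlinarith

namespace IsLocalPrimitive

variable {f F g G : ℝ → ℂ}

theorem intervalIntegrable (h : IsLocalPrimitive f F) {a b : ℝ} (ha : 0 < a) (hb : 0 < b) :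
    IntervalIntegrable f volume a b :=
  intervalIntegrable_of_locallyIntegrableOn h.1 ha hb

theorem eq_add (h : IsLocalPrimitive f F) {a x : ℝ} (ha : 0 < a) (hx : 0 < x) :
    F x = F a + ∫ t in a..x, f t := by
  rw [← h.2 a x ha hx]; ring

theorem absolutelyContinuousOnInterval (h : IsLocalPrimitive f F) {a b : ℝ} (ha : 0 < a)
    (hb : 0 < b) : AbsolutelyContinuousOnInterval F a b := by
  refine absolutelyContinuousOnInterval_of_dist_le
    (absolutelyContinuousOnInterval_integral (h.intervalIntegrable ha hb)) fun x hx y hy => ?_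
  rw [h.eq_add ha (uIcc_subset_Ioi ha hb hx), h.eq_add ha (uIcc_subset_Ioi ha hb hy),
    dist_add_left]

theorem ae_hasDerivAt (h : IsLocalPrimitive f F) : ∀ᵐ x : ℝ, 0 < x → HasDerivAt F (f x) x := by
  refine ae_pos_of_forall_Icc fun a b ha hab => ?_
  have hb := ha.trans_le hab
  filter_upwards [(h.intervalIntegrable ha hb).ae_hasDerivAt_integral] with x hx hxab
  have hx0 : 0 < x := ha.trans_le hxab.1
  have := (hx (by rwa [uIcc_of_le hab]) a left_mem_uIcc).const_add (F a)
  refine this.congr_of_eventuallyEq ?_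
  filter_upwards [Ioi_mem_nhds hx0] with y hy
  exact h.eq_add ha hy

theorem of_absolutelyContinuousOnInterval (hf : LocallyIntegrableOn f (Ioi 0))
    (hF : ∀ a b : ℝ, 0 < a → a ≤ b → AbsolutelyContinuousOnInterval F a b)
    (h : ∀ᵐ x : ℝ, 0 < x → HasDerivAt F (f x) x) : IsLocalPrimitive f F := by
  refine ⟨hf, fun a b ha hb => ?_⟩
  refine integral_eq_sub_of_absolutelyContinuousOnInterval ?_
    (intervalIntegrable_of_locallyIntegrableOn hf ha hb) ?_
  · rcases le_total a b with hab | hab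
    · exact hF a b ha hab
    · exact (hF b a hb hab).symm
  · filter_upwards [h] with x hx hxab
    exact hx (uIcc_subset_Ioi ha hb hxab)

theorem continuousOn (h : IsLocalPrimitive f F) : ContinuousOn F (Ioi 0) := by
  intro x hx
  have hx : 0 < x := hx
  have h1 := (h.absolutelyContinuousOnInterval (half_pos hx) (mul_pos two_pos hx)).continuousOn
  refine (h1.continuousAt ?_).continuousWithinAt
  rw [uIcc_of_le (by linarith)]
  exact Icc_mem_nhds (by linarith) (by linarith)

theorem hasDerivAt (h : IsLocalPrimitive f F) (hf : ContinuousOn f (Ioi 0)) {x : ℝ} (hx : 0 < x) :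
    HasDerivAt F (f x) x := by
  have h1 : HasDerivAt (fun y => F x + ∫ t in x..y, f t) (f x) x := by
    refine (intervalIntegral.integral_hasDerivAt_right IntervalIntegrable.refl ?_ ?_).const_add _
    · exact hf.stronglyMeasurableAtFilter isOpen_Ioi x hx
    · exact hf.continuousAt (Ioi_mem_nhds hx)
  refine h1.congr_of_eventuallyEq ?_
  filter_upwards [Ioi_mem_nhds hx] with y hy
  exact h.eq_add hx hy

theorem of_hasDerivAt (hF : ∀ x : ℝ, 0 < x → HasDerivAt F (f x) x) (hf : ContinuousOn f (Ioi 0)) :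
    IsLocalPrimitive f F := by
  refine ⟨hf.locallyIntegrableOn measurableSet_Ioi, fun a b ha hb => ?_⟩
  refine (intervalIntegral.integral_eq_sub_of_hasDerivAt
    (fun x hx => hF x (uIcc_subset_Ioi ha hb hx)) ?_).symm
  exact (hf.mono (uIcc_subset_Ioi ha hb)).intervalIntegrable

theorem congr (h : IsLocalPrimitive f F) (hf : EqOn f g (Ioi 0)) (hF : EqOn F G (Ioi 0)) :
    IsLocalPrimitive g G := by
  refine ⟨?_, fun a b ha hb => ?_⟩
  · exact h.1.congr ((ae_restrict_iff' measurableSet_Ioi).2 (Eventually.of_forall hf))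
  · rw [← hF ha, ← hF hb, h.2 a b ha hb]
    exact intervalIntegral.integral_congr fun x hx => hf (uIcc_subset_Ioi ha hb hx)

theorem add (h : IsLocalPrimitive f F) (h' : IsLocalPrimitive g G) :
    IsLocalPrimitive (fun x => f x + g x) (fun x => F x + G x) := by
  refine ⟨h.1.add h'.1, fun a b ha hb => ?_⟩
  rw [intervalIntegral.integral_add (h.intervalIntegrable ha hb) (h'.intervalIntegrable ha hb),
    ← h.2 a b ha hb, ← h'.2 a b ha hb]
  ring

theorem const_mul (c : ℂ) (h : IsLocalPrimitive f F) :
    IsLocalPrimitive (fun x => c * f x) (fun x => c * F x) := by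
  refine ⟨?_, fun a b ha hb => ?_⟩
  · exact h.1.smul c
  rw [intervalIntegral.integral_const_mul, ← h.2 a b ha hb]
  ring

/-- The product rule for densities that are merely locally integrable; variation of parameters and
the Wronskian identities rest on it. -/
theorem mul (h : IsLocalPrimitive f F) (h' : IsLocalPrimitive g G) :
    IsLocalPrimitive (fun x => f x * G x + F x * g x) (fun x => F x * G x) := by
  refine of_absolutelyContinuousOnInterval ?_ ?_ ?_
  · exact (h.1.mul_continuousOn h'.continuousOn isOpen_Ioi.isLocallyClosed).add
      (h'.1.continuousOn_mul h.continuousOn isOpen_Ioi.isLocallyClosed)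
  · intro a b ha hab
    exact (h.absolutelyContinuousOnInterval ha (ha.trans_le hab)).fun_smul
      (h'.absolutelyContinuousOnInterval ha (ha.trans_le hab))
  · filter_upwards [h.ae_hasDerivAt, h'.ae_hasDerivAt] with x h1 h2 hx
    exact (h1 hx).mul (h2 hx)

end IsLocalPrimitive


/-! ### The inhomogeneous equation, fundamental systems and variation of parameters. -/

/-- `f` with derivative `D` solves `-f'' + V f = p` on `]0,∞[`. -/
def SolvesWith (V p f D : ℝ → ℂ) : Prop :=
  IsLocalPrimitive D f ∧ IsLocalPrimitive (fun x => V x * f x - p x) D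

namespace SolvesWith

variable {V p q f g D E : ℝ → ℂ}

theorem hasDerivAt (h : SolvesWith V p f D) {x : ℝ} (hx : 0 < x) : HasDerivAt f (D x) x :=
  h.1.hasDerivAt h.2.continuousOn hx

theorem continuousOn (h : SolvesWith V p f D) : ContinuousOn f (Ioi 0) := h.1.continuousOn

theorem add (h : SolvesWith V p f D) (h' : SolvesWith V q g E) :
    SolvesWith V (fun x => p x + q x) (fun x => f x + g x) (fun x => D x + E x) :=
  ⟨h.1.add h'.1, (h.2.add h'.2).congr (fun x _ => by ring) (fun x _ => rfl)⟩

theorem const_mul (c : ℂ) (h : SolvesWith V p f D) :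
    SolvesWith V (fun x => c * p x) (fun x => c * f x) (fun x => c * D x) :=
  ⟨h.1.const_mul c, (h.2.const_mul c).congr (fun x _ => by ring) (fun x _ => rfl)⟩

theorem congr (h : SolvesWith V p f D) (hp : EqOn p q (Ioi 0)) (hf : EqOn f g (Ioi 0)) :
    SolvesWith V q g D :=
  ⟨h.1.congr (fun _ _ => rfl) hf,
    h.2.congr (fun x hx => by simp only [hp hx, hf hx]) (fun _ _ => rfl)⟩

end SolvesWith

/-- A fundamental system `u, v` of `-f'' + V f = 0` on `]0,∞[` with Wronskian `v u' - v' u = 1`,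
where near `0` the function `u` is of order `x^{1/2+ρ}` and `v` of order `x^{1/2-ρ}`. -/
structure FundamentalSystem (ρ : ℝ) (V u v u' v' : ℝ → ℂ) : Prop where
  nonneg : 0 ≤ ρ
  continuousOn_potential : ContinuousOn V (Ioi 0)
  hasDerivAt_u : ∀ x : ℝ, 0 < x → HasDerivAt u (u' x) x
  hasDerivAt_v : ∀ x : ℝ, 0 < x → HasDerivAt v (v' x) x
  hasDerivAt_u' : ∀ x : ℝ, 0 < x → HasDerivAt u' (V x * u x) x
  hasDerivAt_v' : ∀ x : ℝ, 0 < x → HasDerivAt v' (V x * v x) x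
  wronskian : ∀ x : ℝ, 0 < x → v x * u' x - v' x * u x = 1
  bound : ∀ X : ℝ, ∃ C : ℝ, 0 ≤ C ∧ ∀ x ∈ Ioc 0 X,
    ‖u x‖ ≤ C * x ^ (1 / 2 + ρ) ∧ ‖u' x‖ ≤ C * x ^ (-1 / 2 + ρ) ∧
    ‖v x‖ ≤ C * x ^ (1 / 2 - ρ) ∧ ‖v' x‖ ≤ C * x ^ (-1 / 2 - ρ)

/-- `p` is locally integrable on `]0,∞[` and `x^{1/2-ρ} p` is integrable near `0`. -/
def Admissible (ρ : ℝ) (p : ℝ → ℂ) : Prop :=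
  LocallyIntegrableOn p (Ioi 0) ∧ IntegrableOn (fun y : ℝ => y ^ (1 / 2 - ρ) * ‖p y‖) (Ioc 0 1)

theorem continuousOn_rpow_Ioi (s : ℝ) : ContinuousOn (fun y : ℝ => y ^ s) (Ioi 0) :=
  fun x hx => (Real.continuousAt_rpow_const x s (Or.inl (ne_of_gt hx))).continuousWithinAt

theorem integrableOn_rpow_mul_norm {p : ℝ → ℂ} {s : ℝ} (hp : LocallyIntegrableOn p (Ioi 0))
    (h : IntegrableOn (fun y : ℝ => y ^ s * ‖p y‖) (Ioc 0 1)) (X : ℝ) :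
    IntegrableOn (fun y : ℝ => y ^ s * ‖p y‖) (Ioc 0 X) := by
  have h1 : IntegrableOn (fun y : ℝ => y ^ s * ‖p y‖) (Icc 1 (max 1 X)) := by
    have h2 : Icc 1 (max 1 X) ⊆ Ioi (0 : ℝ) := fun y hy => lt_of_lt_of_le one_pos hy.1
    exact IntegrableOn.continuousOn_mul ((continuousOn_rpow_Ioi s).mono h2)
      (hp.integrableOn_compact_subset h2 isCompact_Icc).norm isCompact_Icc
  refine (h.union h1).mono_set fun y hy => ?_
  rcases le_total y 1 with hy1 | hy1
  · exact Or.inl ⟨hy.1, hy1⟩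
  · exact Or.inr ⟨hy1, hy.2.trans (le_max_right _ _)⟩

theorem Admissible.integrableOn {ρ : ℝ} {p : ℝ → ℂ} (hp : Admissible ρ p) (X : ℝ) :
    IntegrableOn (fun y : ℝ => y ^ (1 / 2 - ρ) * ‖p y‖) (Ioc 0 X) :=
  integrableOn_rpow_mul_norm hp.1 hp.2 X

theorem Admissible.add {ρ : ℝ} {p q : ℝ → ℂ} (hp : Admissible ρ p) (hq : Admissible ρ q) :
    Admissible ρ (fun x => p x + q x) := by
  have hm := (hp.1.add hq.1).aestronglyMeasurable.mono_measure
    (Measure.restrict_mono (Ioc_subset_Ioi_self : Ioc (0 : ℝ) 1 ⊆ Ioi 0) le_rfl)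
  refine ⟨hp.1.add hq.1, (hp.2.add hq.2).mono' (AEStronglyMeasurable.mul ?_ hm.norm) ?_⟩
  · exact ((continuousOn_rpow_Ioi _).mono Ioc_subset_Ioi_self).aestronglyMeasurable
      measurableSet_Ioc
  · refine (ae_restrict_iff' measurableSet_Ioc).2 (Eventually.of_forall fun y hy => ?_)
    have h0 : (0 : ℝ) ≤ y ^ (1 / 2 - ρ) := Real.rpow_nonneg hy.1.le _
    rw [Real.norm_of_nonneg (mul_nonneg h0 (norm_nonneg _)), Pi.add_apply, ← mul_add]
    exact mul_le_mul_of_nonneg_left (norm_add_le _ _) h0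

theorem Admissible.const_mul {ρ : ℝ} {p : ℝ → ℂ} (c : ℂ) (hp : Admissible ρ p) :
    Admissible ρ (fun x => c * p x) := by
  refine ⟨hp.1.smul c, ?_⟩
  have := hp.2.const_mul ‖c‖
  refine this.congr (Eventually.of_forall fun y => ?_)
  simp only [norm_mul]; ring

/-- The solution of `-f'' + V f = p` given by the forward Green operator. -/
noncomputable def forwardOp (u v p : ℝ → ℂ) (x : ℝ) : ℂ :=
  v x * (∫ y in (0 : ℝ)..x, u y * p y) - u x * ∫ y in (0 : ℝ)..x, v y * p y

/-- Trades the weight of `u` for that of `v`, so that one integrability condition controls both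
integrals in the forward operator. The factor `x^{2ρ}` later turns the size of the outer `v x` into
that of `u x`. -/
theorem rpow_half_add_le {ρ y x : ℝ} (hρ : 0 ≤ ρ) (hy : 0 < y) (hyx : y ≤ x) :
    y ^ (1 / 2 + ρ) ≤ x ^ (2 * ρ) * y ^ (1 / 2 - ρ) := by
  have : y ^ (1 / 2 + ρ) = y ^ (2 * ρ) * y ^ (1 / 2 - ρ) := by
    rw [← Real.rpow_add hy]; congr 1; ring
  rw [this]
  gcongr

namespace FundamentalSystem

variable {ρ : ℝ} {V u v u' v' : ℝ → ℂ}

theorem continuousOn_u (S : FundamentalSystem ρ V u v u' v') : ContinuousOn u (Ioi 0) :=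
  fun x hx => (S.hasDerivAt_u x hx).continuousAt.continuousWithinAt

theorem continuousOn_v (S : FundamentalSystem ρ V u v u' v') : ContinuousOn v (Ioi 0) :=
  fun x hx => (S.hasDerivAt_v x hx).continuousAt.continuousWithinAt

theorem continuousOn_u' (S : FundamentalSystem ρ V u v u' v') : ContinuousOn u' (Ioi 0) :=
  fun x hx => (S.hasDerivAt_u' x hx).continuousAt.continuousWithinAt

theorem continuousOn_v' (S : FundamentalSystem ρ V u v u' v') : ContinuousOn v' (Ioi 0) :=
  fun x hx => (S.hasDerivAt_v' x hx).continuousAt.continuousWithinAt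

theorem primitive_u (S : FundamentalSystem ρ V u v u' v') : IsLocalPrimitive u' u :=
  .of_hasDerivAt S.hasDerivAt_u S.continuousOn_u'

theorem primitive_v (S : FundamentalSystem ρ V u v u' v') : IsLocalPrimitive v' v :=
  .of_hasDerivAt S.hasDerivAt_v S.continuousOn_v'

theorem primitive_u' (S : FundamentalSystem ρ V u v u' v') :
    IsLocalPrimitive (fun x => V x * u x) u' :=
  .of_hasDerivAt S.hasDerivAt_u' (S.continuousOn_potential.mul S.continuousOn_u)

theorem primitive_v' (S : FundamentalSystem ρ V u v u' v') :
    IsLocalPrimitive (fun x => V x * v x) v' :=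
  .of_hasDerivAt S.hasDerivAt_v' (S.continuousOn_potential.mul S.continuousOn_v)

/-- Variation of parameters. -/
theorem solvesWith (S : FundamentalSystem ρ V u v u' v') {p A B : ℝ → ℂ}
    (hA : IsLocalPrimitive (fun x => u x * p x) A)
    (hB : IsLocalPrimitive (fun x => -(v x * p x)) B) :
    SolvesWith V p (fun x => v x * A x + u x * B x) (fun x => v' x * A x + u' x * B x) := by
  refine ⟨((S.primitive_v.mul hA).add (S.primitive_u.mul hB)).congr (fun x _ => by ring)
    (fun _ _ => rfl), ((S.primitive_v'.mul hA).add (S.primitive_u'.mul hB)).congr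
    (fun x hx => ?_) (fun _ _ => rfl)⟩
  have := S.wronskian x hx
  linear_combination (-p x) * this

theorem integrableOn_mul {w p : ℝ → ℂ} {X C : ℝ} (hw : ContinuousOn w (Ioi 0))
    (hC : ∀ x ∈ Ioc 0 X, ‖w x‖ ≤ C * x ^ (1 / 2 - ρ)) (hp : Admissible ρ p) :
    IntegrableOn (fun y => w y * p y) (Ioc 0 X) := by
  have hs : Ioc 0 X ⊆ Ioi 0 := Ioc_subset_Ioi_self
  refine Integrable.mono' ((hp.integrableOn X).const_mul C)
    (((hw.mono hs).aestronglyMeasurable measurableSet_Ioc).mul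
      (hp.1.aestronglyMeasurable.mono_measure (Measure.restrict_mono hs le_rfl))) ?_
  refine (ae_restrict_iff' measurableSet_Ioc).2 (Eventually.of_forall fun y hy => ?_)
  rw [norm_mul, ← mul_assoc]
  exact mul_le_mul_of_nonneg_right (hC y hy) (norm_nonneg _)

theorem integrableOn_u_mul (S : FundamentalSystem ρ V u v u' v') {p : ℝ → ℂ}
    (hp : Admissible ρ p) (X : ℝ) : IntegrableOn (fun y => u y * p y) (Ioc 0 X) := by
  obtain ⟨C, hC, h⟩ := S.bound X
  refine integrableOn_mul (C := C * X ^ (2 * ρ)) S.continuousOn_u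
    (fun x hx => (h x hx).1.trans ?_) hp
  rw [mul_assoc]
  exact mul_le_mul_of_nonneg_left (rpow_half_add_le S.nonneg hx.1 hx.2) hC

theorem integrableOn_v_mul (S : FundamentalSystem ρ V u v u' v') {p : ℝ → ℂ}
    (hp : Admissible ρ p) (X : ℝ) : IntegrableOn (fun y => v y * p y) (Ioc 0 X) := by
  obtain ⟨C, hC, h⟩ := S.bound X
  exact integrableOn_mul S.continuousOn_v (fun x hx => (h x hx).2.2.1) hp

end FundamentalSystem

/-! ### The forward Green operator and its behaviour at the origin. -/

theorem isLocalPrimitive_integral_zero {f : ℝ → ℂ} (hf : ∀ X : ℝ, IntegrableOn f (Ioc 0 X)) :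
    IsLocalPrimitive f (fun x => ∫ y in (0 : ℝ)..x, f y) := by
  have h : ∀ X : ℝ, 0 < X → IntervalIntegrable f volume 0 X := fun X hX =>
    (intervalIntegrable_iff_integrableOn_Ioc_of_le hX.le).2 (hf X)
  refine ⟨(locallyIntegrableOn_iff isOpen_Ioi.isLocallyClosed).2 fun K hK hKc => ?_,
    fun a b ha hb => intervalIntegral.integral_interval_sub_left (h b hb) (h a ha)⟩
  obtain ⟨X, hX⟩ := hKc.bddAbove
  exact (hf X).mono_set fun y hy => ⟨hK hy, hX hy⟩

theorem tendsto_integral_zero {E : Type*} [NormedAddCommGroup E] [NormedSpace ℝ E]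
    {q : ℝ → E} {X : ℝ} (hX : 0 < X) (hq : IntegrableOn q (Ioc 0 X)) :
    Tendsto (fun x : ℝ => ∫ y in (0 : ℝ)..x, q y) (𝓝[>] 0) (𝓝 0) := by
  have h := intervalIntegral.continuousOn_primitive_interval (f := q) (μ := volume) (a := 0) (b := X)
    (by rw [uIcc_of_le hX.le]; exact (integrableOn_Icc_iff_integrableOn_Ioc).2 hq)
  have h0 := h 0 left_mem_uIcc
  rw [ContinuousWithinAt, intervalIntegral.integral_same] at h0
  refine h0.mono_left ?_
  rw [uIcc_of_le hX.le]
  exact nhdsWithin_le_of_mem (mem_of_superset (Ioc_mem_nhdsGT hX) Ioc_subset_Icc_self)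

namespace FundamentalSystem

variable {ρ : ℝ} {V u v u' v' : ℝ → ℂ}

theorem solvesWith_forwardOp (S : FundamentalSystem ρ V u v u' v') {p : ℝ → ℂ}
    (hp : Admissible ρ p) : SolvesWith V p (forwardOp u v p) (fun x =>
      v' x * (∫ y in (0 : ℝ)..x, u y * p y) - u' x * ∫ y in (0 : ℝ)..x, v y * p y) := by
  have h := S.solvesWith (isLocalPrimitive_integral_zero (S.integrableOn_u_mul hp))
    (((isLocalPrimitive_integral_zero (S.integrableOn_v_mul hp)).const_mul (-1)).congr
      (g := fun x => -(v x * p x)) (fun x _ => by simp) (fun _ _ => rfl))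
  simp only [neg_one_mul, mul_neg, ← sub_eq_add_neg] at h
  exact h

/-- Weighted bounds for the forward Green operator, uniform on bounded intervals. -/
theorem forwardOp_bound (S : FundamentalSystem ρ V u v u' v') (X : ℝ) :
    ∃ C : ℝ, 0 ≤ C ∧ ∀ x ∈ Ioc 0 X, ∀ (p : ℝ → ℂ) (q : ℝ → ℝ), IntegrableOn q (Ioc 0 x) →
      (∀ᵐ y ∂volume.restrict (Ioc 0 x), y ^ (1 / 2 - ρ) * ‖p y‖ ≤ q y) →
      ‖forwardOp u v p x‖ ≤ C * x ^ (1 / 2 + ρ) * (∫ y in (0 : ℝ)..x, q y) ∧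
      ‖v' x * (∫ y in (0 : ℝ)..x, u y * p y) - u' x * ∫ y in (0 : ℝ)..x, v y * p y‖ ≤
        C * x ^ (-1 / 2 + ρ) * (∫ y in (0 : ℝ)..x, q y) := by
  obtain ⟨C, hC, h⟩ := S.bound X
  -- Two summands, each with one factor `C` from the solution outside the integral and one from the
  -- solution inside.
  refine ⟨2 * C ^ 2, by positivity, fun x hx p q hq hpq => ?_⟩
  have hx0 : 0 < x := hx.1
  have hqi : IntervalIntegrable q volume 0 x :=
    (intervalIntegrable_iff_integrableOn_Ioc_of_le hx0.le).2 hq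
  have hu : ‖∫ y in (0 : ℝ)..x, u y * p y‖ ≤ C * x ^ (2 * ρ) * ∫ y in (0 : ℝ)..x, q y := by
    rw [← intervalIntegral.integral_const_mul]
    refine intervalIntegral.norm_integral_le_of_norm_le hx0.le ?_ (hqi.const_mul _)
    filter_upwards [(ae_restrict_iff' measurableSet_Ioc).1 hpq] with y hy hyx
    rw [norm_mul]
    calc ‖u y‖ * ‖p y‖ ≤ (C * (x ^ (2 * ρ) * y ^ (1 / 2 - ρ))) * ‖p y‖ := by
          refine mul_le_mul_of_nonneg_right ((h y ⟨hyx.1, hyx.2.trans hx.2⟩).1.trans ?_)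
            (norm_nonneg _)
          exact mul_le_mul_of_nonneg_left (rpow_half_add_le S.nonneg hyx.1 hyx.2) hC
      _ = C * x ^ (2 * ρ) * (y ^ (1 / 2 - ρ) * ‖p y‖) := by ring
      _ ≤ _ := mul_le_mul_of_nonneg_left (hy hyx) (by positivity)
  have hv : ‖∫ y in (0 : ℝ)..x, v y * p y‖ ≤ C * ∫ y in (0 : ℝ)..x, q y := by
    rw [← intervalIntegral.integral_const_mul]
    refine intervalIntegral.norm_integral_le_of_norm_le hx0.le ?_ (hqi.const_mul _)
    filter_upwards [(ae_restrict_iff' measurableSet_Ioc).1 hpq] with y hy hyx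
    rw [norm_mul]
    calc ‖v y‖ * ‖p y‖ ≤ (C * y ^ (1 / 2 - ρ)) * ‖p y‖ :=
          mul_le_mul_of_nonneg_right (h y ⟨hyx.1, hyx.2.trans hx.2⟩).2.2.1 (norm_nonneg _)
      _ = C * (y ^ (1 / 2 - ρ) * ‖p y‖) := by ring
      _ ≤ _ := mul_le_mul_of_nonneg_left (hy hyx) hC
  obtain ⟨h1, h2, h3, h4⟩ := h x hx
  have e1 : x ^ (1 / 2 - ρ) * x ^ (2 * ρ) = x ^ (1 / 2 + ρ) := by
    rw [← Real.rpow_add hx0]; congr 1; ring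
  have e2 : x ^ (-1 / 2 - ρ) * x ^ (2 * ρ) = x ^ (-1 / 2 + ρ) := by
    rw [← Real.rpow_add hx0]; congr 1; ring
  constructor
  · calc _ ≤ ‖v x‖ * ‖∫ y in (0 : ℝ)..x, u y * p y‖ + ‖u x‖ * ‖∫ y in (0 : ℝ)..x, v y * p y‖ := by
          rw [forwardOp, ← norm_mul, ← norm_mul]; exact norm_sub_le _ _
      _ ≤ (C * x ^ (1 / 2 - ρ)) * (C * x ^ (2 * ρ) * ∫ y in (0 : ℝ)..x, q y) +
          (C * x ^ (1 / 2 + ρ)) * (C * ∫ y in (0 : ℝ)..x, q y) := by gcongr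
      _ = _ := by rw [← e1]; ring
  · calc _ ≤ ‖v' x‖ * ‖∫ y in (0 : ℝ)..x, u y * p y‖ +
            ‖u' x‖ * ‖∫ y in (0 : ℝ)..x, v y * p y‖ := by
          rw [← norm_mul, ← norm_mul]; exact norm_sub_le _ _
      _ ≤ (C * x ^ (-1 / 2 - ρ)) * (C * x ^ (2 * ρ) * ∫ y in (0 : ℝ)..x, q y) +
          (C * x ^ (-1 / 2 + ρ)) * (C * ∫ y in (0 : ℝ)..x, q y) := by gcongr
      _ = _ := by rw [← e2]; ring

/-- The bound of `forwardOp_bound` contains `∫₀ˣ y^{1/2-ρ}‖p‖`, which tends to zero; this turns big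
O into little o. -/
theorem forwardOp_isLittleO (S : FundamentalSystem ρ V u v u' v') {p : ℝ → ℂ}
    (hp : Admissible ρ p) :
    (forwardOp u v p =o[𝓝[>] (0 : ℝ)] fun x : ℝ => x ^ (1 / 2 + ρ)) ∧
    ((fun x => v' x * (∫ y in (0 : ℝ)..x, u y * p y) - u' x * ∫ y in (0 : ℝ)..x, v y * p y)
      =o[𝓝[>] (0 : ℝ)] fun x : ℝ => x ^ (-1 / 2 + ρ)) := by
  obtain ⟨C, hC, h⟩ := S.forwardOp_bound 1
  have ht := (tendsto_integral_zero one_pos (hp.integrableOn 1)).const_mul C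
  rw [mul_zero] at ht
  have key : ∀ (f : ℝ → ℂ) (s : ℝ), (∀ x ∈ Ioc (0 : ℝ) 1, ‖f x‖ ≤
      C * x ^ s * ∫ y in (0 : ℝ)..x, y ^ (1 / 2 - ρ) * ‖p y‖) →
      f =o[𝓝[>] (0 : ℝ)] fun x : ℝ => x ^ s := by
    intro f s hf
    rw [isLittleO_iff]
    intro c hc
    filter_upwards [Ioc_mem_nhdsGT one_pos, ht.eventually (gt_mem_nhds hc)] with x hx hxc
    refine (hf x hx).trans ?_
    have : (0 : ℝ) ≤ x ^ s := Real.rpow_nonneg hx.1.le _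
    rw [Real.norm_of_nonneg this, mul_right_comm]
    exact mul_le_mul_of_nonneg_right hxc.le this
  have hb : ∀ x ∈ Ioc (0 : ℝ) 1, _ := fun x hx =>
    h x hx p _ (hp.integrableOn x) (Eventually.of_forall fun y => le_rfl)
  exact ⟨key _ _ fun x hx => (hb x hx).1, key _ _ fun x hx => (hb x hx).2⟩

end FundamentalSystem


/-! ### Volterra equations: factorial bounds, uniqueness and the Neumann series. -/

theorem integral_mul_primitive_pow {q : ℝ → ℝ} {x : ℝ} (hq : IntervalIntegrable q volume 0 x)
    (j : ℕ) : ∫ y in (0 : ℝ)..x, q y * (∫ t in (0 : ℝ)..y, q t) ^ j =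
      (∫ y in (0 : ℝ)..x, q y) ^ (j + 1) / (j + 1) := by
  set H : ℝ → ℝ := fun y => ∫ t in (0 : ℝ)..y, q t with hH
  -- Since `q` is only integrable, `H ^ (j + 1)` is differentiable only almost everywhere, and the
  -- fundamental theorem is applied to it as an absolutely continuous function. This identity is the
  -- source of the `1/j!` in the iteration.
  have hac : AbsolutelyContinuousOnInterval H 0 x :=
    hq.absolutelyContinuousOnInterval_intervalIntegral left_mem_uIcc
  have hpow : ∀ i : ℕ, AbsolutelyContinuousOnInterval (fun y => H y ^ (i + 1)) 0 x := by
    intro i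
    induction i with
    | zero => simpa using hac
    | succ i ih => simpa only [pow_succ] using ih.fun_mul hac
  have h1 := (hpow j).integral_deriv_eq_sub
  have h2 : ∫ y in (0 : ℝ)..x, deriv (fun y => H y ^ (j + 1)) y =
      ∫ y in (0 : ℝ)..x, ((j : ℝ) + 1) * (q y * H y ^ j) := by
    refine intervalIntegral.integral_congr_ae ?_
    filter_upwards [hq.ae_hasDerivAt_integral] with y hy hyx
    have := (hy (uIoc_subset_uIcc hyx) 0 left_mem_uIcc).pow (j + 1)
    rw [show (fun y => H y ^ (j + 1)) = (fun x => ∫ t in (0 : ℝ)..x, q t) ^ (j + 1) from rfl,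
      this.deriv]
    simp only [hH, Nat.add_sub_cancel]
    push_cast
    ring
  rw [h2, intervalIntegral.integral_const_mul] at h1
  have h0 : H 0 = 0 := intervalIntegral.integral_same
  rw [h0, zero_pow (Nat.succ_ne_zero j), sub_zero] at h1
  rw [eq_div_iff (by positivity), ← h1, mul_comm]

/-- The function `∫₀ˣ y |Q(y)| dy`. -/
noncomputable def potentialMass (Q : ℝ → ℂ) (x : ℝ) : ℝ := ∫ y in (0 : ℝ)..x, y * ‖Q y‖

theorem intervalIntegrable_mul_norm {Q : ℝ → ℂ}
    (hQ : ∀ X : ℝ, IntegrableOn (fun y => y * ‖Q y‖) (Ioc 0 X)) {x : ℝ} (hx : 0 < x) :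
    IntervalIntegrable (fun y => y * ‖Q y‖) volume 0 x :=
  (intervalIntegrable_iff_integrableOn_Ioc_of_le hx.le).2 (hQ x)

theorem potentialMass_nonneg {Q : ℝ → ℂ} {x : ℝ} (hx : 0 < x) : 0 ≤ potentialMass Q x :=
  intervalIntegral.integral_nonneg hx.le fun _ hy => mul_nonneg hy.1 (norm_nonneg _)

theorem potentialMass_mono {Q : ℝ → ℂ}
    (hQ : ∀ X : ℝ, IntegrableOn (fun y => y * ‖Q y‖) (Ioc 0 X)) {x y : ℝ} (hx : 0 < x) (hxy : x ≤ y) :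
    potentialMass Q x ≤ potentialMass Q y := by
  refine intervalIntegral.integral_mono_interval le_rfl hx.le hxy ?_
    (intervalIntegrable_mul_norm hQ (hx.trans_le hxy))
  refine (ae_restrict_iff' measurableSet_Ioc).2 (Eventually.of_forall fun y hy => ?_)
  exact mul_nonneg hy.1.le (norm_nonneg _)

theorem intervalIntegrable_mul_potentialMass_pow {Q : ℝ → ℂ}
    (hQ : ∀ X : ℝ, IntegrableOn (fun y => y * ‖Q y‖) (Ioc 0 X)) {x : ℝ} (hx : 0 < x) (j : ℕ) :
    IntervalIntegrable (fun y => y * ‖Q y‖ * potentialMass Q y ^ j) volume 0 x := by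
  refine (intervalIntegrable_mul_norm hQ hx).mul_continuousOn (ContinuousOn.pow ?_ j)
  exact intervalIntegral.continuousOn_primitive_interval
    (by rw [uIcc_of_le hx.le]; exact (integrableOn_Icc_iff_integrableOn_Ioc).2 (hQ x))

namespace FundamentalSystem

variable {ρ : ℝ} {V u v u' v' Q : ℝ → ℂ}

/-- The weights `y^{1/2-ρ}` and `y^{1/2+ρ}` multiply to `y`, so on functions of the size of `u` only
`∫ y|Q|` matters. -/
theorem rpow_mul_norm_mul_le {M y b : ℝ} {f : ℝ → ℂ} (hy : 0 < y)
    (h : ‖f y‖ ≤ M * y ^ (1 / 2 + ρ) * b) :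
    y ^ (1 / 2 - ρ) * ‖Q y * f y‖ ≤ M * (y * ‖Q y‖ * b) := by
  have e : y ^ (1 / 2 - ρ) * y ^ (1 / 2 + ρ) = y := by
    rw [← Real.rpow_add hy]; ring_nf; exact Real.rpow_one y
  have h0 : 0 ≤ y ^ (1 / 2 - ρ) * ‖Q y‖ := mul_nonneg (Real.rpow_nonneg hy.le _) (norm_nonneg _)
  calc y ^ (1 / 2 - ρ) * ‖Q y * f y‖ = y ^ (1 / 2 - ρ) * ‖Q y‖ * ‖f y‖ := by rw [norm_mul]; ring
    _ ≤ y ^ (1 / 2 - ρ) * ‖Q y‖ * (M * y ^ (1 / 2 + ρ) * b) := mul_le_mul_of_nonneg_left h h0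
    _ = M * ((y ^ (1 / 2 - ρ) * y ^ (1 / 2 + ρ)) * ‖Q y‖ * b) := by ring
    _ = _ := by rw [e]

/-- One step of the Volterra iteration. -/
theorem forwardOp_iterate_bound (S : FundamentalSystem ρ V u v u' v')
    (hQ : ∀ X : ℝ, IntegrableOn (fun y => y * ‖Q y‖) (Ioc 0 X)) (X : ℝ) :
    ∃ C : ℝ, 0 ≤ C ∧ ∀ x ∈ Ioc 0 X, ∀ (f : ℝ → ℂ) (M : ℝ) (j : ℕ),
      (∀ᵐ y ∂volume.restrict (Ioc 0 x),
        ‖f y‖ ≤ M * y ^ (1 / 2 + ρ) * ((C * potentialMass Q y) ^ j / j.factorial)) →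
      ‖forwardOp u v (fun y => Q y * f y) x‖ ≤
        M * x ^ (1 / 2 + ρ) * ((C * potentialMass Q x) ^ (j + 1) / (j + 1).factorial) := by
  obtain ⟨C, hC, h⟩ := S.forwardOp_bound X
  refine ⟨C, hC, fun x hx f M j hf => ?_⟩
  have hi := intervalIntegrable_mul_potentialMass_pow hQ hx.1 j
  have hi' := (intervalIntegrable_iff_integrableOn_Ioc_of_le hx.1.le).1
    (hi.const_mul (M * (C ^ j / j.factorial)))
  refine (h x hx _ _ hi' ?_).1.trans_eq ?_
  · filter_upwards [hf, ae_restrict_mem measurableSet_Ioc] with y hy hyx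
    refine (rpow_mul_norm_mul_le hyx.1 hy).trans_eq ?_
    rw [mul_pow]; ring
  · rw [intervalIntegral.integral_const_mul]
    have := integral_mul_primitive_pow (intervalIntegrable_mul_norm hQ hx.1) j
    simp only [potentialMass] at this ⊢
    rw [this, Nat.factorial_succ]
    have : (j.factorial : ℝ) ≠ 0 := by positivity
    push_cast
    field_simp
    ring

/-- A weighted bounded solution of the homogeneous Volterra equation vanishes. -/
theorem eq_zero_of_eq_neg_forwardOp (S : FundamentalSystem ρ V u v u' v')
    (hQ : ∀ X : ℝ, IntegrableOn (fun y => y * ‖Q y‖) (Ioc 0 X)) {X M : ℝ} {d : ℝ → ℂ}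
    (hM : ∀ᵐ y ∂volume.restrict (Ioo 0 X), ‖d y‖ ≤ M * y ^ (1 / 2 + ρ))
    (hd : ∀ x ∈ Ioo 0 X, d x = -forwardOp u v (fun y => Q y * d y) x) :
    ∀ x ∈ Ioo 0 X, d x = 0 := by
  obtain ⟨C, hC, h⟩ := S.forwardOp_iterate_bound hQ X
  -- A bound almost everywhere suffices, as it is only used under an integral; at the end the
  -- equation itself gives the estimate at every point.
  have hb : ∀ j : ℕ, ∀ᵐ y ∂volume.restrict (Ioo 0 X),
      ‖d y‖ ≤ M * y ^ (1 / 2 + ρ) * ((C * potentialMass Q y) ^ j / j.factorial) := by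
    intro j
    induction j with
    | zero => simpa using hM
    | succ j ih =>
      filter_upwards [ae_restrict_mem measurableSet_Ioo] with x hx
      rw [hd x hx, norm_neg]
      refine h x ⟨hx.1, hx.2.le⟩ d M j ?_
      exact ae_restrict_of_ae_restrict_of_subset
        (Ioc_subset_Ioo_right hx.2) ih
  intro x hx
  have hlim : Tendsto (fun j : ℕ => M * x ^ (1 / 2 + ρ) *
      ((C * potentialMass Q x) ^ (j + 1) / (j + 1).factorial)) atTop (𝓝 0) := by
    have := ((FloorSemiring.tendsto_pow_div_factorial_atTop
      (C * potentialMass Q x)).comp (tendsto_add_atTop_nat 1)).const_mul (M * x ^ (1 / 2 + ρ))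
    simpa using this
  refine norm_le_zero_iff.1 (ge_of_tendsto' hlim fun j => ?_)
  rw [hd x hx, norm_neg]
  exact h x ⟨hx.1, hx.2.le⟩ d M j (ae_restrict_of_ae_restrict_of_subset
    (Ioc_subset_Ioo_right hx.2) (hb j))

theorem admissible_mul {f : ℝ → ℂ} (hQl : LocallyIntegrableOn Q (Ioi 0))
    (hQ : ∀ X : ℝ, IntegrableOn (fun y => y * ‖Q y‖) (Ioc 0 X)) (hf : ContinuousOn f (Ioi 0))
    {M : ℝ} (hM : ∀ x ∈ Ioc (0 : ℝ) 1, ‖f x‖ ≤ M * x ^ (1 / 2 + ρ)) :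
    Admissible ρ (fun y => Q y * f y) := by
  have hl := hQl.mul_continuousOn hf isOpen_Ioi.isLocallyClosed
  have hs : Ioc (0 : ℝ) 1 ⊆ Ioi 0 := Ioc_subset_Ioi_self
  refine ⟨hl, ((hQ 1).const_mul M).mono' ?_ ?_⟩
  · exact (((continuousOn_rpow_Ioi _).mono hs).aestronglyMeasurable measurableSet_Ioc).mul
      (hl.aestronglyMeasurable.mono_measure (Measure.restrict_mono hs le_rfl)).norm
  · filter_upwards [ae_restrict_mem measurableSet_Ioc] with y hy
    rw [Real.norm_of_nonneg (mul_nonneg (Real.rpow_nonneg hy.1.le _) (norm_nonneg _))]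
    simpa using rpow_mul_norm_mul_le (Q := Q) (b := 1) hy.1 (by simpa using hM y hy)

/-- The Volterra equation `r + G_→ Q r = F` is solvable in the weighted space. -/
theorem exists_eq_sub_forwardOp (S : FundamentalSystem ρ V u v u' v')
    (hQl : LocallyIntegrableOn Q (Ioi 0))
    (hQ : ∀ X : ℝ, IntegrableOn (fun y => y * ‖Q y‖) (Ioc 0 X)) {F : ℝ → ℂ}
    (hF : ContinuousOn F (Ioi 0))
    (hFb : ∀ X : ℝ, ∃ M : ℝ, 0 ≤ M ∧ ∀ x ∈ Ioc 0 X, ‖F x‖ ≤ M * x ^ (1 / 2 + ρ)) :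
    ∃ r : ℝ → ℂ, ContinuousOn r (Ioi 0) ∧
      (∀ X : ℝ, ∃ M : ℝ, 0 ≤ M ∧ ∀ x ∈ Ioc 0 X, ‖r x‖ ≤ M * x ^ (1 / 2 + ρ)) ∧
      ∀ x : ℝ, 0 < x → r x = F x - forwardOp u v (fun y => Q y * r y) x := by
  let R : ℕ → ℝ → ℂ := fun j =>
    (fun (f : ℝ → ℂ) (x : ℝ) => -forwardOp u v (fun y => Q y * f y) x)^[j] F
  have R0 : R 0 = F := rfl
  have Rs : ∀ j, R (j + 1) = fun x => -forwardOp u v (fun y => Q y * R j y) x := fun j =>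
    Function.iterate_succ_apply' _ _ _
  have hRb : ∀ X : ℝ, ∃ C M : ℝ, 0 ≤ C ∧ 0 ≤ M ∧ ∀ j, ∀ x ∈ Ioc 0 X,
      ‖R j x‖ ≤ M * x ^ (1 / 2 + ρ) * ((C * potentialMass Q x) ^ j / j.factorial) := by
    intro X
    obtain ⟨C, hC, h⟩ := S.forwardOp_iterate_bound hQ X
    obtain ⟨M, hM0, hM⟩ := hFb X
    refine ⟨C, M, hC, hM0, fun j => ?_⟩
    induction j with
    | zero => simpa [R0] using hM
    | succ j ih =>
      intro x hx
      rw [Rs, norm_neg]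
      refine h x hx (R j) M j ?_
      filter_upwards [ae_restrict_mem measurableSet_Ioc] with y hy
      exact ih y ⟨hy.1, hy.2.trans hx.2⟩
  -- The monotone mass is replaced by its value at `X`, which gives one exponential series as a
  -- majorant on the whole interval.
  have hRb' : ∀ X : ℝ, ∃ C M : ℝ, 0 ≤ C ∧ 0 ≤ M ∧ ∀ j, ∀ x ∈ Ioc 0 X,
      ‖R j x‖ ≤ M * x ^ (1 / 2 + ρ) * (C ^ j / j.factorial) := by
    intro X
    obtain ⟨C, M, hC, hM, h⟩ := hRb X
    rcases le_or_gt X 0 with hX | hX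
    · exact ⟨0, 0, le_rfl, le_rfl, fun j x hx => absurd (hx.1.trans_le hx.2) (not_lt.2 hX)⟩
    refine ⟨C * potentialMass Q X, M, mul_nonneg hC (potentialMass_nonneg hX), hM,
      fun j x hx => (h j x hx).trans ?_⟩
    have h1 := potentialMass_mono hQ hx.1 hx.2
    have h2 := potentialMass_nonneg (Q := Q) hx.1
    have h3 := hx.1
    gcongr
  have hsum : ∀ x : ℝ, 0 < x → Summable fun j => R j x := by
    intro x hx
    obtain ⟨C, M, -, -, h⟩ := hRb' x
    exact Summable.of_norm_bounded ((Real.summable_pow_div_factorial C).mul_left _)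
      fun j => h j x ⟨hx, le_rfl⟩
  have hRc : ∀ j, ContinuousOn (R j) (Ioi 0) ∧ Admissible ρ (fun y => Q y * R j y) := by
    have hadm : ∀ j, ContinuousOn (R j) (Ioi 0) → Admissible ρ (fun y => Q y * R j y) := by
      intro j hj
      obtain ⟨C, M, -, -, h⟩ := hRb' 1
      refine admissible_mul hQl hQ hj (M := M * (C ^ j / j.factorial)) fun x hx =>
        (h j x hx).trans_eq (by ring)
    intro j
    induction j with
    | zero => exact ⟨hF, hadm 0 hF⟩
    | succ j ih =>
      have : ContinuousOn (R (j + 1)) (Ioi 0) := by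
        rw [Rs]
        exact (S.solvesWith_forwardOp ih.2).continuousOn.neg
      exact ⟨this, hadm _ this⟩
  have hrb : ∀ X : ℝ, ∃ M : ℝ, 0 ≤ M ∧ ∀ x ∈ Ioc 0 X, ‖∑' j, R j x‖ ≤ M * x ^ (1 / 2 + ρ) := by
    intro X
    obtain ⟨C, M, hC, hM, h⟩ := hRb' X
    refine ⟨M * Real.exp C, by positivity, fun x hx => ?_⟩
    have hs := (Real.summable_pow_div_factorial C).mul_left (M * x ^ (1 / 2 + ρ))
    refine (tsum_of_norm_bounded hs.hasSum fun j => h j x hx).trans_eq ?_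
    rw [tsum_mul_left, Real.exp_eq_exp_ℝ, NormedSpace.exp_eq_tsum_div]
    ring
  have hrc : ContinuousOn (fun x => ∑' j, R j x) (Ioi 0) := by
    intro x hx
    have hx : 0 < x := hx
    obtain ⟨C, M, hC, hM, h⟩ := hRb' (x + 1)
    have := continuousOn_tsum (f := R) (s := Ioo 0 (x + 1))
      (u := fun j => M * (x + 1) ^ (1 / 2 + ρ) * (C ^ j / j.factorial))
      (fun j => (hRc j).1.mono Ioo_subset_Ioi_self)
      ((Real.summable_pow_div_factorial C).mul_left _) fun j y hy => by
        refine (h j y ⟨hy.1, hy.2.le⟩).trans ?_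
        have h1 := hy.1.le
        have h2 := hy.2.le
        have h3 := S.nonneg
        gcongr
    exact (this.continuousAt (Ioo_mem_nhds hx (lt_add_one x))).continuousWithinAt
  refine ⟨fun x => ∑' j, R j x, hrc, hrb, fun x hx => ?_⟩
  -- Dominated convergence moves the sum through both integrals (`w = u` and `w = v`); the majorants
  -- are exponential terms times `y‖Q y‖`.
  have hint : ∀ w : ℝ → ℂ, ContinuousOn w (Ioi 0) →
      (∃ K : ℝ, ∀ y ∈ Ioc 0 x, ‖w y‖ ≤ K * y ^ (1 / 2 - ρ)) →
      HasSum (fun j => ∫ y in (0 : ℝ)..x, w y * (Q y * R j y))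
        (∫ y in (0 : ℝ)..x, w y * (Q y * ∑' j, R j y)) := by
    rintro w hw ⟨K, hK⟩
    obtain ⟨C, M, hC, hM, h⟩ := hRb' x
    refine intervalIntegral.hasSum_integral_of_dominated_convergence
      (fun j y => (K * M * (C ^ j / j.factorial)) * (y * ‖Q y‖)) (fun j => ?_) (fun j => ?_)
      ?_ ?_ ?_
    · rw [uIoc_of_le hx.le]
      exact (FundamentalSystem.integrableOn_mul hw hK (hRc j).2).aestronglyMeasurable
    · refine Eventually.of_forall fun y hy => ?_
      rw [uIoc_of_le hx.le] at hy
      have h1 := rpow_mul_norm_mul_le (Q := Q) hy.1 (h j y hy)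
      have hK0 : 0 ≤ K := nonneg_of_mul_nonneg_left ((norm_nonneg _).trans (hK y hy))
        (Real.rpow_pos_of_pos hy.1 _)
      rw [norm_mul]
      calc ‖w y‖ * ‖Q y * R j y‖ ≤ K * y ^ (1 / 2 - ρ) * ‖Q y * R j y‖ :=
            mul_le_mul_of_nonneg_right (hK y hy) (norm_nonneg _)
        _ = K * (y ^ (1 / 2 - ρ) * ‖Q y * R j y‖) := by ring
        _ ≤ K * (M * (y * ‖Q y‖ * (C ^ j / j.factorial))) := mul_le_mul_of_nonneg_left h1 hK0
        _ = _ := by ring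
    · exact Eventually.of_forall fun y _ =>
        ((Real.summable_pow_div_factorial C).mul_left _).mul_right _
    · simp_rw [tsum_mul_right, tsum_mul_left]
      exact (intervalIntegrable_mul_norm hQ hx).const_mul _
    · refine Eventually.of_forall fun y hy => ?_
      rw [uIoc_of_le hx.le] at hy
      exact ((hsum y hy.1).hasSum.mul_left _).mul_left _
  have hu := hint u S.continuousOn_u (by
    obtain ⟨C, hC, h⟩ := S.bound x
    refine ⟨C * x ^ (2 * ρ), fun y hy => (h y hy).1.trans ?_⟩
    rw [mul_assoc]
    exact mul_le_mul_of_nonneg_left (rpow_half_add_le S.nonneg hy.1 hy.2) hC)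
  have hv := hint v S.continuousOn_v (by
    obtain ⟨C, hC, h⟩ := S.bound x
    exact ⟨C, fun y hy => (h y hy).2.2.1⟩)
  have hfw : HasSum (fun j => forwardOp u v (fun y => Q y * R j y) x)
      (forwardOp u v (fun y => Q y * ∑' j, R j y) x) :=
    (hu.mul_left (v x)).sub (hv.mul_left (u x))
  have h1 : ∑' j, R j x = R 0 x + ∑' j, R (j + 1) x := (hsum x hx).tsum_eq_zero_add
  simp only [Rs, R0] at h1
  simp only
  rw [h1, hfw.neg.tsum_eq, sub_eq_add_neg]

end FundamentalSystem


/-! ### Uniqueness of small solutions and correction of approximate ones. -/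

theorem exists_bound_of_isBigO {d : ℝ → ℂ} {s : ℝ} (hd : ContinuousOn d (Ioi 0))
    (h : d =O[𝓝[>] (0 : ℝ)] fun x : ℝ => x ^ s) (X : ℝ) :
    ∃ M : ℝ, 0 ≤ M ∧ ∀ x ∈ Ioc 0 X, ‖d x‖ ≤ M * x ^ s := by
  obtain ⟨c, hc⟩ := h.bound
  obtain ⟨δ, hδ, hδc⟩ := mem_nhdsGT_iff_exists_Ioc_subset.1 hc
  have hδ : 0 < δ := hδ
  have hsub : Icc δ X ⊆ Ioi 0 := fun x hx => hδ.trans_le hx.1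
  obtain ⟨K, hK⟩ := isCompact_Icc.exists_bound_of_continuousOn
    ((hd.norm.mono hsub).fun_mul ((continuousOn_rpow_Ioi (-s)).mono hsub))
  refine ⟨max (max c K) 0, le_max_right _ _, fun x hx => ?_⟩
  have hp : 0 < x ^ s := Real.rpow_pos_of_pos hx.1 s
  rcases le_total x δ with hxδ | hxδ
  · have h1 : ‖d x‖ ≤ c * ‖x ^ s‖ := hδc ⟨hx.1, hxδ⟩
    rw [Real.norm_of_nonneg hp.le] at h1
    exact h1.trans (mul_le_mul_of_nonneg_right ((le_max_left _ _).trans (le_max_left _ _)) hp.le)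
  · have h1 := (le_abs_self _).trans (hK x ⟨hxδ, hx.2⟩)
    rw [Real.rpow_neg hx.1.le, ← div_eq_mul_inv, div_le_iff₀ hp] at h1
    exact h1.trans (mul_le_mul_of_nonneg_right ((le_max_right _ _).trans (le_max_left _ _)) hp.le)

/-- The difference of the two sides is constant on the half-line and tends to zero at the origin. -/
theorem IsLocalPrimitive.eq_integral_of_tendsto {f F : ℝ → ℂ} (h : IsLocalPrimitive f F)
    (hf : ∀ X : ℝ, IntegrableOn f (Ioc 0 X)) (hF : Tendsto F (𝓝[>] 0) (𝓝 0)) {x : ℝ} (hx : 0 < x) :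
    F x = ∫ y in (0 : ℝ)..x, f y := by
  have h1 := (isLocalPrimitive_integral_zero hf).2
  have h2 : Tendsto (fun s => F x - F s - ((∫ y in (0 : ℝ)..x, f y) - ∫ y in (0 : ℝ)..s, f y))
      (𝓝[>] 0) (𝓝 (F x - 0 - ((∫ y in (0 : ℝ)..x, f y) - 0))) :=
    (hF.const_sub _).sub ((tendsto_integral_zero one_pos (hf 1)).const_sub _)
  have h3 : Tendsto (fun s => F x - F s - ((∫ y in (0 : ℝ)..x, f y) - ∫ y in (0 : ℝ)..s, f y))
      (𝓝[>] 0) (𝓝 0) := by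
    refine tendsto_const_nhds.congr' ?_
    filter_upwards [self_mem_nhdsWithin] with s hs
    rw [h.2 s x hs hx, h1 s x hs hx, sub_self]
  simpa [sub_eq_zero] using tendsto_nhds_unique h2 h3

theorem isLittleO_rpow_mul {f g : ℝ → ℂ} {s t : ℝ} (hst : 0 ≤ s + t)
    (hf : f =O[𝓝[>] (0 : ℝ)] fun x : ℝ => x ^ s) (hg : g =o[𝓝[>] (0 : ℝ)] fun x : ℝ => x ^ t) :
    Tendsto (fun x => f x * g x) (𝓝[>] 0) (𝓝 0) := by
  rw [← isLittleO_one_iff ℝ]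
  refine (hf.mul_isLittleO hg).trans_isBigO ?_
  refine IsBigO.of_bound 1 ?_
  filter_upwards [Ioc_mem_nhdsGT one_pos] with x hx
  rw [← Real.rpow_add hx.1, Real.norm_of_nonneg (Real.rpow_nonneg hx.1.le _)]
  simpa using Real.rpow_le_one hx.1.le hx.2 hst

namespace FundamentalSystem

variable {ρ : ℝ} {V u v u' v' Q : ℝ → ℂ}

theorem isBigO (S : FundamentalSystem ρ V u v u' v') :
    (u =O[𝓝[>] (0 : ℝ)] fun x : ℝ => x ^ (1 / 2 + ρ)) ∧
    (u' =O[𝓝[>] (0 : ℝ)] fun x : ℝ => x ^ (-1 / 2 + ρ)) ∧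
    (v =O[𝓝[>] (0 : ℝ)] fun x : ℝ => x ^ (1 / 2 - ρ)) ∧
    (v' =O[𝓝[>] (0 : ℝ)] fun x : ℝ => x ^ (-1 / 2 - ρ)) := by
  obtain ⟨C, hC, h⟩ := S.bound 1
  have key : ∀ (f : ℝ → ℂ) (s : ℝ), (∀ x ∈ Ioc (0 : ℝ) 1, ‖f x‖ ≤ C * x ^ s) →
      f =O[𝓝[>] (0 : ℝ)] fun x : ℝ => x ^ s := by
    intro f s hf
    refine IsBigO.of_bound C ?_
    filter_upwards [Ioc_mem_nhdsGT one_pos] with x hx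
    rw [Real.norm_of_nonneg (Real.rpow_nonneg hx.1.le _)]
    exact hf x hx
  exact ⟨key _ _ fun x hx => (h x hx).1, key _ _ fun x hx => (h x hx).2.1,
    key _ _ fun x hx => (h x hx).2.2.1, key _ _ fun x hx => (h x hx).2.2.2⟩

/-- A solution of the perturbed equation which is small enough at `0` vanishes. -/
theorem eq_zero_of_isLittleO (S : FundamentalSystem ρ V u v u' v')
    (hQl : LocallyIntegrableOn Q (Ioi 0))
    (hQ : ∀ X : ℝ, IntegrableOn (fun y => y * ‖Q y‖) (Ioc 0 X)) {d D : ℝ → ℂ}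
    (hd : SolvesWith V (fun x => -(Q x * d x)) d D)
    (h1 : d =o[𝓝[>] (0 : ℝ)] fun x : ℝ => x ^ (1 / 2 + ρ))
    (h2 : D =o[𝓝[>] (0 : ℝ)] fun x : ℝ => x ^ (-1 / 2 + ρ)) {x : ℝ} (hx : 0 < x) : d x = 0 := by
  have hρ := S.nonneg
  obtain ⟨bu, bu', bv, bv'⟩ := S.isBigO
  have hb := exists_bound_of_isBigO hd.continuousOn h1.isBigO
  obtain ⟨M1, -, hM1⟩ := hb 1
  have hadm : Admissible ρ (fun y => Q y * d y) := admissible_mul hQl hQ hd.continuousOn hM1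
  -- In the derivative of a Wronskian of `d` with a free solution the `V` terms cancel and only `Q
  -- d` remains. The Wronskians with `u` and `v` determine `d`, because `v u' - v' u = 1`.
  have hα : IsLocalPrimitive (fun x => u x * (Q x * d x)) (fun x => u x * D x - u' x * d x) := by
    refine ((S.primitive_u.mul hd.2).add ((S.primitive_u'.mul hd.1).const_mul (-1))).congr
      (fun x _ => by ring) (fun x _ => by ring)
  have hβ : IsLocalPrimitive (fun x => v x * (Q x * d x)) (fun x => v x * D x - v' x * d x) := by
    refine ((S.primitive_v.mul hd.2).add ((S.primitive_v'.mul hd.1).const_mul (-1))).congr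
      (fun x _ => by ring) (fun x _ => by ring)
  have hα0 : Tendsto (fun x => u x * D x - u' x * d x) (𝓝[>] 0) (𝓝 0) := by
    simpa using (isLittleO_rpow_mul (by linarith) bu h2).sub
      (isLittleO_rpow_mul (by linarith) bu' h1)
  have hβ0 : Tendsto (fun x => v x * D x - v' x * d x) (𝓝[>] 0) (𝓝 0) := by
    simpa using (isLittleO_rpow_mul (by linarith) bv h2).sub
      (isLittleO_rpow_mul (by linarith) bv' h1)
  have heq : ∀ x : ℝ, 0 < x → d x = -forwardOp u v (fun y => Q y * d y) x := by
    intro x hx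
    rw [forwardOp, ← hα.eq_integral_of_tendsto (S.integrableOn_u_mul hadm) hα0 hx,
      ← hβ.eq_integral_of_tendsto (S.integrableOn_v_mul hadm) hβ0 hx]
    linear_combination (-d x) * S.wronskian x hx
  obtain ⟨M, -, hM⟩ := hb (x + 1)
  refine S.eq_zero_of_eq_neg_forwardOp hQ (X := x + 1) (M := M) ?_ (fun y hy => heq y hy.1) x
    ⟨hx, lt_add_one x⟩
  filter_upwards [ae_restrict_mem measurableSet_Ioo] with y hy
  exact hM y ⟨hy.1, hy.2.le⟩

/-- Correction of an approximate solution `T` of the perturbed equation to a solution. -/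
theorem exists_correction (S : FundamentalSystem ρ V u v u' v')
    (hQl : LocallyIntegrableOn Q (Ioi 0))
    (hQ : ∀ X : ℝ, IntegrableOn (fun y => y * ‖Q y‖) (Ioc 0 X)) {p q T DT : ℝ → ℂ}
    (hT : SolvesWith V p T DT) (hq : Admissible ρ q)
    (hpq : ∀ x : ℝ, 0 < x → q x = -(Q x * T x) - p x) :
    ∃ r Dr : ℝ → ℂ,
      SolvesWith V (fun x => -(Q x * (T x + r x))) (fun x => T x + r x) (fun x => DT x + Dr x) ∧
      (r =o[𝓝[>] (0 : ℝ)] fun x : ℝ => x ^ (1 / 2 + ρ)) ∧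
      (Dr =o[𝓝[>] (0 : ℝ)] fun x : ℝ => x ^ (-1 / 2 + ρ)) ∧
      ContinuousOn r (Ioi 0) ∧
      (∃ M : ℝ, ∀ x ∈ Ioc (0 : ℝ) 1, ‖r x‖ ≤ M * x ^ (1 / 2 + ρ)) ∧
      ∀ x : ℝ, 0 < x → r x + forwardOp u v (fun y => Q y * r y) x = forwardOp u v q x := by
  obtain ⟨DF, hF, hF1, hF2⟩ : ∃ DF : ℝ → ℂ, SolvesWith V q (forwardOp u v q) DF ∧
      (forwardOp u v q =o[𝓝[>] (0 : ℝ)] fun x : ℝ => x ^ (1 / 2 + ρ)) ∧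
      (DF =o[𝓝[>] (0 : ℝ)] fun x : ℝ => x ^ (-1 / 2 + ρ)) :=
    ⟨_, S.solvesWith_forwardOp hq, S.forwardOp_isLittleO hq⟩
  obtain ⟨r, hrc, hrb, hr⟩ := S.exists_eq_sub_forwardOp hQl hQ hF.continuousOn
    (exists_bound_of_isBigO hF.continuousOn hF1.isBigO)
  obtain ⟨M, hM0, hM⟩ := hrb 1
  have hadm : Admissible ρ (fun y => Q y * r y) := admissible_mul hQl hQ hrc hM
  obtain ⟨DG, hG, hG1, hG2⟩ : ∃ DG : ℝ → ℂ,
      SolvesWith V (fun y => Q y * r y) (forwardOp u v (fun y => Q y * r y)) DG ∧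
      (forwardOp u v (fun y => Q y * r y) =o[𝓝[>] (0 : ℝ)] fun x : ℝ => x ^ (1 / 2 + ρ)) ∧
      (DG =o[𝓝[>] (0 : ℝ)] fun x : ℝ => x ^ (-1 / 2 + ρ)) :=
    ⟨_, S.solvesWith_forwardOp hadm, S.forwardOp_isLittleO hadm⟩
  refine ⟨r, fun x => DF x + -1 * DG x, ?_, ?_, hF2.add (hG2.const_mul_left (-1)), hrc, ⟨M, hM⟩,
    fun x hx => by rw [hr x hx]; ring⟩
  -- The right-hand sides add up to `p + q - Q r`, and the choice of `q` makes this `-Q (T + r)`.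
  · refine (hT.add (hF.add (hG.const_mul (-1)))).congr (fun x hx => ?_) (fun x hx => ?_)
    · simp only [hpq x hx]; ring
    · simp only [hr x hx]; ring
  · refine (hF1.sub hG1).congr' ?_ EventuallyEq.rfl
    filter_upwards [self_mem_nhdsWithin] with x hx
    exact (hr x hx).symm

end FundamentalSystem

/-! ### The two-sided Green operator and its gain of decay. -/

/-- The two-sided Green operator on `]0,1[` applied to `Q f`, extended to `]0,∞[` as a solution. -/
noncomputable def twoSidedOp (u v Q f : ℝ → ℂ) (x : ℝ) : ℂ :=
  v x * (∫ y in (0 : ℝ)..x, u y * (Q y * f y)) + u x * ∫ y in x..1, v y * (Q y * f y)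

namespace FundamentalSystem

variable {ρ ε : ℝ} {V u v u' v' Q f : ℝ → ℂ}

theorem integrableOn_Ioc_of_locallyIntegrableOn {g : ℝ → ℂ} (hg : LocallyIntegrableOn g (Ioi 0))
    (h1 : IntegrableOn g (Ioc 0 1)) (X : ℝ) : IntegrableOn g (Ioc 0 X) := by
  have h2 : Icc 1 (max 1 X) ⊆ Ioi (0 : ℝ) := fun y hy => lt_of_lt_of_le one_pos hy.1
  refine (h1.union (hg.integrableOn_compact_subset h2 isCompact_Icc)).mono_set fun y hy => ?_
  rcases le_total y 1 with hy1 | hy1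
  · exact Or.inl ⟨hy.1, hy1⟩
  · exact Or.inr ⟨hy1, hy.2.trans (le_max_right _ _)⟩

theorem integrableOn_u_mul_mul (S : FundamentalSystem ρ V u v u' v')
    (hQl : LocallyIntegrableOn Q (Ioi 0))
    (hQ : ∀ X : ℝ, IntegrableOn (fun y => y * ‖Q y‖) (Ioc 0 X)) (hf : ContinuousOn f (Ioi 0))
    {M : ℝ} (hM : ∀ x ∈ Ioc (0 : ℝ) 1, ‖f x‖ ≤ M * x ^ (1 / 2 - ρ)) (X : ℝ) :
    IntegrableOn (fun y => u y * (Q y * f y)) (Ioc 0 X) := by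
  have hl := (hQl.mul_continuousOn hf isOpen_Ioi.isLocallyClosed).continuousOn_mul
    S.continuousOn_u isOpen_Ioi.isLocallyClosed
  refine integrableOn_Ioc_of_locallyIntegrableOn hl ?_ X
  obtain ⟨C, hC, h⟩ := S.bound 1
  refine ((hQ 1).const_mul (C * M)).mono' (hl.aestronglyMeasurable.mono_measure
    (Measure.restrict_mono Ioc_subset_Ioi_self le_rfl)) ?_
  filter_upwards [ae_restrict_mem measurableSet_Ioc] with y hy
  have e : y ^ (1 / 2 + ρ) * y ^ (1 / 2 - ρ) = y := by
    rw [← Real.rpow_add hy.1]; ring_nf; exact Real.rpow_one y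
  rw [norm_mul, norm_mul]
  calc ‖u y‖ * (‖Q y‖ * ‖f y‖) ≤ (C * y ^ (1 / 2 + ρ)) * (‖Q y‖ * (M * y ^ (1 / 2 - ρ))) := by
        gcongr
        · exact mul_nonneg hC (Real.rpow_nonneg hy.1.le _)
        · exact (h y hy).1
        · exact hM y hy
    _ = C * M * ((y ^ (1 / 2 + ρ) * y ^ (1 / 2 - ρ)) * ‖Q y‖) := by ring
    _ = _ := by rw [e]

/-- The integral with `v` starts from `1` because `v Q f` need not be integrable at `0`. Beyond `1`
it becomes an oriented integral of reversed direction, so variation of parameters holds on the whole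
half-line. -/
theorem solvesWith_twoSidedOp (S : FundamentalSystem ρ V u v u' v')
    (hQl : LocallyIntegrableOn Q (Ioi 0))
    (hQ : ∀ X : ℝ, IntegrableOn (fun y => y * ‖Q y‖) (Ioc 0 X)) (hf : ContinuousOn f (Ioi 0))
    {M : ℝ} (hM : ∀ x ∈ Ioc (0 : ℝ) 1, ‖f x‖ ≤ M * x ^ (1 / 2 - ρ)) :
    ∃ D : ℝ → ℂ, SolvesWith V (fun x => Q x * f x) (twoSidedOp u v Q f) D := by
  have hl := (hQl.mul_continuousOn hf isOpen_Ioi.isLocallyClosed).continuousOn_mul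
    S.continuousOn_v isOpen_Ioi.isLocallyClosed
  have hi : ∀ {a b : ℝ}, 0 < a → 0 < b →
      IntervalIntegrable (fun y => v y * (Q y * f y)) volume a b := fun ha hb =>
    intervalIntegrable_of_locallyIntegrableOn hl ha hb
  refine ⟨_, S.solvesWith (p := fun x => Q x * f x)
    (isLocalPrimitive_integral_zero (S.integrableOn_u_mul_mul hQl hQ hf hM))
    (B := fun x => ∫ y in x..1, v y * (Q y * f y)) ⟨hl.neg, fun a b ha hb => ?_⟩⟩
  simp only [intervalIntegral.integral_neg]
  rw [← intervalIntegral.integral_add_adjacent_intervals (hi ha hb) (hi hb one_pos)]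
  ring

/-- One application gains `x^ε`. In the integral over `y ≤ x` the surplus power `y^{a+ε}` is at most
`x^b`; in the one over `y ≥ x` the power `y^{a+ε-2ρ}` is at most `x^{b-2ρ}`, which needs `b ≤ 2ρ`.
The cap reflects that the output contains multiples of `u`. -/
theorem norm_twoSidedOp_le (S : FundamentalSystem ρ V u v u' v')
    (hQε : IntegrableOn (fun y : ℝ => y ^ (1 - ε) * ‖Q y‖) (Ioc 0 1)) {M a b : ℝ}
    (hM : ∀ x ∈ Ioc (0 : ℝ) 1, ‖f x‖ ≤ M * x ^ (1 / 2 - ρ + a)) (hb0 : 0 ≤ b) (hba : b ≤ a + ε)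
    (hbρ : b ≤ 2 * ρ) :
    ∃ M' : ℝ, ∀ x ∈ Ioc (0 : ℝ) 1, ‖twoSidedOp u v Q f x‖ ≤ M' * x ^ (1 / 2 - ρ + b) := by
  obtain ⟨C, hC, h⟩ := S.bound 1
  have hM0 : 0 ≤ M := by
    simpa using (norm_nonneg _).trans (hM 1 ⟨one_pos, le_rfl⟩)
  set q : ℝ → ℝ := fun y => y ^ (1 - ε) * ‖Q y‖ with hq
  have hq0 : ∀ y ∈ Ioc (0 : ℝ) 1, 0 ≤ q y := fun y hy =>
    mul_nonneg (Real.rpow_nonneg hy.1.le _) (norm_nonneg _)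
  set I := ∫ y in (0 : ℝ)..1, q y with hI
  have hqi : ∀ {s t : ℝ}, 0 ≤ s → s ≤ t → t ≤ 1 → IntervalIntegrable q volume s t :=
    fun hs hst ht => (intervalIntegrable_iff_integrableOn_Ioc_of_le hst).2
      (hQε.mono_set (Ioc_subset_Ioc hs ht))
  have hqI : ∀ {s t : ℝ}, 0 ≤ s → s ≤ t → t ≤ 1 → ∫ y in s..t, q y ≤ I := by
    intro s t hs hst ht
    refine intervalIntegral.integral_mono_interval hs hst ht ?_ (hqi le_rfl zero_le_one le_rfl)
    filter_upwards [ae_restrict_mem measurableSet_Ioc] with y hy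
    exact hq0 y hy
  refine ⟨2 * C ^ 2 * M * I, fun x hx => ?_⟩
  have h1 : ‖∫ y in (0 : ℝ)..x, u y * (Q y * f y)‖ ≤ C * M * x ^ b * I := by
    refine (intervalIntegral.norm_integral_le_of_norm_le hx.1.le ?_
      ((hqi le_rfl hx.1.le hx.2).const_mul (C * M * x ^ b))).trans ?_
    · refine Eventually.of_forall fun y hy => ?_
      have hy1 : y ∈ Ioc (0 : ℝ) 1 := ⟨hy.1, hy.2.trans hx.2⟩
      have e : y ^ (1 / 2 + ρ) * y ^ (1 / 2 - ρ + a) = y ^ (1 - ε) * y ^ (a + ε) := by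
        rw [← Real.rpow_add hy.1, ← Real.rpow_add hy.1]; ring_nf
      have e2 : y ^ (a + ε) ≤ x ^ b :=
        (Real.rpow_le_rpow_of_exponent_ge hy.1 hy1.2 hba).trans
          (Real.rpow_le_rpow hy.1.le hy.2 hb0)
      rw [norm_mul, norm_mul]
      calc ‖u y‖ * (‖Q y‖ * ‖f y‖) ≤
            (C * y ^ (1 / 2 + ρ)) * (‖Q y‖ * (M * y ^ (1 / 2 - ρ + a))) := by
            gcongr
            · exact mul_nonneg hC (Real.rpow_nonneg hy.1.le _)
            · exact (h y hy1).1
            · exact hM y hy1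
        _ = C * M * (y ^ (1 / 2 + ρ) * y ^ (1 / 2 - ρ + a)) * ‖Q y‖ := by ring
        _ = C * M * y ^ (a + ε) * q y := by rw [e, hq]; ring
        _ ≤ _ := by
            refine mul_le_mul_of_nonneg_right ?_ (hq0 y hy1)
            exact mul_le_mul_of_nonneg_left e2 (mul_nonneg hC hM0)
    · rw [intervalIntegral.integral_const_mul]
      exact mul_le_mul_of_nonneg_left (hqI le_rfl hx.1.le hx.2)
        (mul_nonneg (mul_nonneg hC hM0) (Real.rpow_nonneg hx.1.le _))
  have h2 : ‖∫ y in x..1, v y * (Q y * f y)‖ ≤ C * M * x ^ (b - 2 * ρ) * I := by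
    refine (intervalIntegral.norm_integral_le_of_norm_le hx.2 ?_
      ((hqi hx.1.le hx.2 le_rfl).const_mul (C * M * x ^ (b - 2 * ρ)))).trans ?_
    · refine Eventually.of_forall fun y hy => ?_
      have hy1 : y ∈ Ioc (0 : ℝ) 1 := ⟨hx.1.trans hy.1, hy.2⟩
      have e : y ^ (1 / 2 - ρ) * y ^ (1 / 2 - ρ + a) = y ^ (1 - ε) * y ^ (a + ε - 2 * ρ) := by
        rw [← Real.rpow_add hy1.1, ← Real.rpow_add hy1.1]; ring_nf
      have e2 : y ^ (a + ε - 2 * ρ) ≤ x ^ (b - 2 * ρ) :=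
        (Real.rpow_le_rpow_of_exponent_ge hy1.1 hy1.2 (by linarith)).trans
          (Real.rpow_le_rpow_of_nonpos hx.1 hy.1.le (by linarith))
      rw [norm_mul, norm_mul]
      calc ‖v y‖ * (‖Q y‖ * ‖f y‖) ≤
            (C * y ^ (1 / 2 - ρ)) * (‖Q y‖ * (M * y ^ (1 / 2 - ρ + a))) := by
            gcongr
            · exact mul_nonneg hC (Real.rpow_nonneg hy1.1.le _)
            · exact (h y hy1).2.2.1
            · exact hM y hy1
        _ = C * M * (y ^ (1 / 2 - ρ) * y ^ (1 / 2 - ρ + a)) * ‖Q y‖ := by ring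
        _ = C * M * y ^ (a + ε - 2 * ρ) * q y := by rw [e, hq]; ring
        _ ≤ _ := by
            refine mul_le_mul_of_nonneg_right ?_ (hq0 y hy1)
            exact mul_le_mul_of_nonneg_left e2 (mul_nonneg hC hM0)
    · rw [intervalIntegral.integral_const_mul]
      exact mul_le_mul_of_nonneg_left (hqI hx.1.le hx.2 le_rfl)
        (mul_nonneg (mul_nonneg hC hM0) (Real.rpow_nonneg hx.1.le _))
  have e1 : x ^ (1 / 2 - ρ) * x ^ b = x ^ (1 / 2 - ρ + b) := by rw [← Real.rpow_add hx.1]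
  have e2 : x ^ (1 / 2 + ρ) * x ^ (b - 2 * ρ) = x ^ (1 / 2 - ρ + b) := by
    rw [← Real.rpow_add hx.1]; ring_nf
  have hx0 := hx.1
  calc ‖twoSidedOp u v Q f x‖ ≤ ‖v x‖ * ‖∫ y in (0 : ℝ)..x, u y * (Q y * f y)‖ +
        ‖u x‖ * ‖∫ y in x..1, v y * (Q y * f y)‖ := by
        rw [twoSidedOp, ← norm_mul, ← norm_mul]; exact norm_add_le _ _
    _ ≤ (C * x ^ (1 / 2 - ρ)) * (C * M * x ^ b * I) +
        (C * x ^ (1 / 2 + ρ)) * (C * M * x ^ (b - 2 * ρ) * I) := by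
        gcongr
        · exact (h x hx).2.2.1
        · exact (h x hx).1
    _ = C ^ 2 * M * I * (x ^ (1 / 2 - ρ) * x ^ b) +
        C ^ 2 * M * I * (x ^ (1 / 2 + ρ) * x ^ (b - 2 * ρ)) := by ring
    _ = _ := by rw [e1, e2]; ring

end FundamentalSystem


/-! ### Power series, `1/Γ` and the hypergeometric function in argument and order. -/

section ExponentialSeries

/-- Exponential generating series of bounded sequences are summable. -/
theorem summable_pow_mul_inv_factorial_mul {c : ℕ → ℂ} {M : ℝ} (hc : ∀ n, ‖c n‖ ≤ M) (w : ℂ) :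
    Summable fun n : ℕ => w ^ n * ((n.factorial : ℂ)⁻¹ * c n) := by
  refine Summable.of_norm_bounded ((Real.summable_pow_div_factorial ‖w‖).mul_right M) fun n => ?_
  rw [norm_mul, norm_mul, norm_pow, norm_inv, Complex.norm_natCast, ← mul_assoc, ← div_eq_mul_inv]
  exact mul_le_mul_of_nonneg_left (hc n) (by positivity)

theorem hasDerivAt_tsum_pow_mul_inv_factorial_mul {c : ℕ → ℂ} {M : ℝ} (hc : ∀ n, ‖c n‖ ≤ M)
    (w : ℂ) : HasDerivAt (fun w : ℂ => ∑' n : ℕ, w ^ n * ((n.factorial : ℂ)⁻¹ * c n))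
      (∑' n : ℕ, w ^ n * ((n.factorial : ℂ)⁻¹ * c (n + 1))) w := by
  have hM : 0 ≤ M := (norm_nonneg _).trans (hc 0)
  have hfac : ∀ n : ℕ, ((n : ℂ) + 1) * ((n + 1).factorial : ℂ)⁻¹ = (n.factorial : ℂ)⁻¹ := by
    intro n
    have h1 : (n.factorial : ℂ) ≠ 0 := by exact_mod_cast n.factorial_ne_zero
    have h2 : (n : ℂ) + 1 ≠ 0 := by exact_mod_cast n.succ_ne_zero
    rw [Nat.factorial_succ]
    push_cast
    field_simp
  have hterm : ∀ (n : ℕ) (y : ℂ),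
      ((n + 1 : ℕ) : ℂ) * y ^ (n + 1 - 1) * (((n + 1).factorial : ℂ)⁻¹ * c (n + 1)) =
        y ^ n * ((n.factorial : ℂ)⁻¹ * c (n + 1)) := by
    intro n y
    rw [← hfac n, Nat.add_sub_cancel]; push_cast; ring
  set R := ‖w‖ + 1 with hR
  -- Differentiation lowers the power by one: the term of index `n + 1` is bounded by the `n`-th
  -- exponential term, and the term of index `0` vanishes.
  let b : ℕ → ℝ := fun n => Nat.casesOn n 0 fun n => R ^ n / n.factorial * M
  have hb : Summable b :=
    (summable_nat_add_iff 1).1 ((Real.summable_pow_div_factorial R).mul_right M)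
  have hg : ∀ (n : ℕ) (y : ℂ), y ∈ Metric.ball (0 : ℂ) R →
      ‖(n : ℂ) * y ^ (n - 1) * ((n.factorial : ℂ)⁻¹ * c n)‖ ≤ b n := by
    intro n y hy
    rw [mem_ball_zero_iff] at hy
    cases n with
    | zero => simp [b]
    | succ n =>
      rw [hterm, norm_mul, norm_mul, norm_pow, norm_inv, Complex.norm_natCast, ← mul_assoc,
        ← div_eq_mul_inv]
      simp only [b]
      gcongr
      exact hc _
  have h := hasDerivAt_tsum_of_isPreconnected (g := fun (n : ℕ) (y : ℂ) =>
      y ^ n * ((n.factorial : ℂ)⁻¹ * c n))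
    (g' := fun n y => (n : ℂ) * y ^ (n - 1) * ((n.factorial : ℂ)⁻¹ * c n)) hb Metric.isOpen_ball
    (convex_ball (0 : ℂ) R).isPreconnected (fun n y _ => (hasDerivAt_pow n y).mul_const _) hg
    (Metric.mem_ball_self (by positivity)) (summable_pow_mul_inv_factorial_mul hc 0)
    (y := w) (by rw [mem_ball_zero_iff]; linarith)
  refine h.congr_deriv ?_
  have hs : Summable fun n : ℕ => (n : ℂ) * w ^ (n - 1) * ((n.factorial : ℂ)⁻¹ * c n) :=
    Summable.of_norm_bounded hb fun n => hg n w (by rw [mem_ball_zero_iff]; linarith)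
  rw [hs.tsum_eq_zero_add]
  simp only [hterm]
  simp

end ExponentialSeries

section RecipGamma

/-- By `1/Γ(s) = s/Γ(s+1)` the modulus of `1/Γ` does not grow under `s ↦ s + 1` once `|s| ≥ 1`. The
finitely many earlier arguments lie in a compact ball, where the entire function `1/Γ` is bounded.
-/
theorem exists_norm_inv_Gamma_le (R : ℝ) :
    ∃ M : ℝ, ∀ (n : ℕ) (m : ℂ), ‖m‖ ≤ R → ‖(Complex.Gamma (m + n + 1))⁻¹‖ ≤ M := by
  obtain ⟨N, hN⟩ := exists_nat_ge R
  obtain ⟨M, hM⟩ := (isCompact_closedBall (0 : ℂ) (R + N + 1)).exists_bound_of_continuousOn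
    Complex.differentiable_one_div_Gamma.continuous.continuousOn
  refine ⟨M, fun n m hm => ?_⟩
  induction n with
  | zero =>
    refine hM _ ?_
    rw [mem_closedBall_zero_iff]
    calc _ ≤ ‖m‖ + ‖((0 : ℕ) : ℂ)‖ + ‖(1 : ℂ)‖ := norm_add₃_le
      _ ≤ _ := by simp; linarith [(Nat.cast_nonneg N : (0 : ℝ) ≤ N)]
  | succ n ih =>
    rcases le_or_gt (n + 1) N with h | h
    · refine hM _ ?_
      rw [mem_closedBall_zero_iff]
      calc _ ≤ ‖m‖ + ‖((n + 1 : ℕ) : ℂ)‖ + ‖(1 : ℂ)‖ := norm_add₃_le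
        _ ≤ _ := by
          rw [Complex.norm_natCast, norm_one]
          have : ((n + 1 : ℕ) : ℝ) ≤ N := by exact_mod_cast h
          linarith
    · refine le_trans ?_ ih
      rw [Complex.one_div_Gamma_eq_self_mul_one_div_Gamma_add_one (m + n + 1), norm_mul,
        show m + ((n + 1 : ℕ) : ℂ) + 1 = m + n + 1 + 1 by push_cast; ring]
      refine le_mul_of_one_le_left (norm_nonneg _) ?_
      have h1 : (N : ℝ) ≤ n := by exact_mod_cast Nat.lt_succ_iff.1 h
      have h2 : ‖((n : ℂ) + 1)‖ = (n : ℝ) + 1 := by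
        have := Complex.norm_natCast (n + 1)
        push_cast at this
        exact this
      have h3 : ‖((n : ℂ) + 1)‖ ≤ ‖m + n + 1‖ + ‖m‖ := by
        calc _ = ‖(m + n + 1) - m‖ := by congr 1; ring
          _ ≤ _ := norm_sub_le _ _
      linarith

/-- The derivative of `1/Γ`. -/
noncomputable def invGammaDeriv : ℂ → ℂ := deriv fun s : ℂ => (Complex.Gamma s)⁻¹

theorem hasDerivAt_inv_Gamma (s : ℂ) :
    HasDerivAt (fun s : ℂ => (Complex.Gamma s)⁻¹) (invGammaDeriv s) s :=
  (Complex.differentiable_one_div_Gamma s).hasDerivAt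

/-- Cauchy's estimate on a unit circle, with the previous bound for the radius enlarged by one. -/
theorem exists_norm_invGammaDeriv_le (R : ℝ) :
    ∃ M : ℝ, ∀ (n : ℕ) (m : ℂ), ‖m‖ ≤ R → ‖invGammaDeriv (m + n + 1)‖ ≤ M := by
  obtain ⟨M, hM⟩ := exists_norm_inv_Gamma_le (R + 1)
  refine ⟨M, fun n m hm => ?_⟩
  have := Complex.norm_deriv_le_of_forall_mem_sphere_norm_le (c := m + n + 1) (R := 1) (C := M)
    (f := fun s : ℂ => (Complex.Gamma s)⁻¹) one_pos
    Complex.differentiable_one_div_Gamma.diffContOnCl (fun z hz => by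
      rw [mem_sphere_iff_norm] at hz
      have h := hM n (z - n - 1) (by
        calc ‖z - n - 1‖ = ‖(z - (m + n + 1)) + m‖ := by congr 1; ring
          _ ≤ ‖z - (m + n + 1)‖ + ‖m‖ := norm_add_le _ _
          _ ≤ _ := by rw [hz]; linarith)
      rwa [show z - n - 1 + n + 1 = z by ring] at h)
  simpa [invGammaDeriv] using this

end RecipGamma

section HypF

/-- The derivative of `hypF` with respect to the order. -/
noncomputable def hypFOrder (m w : ℂ) : ℂ :=
  ∑' n : ℕ, w ^ n * ((n.factorial : ℂ)⁻¹ * invGammaDeriv (m + n + 1))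

theorem hypF_eq (m w : ℂ) :
    hypF m w = ∑' n : ℕ, w ^ n * ((n.factorial : ℂ)⁻¹ * (Complex.Gamma (m + n + 1))⁻¹) := by
  simp only [hypF, mul_inv]

theorem summable_hypF (m w : ℂ) :
    Summable fun n : ℕ => w ^ n * ((n.factorial : ℂ)⁻¹ * (Complex.Gamma (m + n + 1))⁻¹) := by
  obtain ⟨M, hM⟩ := exists_norm_inv_Gamma_le ‖m‖
  exact summable_pow_mul_inv_factorial_mul (fun n => hM n m le_rfl) w

theorem hasDerivAt_hypF (m w : ℂ) : HasDerivAt (hypF m) (hypF (m + 1) w) w := by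
  obtain ⟨M, hM⟩ := exists_norm_inv_Gamma_le ‖m‖
  rw [funext (hypF_eq m), hypF_eq]
  convert hasDerivAt_tsum_pow_mul_inv_factorial_mul (fun n => hM n m le_rfl) w using 6 with n
  push_cast; ring_nf

theorem hasDerivAt_hypFOrder (m w : ℂ) : HasDerivAt (hypFOrder m) (hypFOrder (m + 1) w) w := by
  obtain ⟨M, hM⟩ := exists_norm_invGammaDeriv_le ‖m‖
  unfold hypFOrder
  convert hasDerivAt_tsum_pow_mul_inv_factorial_mul (fun n => hM n m le_rfl) w using 6 with n
  push_cast; ring_nf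

/-- Needed for integer orders, where the Macdonald function is a limit of quotients `0/0` in the
order. -/
theorem hasDerivAt_hypF_order (m w : ℂ) :
    HasDerivAt (fun m => hypF m w) (hypFOrder m w) m := by
  obtain ⟨M, hM⟩ := exists_norm_invGammaDeriv_le (‖m‖ + 1)
  simp only [hypF_eq]
  refine hasDerivAt_tsum_of_isPreconnected (u := fun n => ‖w‖ ^ n / n.factorial * M)
    (g := fun (n : ℕ) (y : ℂ) =>
      w ^ n * ((n.factorial : ℂ)⁻¹ * (Complex.Gamma (y + n + 1))⁻¹))
    (g' := fun n y => w ^ n * ((n.factorial : ℂ)⁻¹ * invGammaDeriv (y + n + 1)))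
    ((Real.summable_pow_div_factorial ‖w‖).mul_right M) Metric.isOpen_ball
    (convex_ball (0 : ℂ) (‖m‖ + 1)).isPreconnected ?_ ?_
    (Metric.mem_ball_self (by positivity)) (summable_hypF 0 w)
    (by rw [mem_ball_zero_iff]; linarith)
  · intro n y _
    have h1 : HasDerivAt (fun y : ℂ => y + n + 1) 1 y :=
      ((hasDerivAt_id y).add_const _).add_const _
    have h2 := (hasDerivAt_inv_Gamma (y + n + 1)).comp y h1
    rw [mul_one] at h2
    exact (h2.const_mul _).const_mul _
  · intro n y hy
    rw [mem_ball_zero_iff] at hy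
    rw [norm_mul, norm_mul, norm_pow, norm_inv, Complex.norm_natCast, ← mul_assoc,
      ← div_eq_mul_inv]
    exact mul_le_mul_of_nonneg_left (hM n y hy.le) (by positivity)

/-- Termwise `1/Γ(m+n+1) = (m+1+n)/Γ(m+n+2)`: the part `m + 1` gives the first summand, and the part
`n` cancels against `n!` and shifts the index. Since raising the order by one is differentiation in
`w`, this is the differential equation of `hypF`. -/
theorem hypF_recurrence (m w : ℂ) :
    hypF m w = (m + 1) * hypF (m + 1) w + w * hypF (m + 2) w := by
  have h1 := summable_hypF (m + 1) w
  have h2 := summable_hypF (m + 2) w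
  set g : ℕ → ℂ := fun n =>
    (n : ℂ) * (w ^ n * ((n.factorial : ℂ)⁻¹ * (Complex.Gamma (m + 1 + n + 1))⁻¹)) with hg
  have hgs : ∀ n : ℕ, g (n + 1) =
      w * (w ^ n * ((n.factorial : ℂ)⁻¹ * (Complex.Gamma (m + 2 + n + 1))⁻¹)) := by
    intro n
    have h1 : (n.factorial : ℂ) ≠ 0 := by exact_mod_cast n.factorial_ne_zero
    have h2 : (n : ℂ) + 1 ≠ 0 := by exact_mod_cast n.succ_ne_zero
    simp only [hg]
    rw [Nat.factorial_succ, show m + 1 + ((n + 1 : ℕ) : ℂ) + 1 = m + 2 + n + 1 by push_cast; ring]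
    push_cast
    field_simp
    ring
  have hgsum : Summable g := by
    rw [← summable_nat_add_iff 1]
    simp only [hgs]
    exact h2.mul_left w
  have hg2 : ∑' n, g n = w * hypF (m + 2) w := by
    rw [hgsum.tsum_eq_zero_add, hypF_eq, ← tsum_mul_left]
    simp only [hgs]
    simp [hg]
  rw [← hg2, hypF_eq (m + 1), ← tsum_mul_left, ← (h1.mul_left _).tsum_add hgsum, hypF_eq]
  refine tsum_congr fun n => ?_
  rw [Complex.one_div_Gamma_eq_self_mul_one_div_Gamma_add_one (m + n + 1)]
  simp only [hg]
  rw [show m + n + 1 + 1 = m + 1 + n + 1 by ring]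
  ring

theorem hypF_zero (m : ℂ) : hypF m 0 = (Complex.Gamma (m + 1))⁻¹ := by
  rw [hypF_eq, tsum_eq_single 0 (fun n hn => by simp [hn])]
  simp

/-- The first `N` terms vanish, as `Γ` has poles there and takes the default value `0`; the rest is
a shifted series. -/
theorem hypF_neg_natCast (N : ℕ) (w : ℂ) : hypF (-N) w = w ^ N * hypF N w := by
  rw [hypF_eq, ← (summable_hypF (-N) w).sum_add_tsum_nat_add N, Finset.sum_eq_zero, zero_add,
    hypF_eq, ← tsum_mul_left]
  · refine tsum_congr fun i => ?_
    have e1 : (-(N : ℂ)) + ((i + N : ℕ) : ℂ) + 1 = (i : ℂ) + 1 := by push_cast; ring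
    have e2 : (N : ℂ) + i + 1 = ((i + N : ℕ) : ℂ) + 1 := by push_cast; ring
    rw [e1, e2, Complex.Gamma_nat_eq_factorial, Complex.Gamma_nat_eq_factorial]
    ring
  · intro n hn
    have hn : n < N := Finset.mem_range.1 hn
    obtain ⟨j, rfl⟩ := Nat.exists_eq_add_of_lt hn
    have e : (-((n + j + 1 : ℕ) : ℂ)) + n + 1 = -(j : ℂ) := by push_cast; ring
    rw [e, Complex.Gamma_neg_nat_eq_zero]
    simp

/-- The Wronskian relation for `hypF` of opposite orders. -/
theorem hypF_wronskian (m w : ℂ) :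
    2 * m * (hypF (-m) w * hypF m w) +
      2 * w * (hypF (-m) w * hypF (m + 1) w - hypF (-m + 1) w * hypF m w) =
      2 * Complex.sin (Real.pi * m) / Real.pi := by
  set Φ : ℂ → ℂ := fun w => 2 * m * (hypF (-m) w * hypF m w) +
      2 * w * (hypF (-m) w * hypF (m + 1) w - hypF (-m + 1) w * hypF m w) with hΦ
  have hd : ∀ w, HasDerivAt Φ 0 w := by
    intro w
    have ha := hasDerivAt_hypF (-m) w
    have hb := hasDerivAt_hypF m w
    have ha1 := hasDerivAt_hypF (-m + 1) w
    have hb1 := hasDerivAt_hypF (m + 1) w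
    have h := ((ha.mul hb).const_mul (2 * m)).add
      (((hasDerivAt_id w).const_mul 2).mul ((ha.mul hb1).sub (ha1.mul hb)))
    refine h.congr_deriv ?_
    have r1 := hypF_recurrence m w
    have r2 := hypF_recurrence (-m) w
    simp only [id, Pi.mul_apply, Pi.sub_apply]
    rw [show m + 1 + 1 = m + 2 by ring, show -m + 1 + 1 = -m + 2 by ring]
    linear_combination (-2 * hypF (-m) w) * r1 + 2 * hypF m w * r2
  have hconst := is_const_of_deriv_eq_zero (fun w => (hd w).differentiableAt)
    (fun w => (hd w).deriv) w 0
  -- The recurrences for `m` and `-m` made `Φ` constant; its value at `0` is given by the reflection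
  -- formula.
  have h0 : Φ 0 = 2 * Complex.sin (Real.pi * m) / Real.pi := by
    simp only [hΦ, hypF_zero, mul_zero, zero_mul, add_zero]
    have h1 := Complex.one_div_Gamma_eq_self_mul_one_div_Gamma_add_one m
    have h2 := Complex.Gamma_mul_Gamma_one_sub m
    have h3 : (Complex.Gamma m)⁻¹ * (Complex.Gamma (-m + 1))⁻¹ =
        Complex.sin (Real.pi * m) / Real.pi := by
      rw [← mul_inv, neg_add_eq_sub, h2, inv_div]
    rw [h1] at h3
    linear_combination 2 * h3
  rw [← h0, ← hconst]

end HypF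


/-! ### The free solutions: derivatives, Bessel equation and Wronskian. -/

theorem ofReal_ne_zero_of_pos {x : ℝ} (hx : 0 < x) : (x : ℂ) ≠ 0 :=
  Complex.ofReal_ne_zero.2 hx.ne'

theorem hasDerivAt_ofReal_cpow (s : ℂ) {x : ℝ} (hx : 0 < x) :
    HasDerivAt (fun x : ℝ => (x : ℂ) ^ s) (s / x * (x : ℂ) ^ s) x := by
  have h := ((hasDerivAt_id (x : ℂ)).cpow_const (c := s)
    (Complex.ofReal_mem_slitPlane.2 hx)).comp_ofReal
  refine h.congr_deriv ?_
  rw [mul_one, id, Complex.cpow_sub _ _ (ofReal_ne_zero_of_pos hx), Complex.cpow_one]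
  ring

theorem hasDerivAt_comp_sq (k : ℂ) {f : ℂ → ℂ} {f' : ℂ} {x : ℝ}
    (h : HasDerivAt f f' (k ^ 2 * (x : ℂ) ^ 2 / 4)) :
    HasDerivAt (fun x : ℝ => f (k ^ 2 * (x : ℂ) ^ 2 / 4)) (f' * (k ^ 2 / 2 * x)) x := by
  have h1 : HasDerivAt (fun z : ℂ => k ^ 2 * z ^ 2 / 4) (k ^ 2 / 2 * x) (x : ℂ) := by
    refine (((hasDerivAt_pow 2 (x : ℂ)).const_mul (k ^ 2)).div_const 4).congr_deriv ?_
    push_cast; ring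
  exact (h.comp (x : ℂ) h1).comp_ofReal

theorem cpow_add_one_of_pos {x : ℝ} (hx : 0 < x) (m : ℂ) :
    (x : ℂ) ^ (1 / 2 + (m + 1)) = (x : ℂ) ^ (1 / 2 + m) * x := by
  rw [← add_assoc, Complex.cpow_add _ _ (ofReal_ne_zero_of_pos hx), Complex.cpow_one]

theorem cpow_mul_cpow_neg_of_pos {x : ℝ} (hx : 0 < x) (m : ℂ) :
    (x : ℂ) ^ (1 / 2 + -m) * (x : ℂ) ^ (1 / 2 + m) = x := by
  rw [← Complex.cpow_add _ _ (ofReal_ne_zero_of_pos hx),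
    show (1 / 2 + -m) + (1 / 2 + m) = (1 : ℂ) by ring, Complex.cpow_one]

/-- The derivative of `u⁰_m(x,k)` with respect to `x`. -/
noncomputable def u0Deriv (m k : ℂ) (x : ℝ) : ℂ :=
  (1 / 2 + m) / x * u0 m k x + k ^ 2 / 2 * u0 (m + 1) k x

/-- The derivative of `u⁰_m(x,k)` with respect to the order `m`. -/
noncomputable def u0Order (m k : ℂ) (x : ℝ) : ℂ :=
  (x : ℂ) ^ (1 / 2 + m) * (Complex.log x * hypF m (k ^ 2 * (x : ℂ) ^ 2 / 4) +
    hypFOrder m (k ^ 2 * (x : ℂ) ^ 2 / 4))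

/-- The mixed derivative of `u⁰_m(x,k)` with respect to `x` and to the order `m`. -/
noncomputable def u0OrderDeriv (m k : ℂ) (x : ℝ) : ℂ :=
  (1 / 2 + m) / x * u0Order m k x + u0 m k x / x + k ^ 2 / 2 * u0Order (m + 1) k x

theorem hasDerivAt_u0 (m k : ℂ) {x : ℝ} (hx : 0 < x) : HasDerivAt (u0 m k) (u0Deriv m k x) x := by
  have h := (hasDerivAt_ofReal_cpow (1 / 2 + m) hx).mul
    (hasDerivAt_comp_sq k (hasDerivAt_hypF m (k ^ 2 * (x : ℂ) ^ 2 / 4)))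
  refine h.congr_deriv ?_
  simp only [u0Deriv, u0, cpow_add_one_of_pos hx]
  ring

theorem hasDerivAt_u0Order (m k : ℂ) {x : ℝ} (hx : 0 < x) :
    HasDerivAt (u0Order m k) (u0OrderDeriv m k x) x := by
  have hx0 := ofReal_ne_zero_of_pos hx
  have hl : HasDerivAt (fun x : ℝ => Complex.log x) ((x : ℂ)⁻¹) x :=
    (Complex.hasDerivAt_log (Complex.ofReal_mem_slitPlane.2 hx)).comp_ofReal
  have h := (hasDerivAt_ofReal_cpow (1 / 2 + m) hx).mul ((hl.mul
    (hasDerivAt_comp_sq k (hasDerivAt_hypF m (k ^ 2 * (x : ℂ) ^ 2 / 4)))).add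
    (hasDerivAt_comp_sq k (hasDerivAt_hypFOrder m (k ^ 2 * (x : ℂ) ^ 2 / 4))))
  refine h.congr_deriv ?_
  simp only [u0OrderDeriv, u0Order, u0, cpow_add_one_of_pos hx, Pi.add_apply, Pi.mul_apply]
  ring

theorem hasDerivAt_u0_order (m k : ℂ) {x : ℝ} (hx : 0 < x) :
    HasDerivAt (fun m => u0 m k x) (u0Order m k x) m := by
  have h1 : HasDerivAt (fun m : ℂ => (x : ℂ) ^ (1 / 2 + m))
      ((x : ℂ) ^ (1 / 2 + m) * Complex.log x * 1) m :=
    ((hasDerivAt_id m).const_add (1 / 2)).const_cpow (Or.inl (ofReal_ne_zero_of_pos hx))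
  refine (h1.mul (hasDerivAt_hypF_order m (k ^ 2 * (x : ℂ) ^ 2 / 4))).congr_deriv ?_
  simp only [u0Order]
  ring

theorem hasDerivAt_u0_add_order (m a k : ℂ) {x : ℝ} (hx : 0 < x) :
    HasDerivAt (fun m => u0 (m + a) k x) (u0Order (m + a) k x) m := by
  have := (hasDerivAt_u0_order (m + a) k hx).comp m ((hasDerivAt_id m).add_const a)
  rwa [mul_one] at this

theorem hasDerivAt_u0Deriv_order (m k : ℂ) {x : ℝ} (hx : 0 < x) :
    HasDerivAt (fun m => u0Deriv m k x) (u0OrderDeriv m k x) m := by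
  have h1 : HasDerivAt (fun m : ℂ => (1 / 2 + m) / (x : ℂ)) (1 / x) m :=
    ((hasDerivAt_id m).const_add (1 / 2)).div_const _
  have h := (h1.mul (hasDerivAt_u0_order m k hx)).add
    ((hasDerivAt_u0_add_order m 1 k hx).const_mul (k ^ 2 / 2))
  refine h.congr_deriv ?_
  simp only [u0OrderDeriv]
  ring

theorem u0_recurrence (m k : ℂ) {x : ℝ} (hx : 0 < x) :
    u0 m k x = (m + 1) / x * u0 (m + 1) k x + k ^ 2 / 4 * u0 (m + 2) k x := by
  have hx0 := ofReal_ne_zero_of_pos hx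
  rw [show m + 2 = m + 1 + 1 by ring]
  simp only [u0, cpow_add_one_of_pos hx]
  have := hypF_recurrence m (k ^ 2 * (x : ℂ) ^ 2 / 4)
  rw [show m + 2 = m + 1 + 1 by ring] at this
  rw [this]
  field_simp

/-- Differentiate `u0_recurrence` in the order. -/
theorem u0Order_recurrence (m k : ℂ) {x : ℝ} (hx : 0 < x) :
    u0Order m k x = u0 (m + 1) k x / x + (m + 1) / x * u0Order (m + 1) k x +
      k ^ 2 / 4 * u0Order (m + 2) k x := by
  have h1 : HasDerivAt (fun m : ℂ => (m + 1) / (x : ℂ)) (1 / x) m :=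
    ((hasDerivAt_id m).add_const 1).div_const _
  have h := (h1.mul (hasDerivAt_u0_add_order m 1 k hx)).add
    ((hasDerivAt_u0_add_order m 2 k hx).const_mul (k ^ 2 / 4))
  have h2 := (hasDerivAt_u0_order m k hx).unique
    (h.congr_of_eventuallyEq (Eventually.of_forall fun m => u0_recurrence m k hx))
  rw [h2]
  ring

/-- The potential of the unperturbed equation `f'' = ((m² - 1/4)/x² + k²) f`. -/
noncomputable def freePotential (m k : ℂ) (x : ℝ) : ℂ := (m ^ 2 - 1 / 4) / (x : ℂ) ^ 2 + k ^ 2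

theorem continuousOn_freePotential (m k : ℂ) : ContinuousOn (freePotential m k) (Ioi 0) := by
  unfold freePotential
  refine ContinuousOn.add (ContinuousOn.div continuousOn_const (by fun_prop) ?_) continuousOn_const
  intro x hx
  exact pow_ne_zero 2 (ofReal_ne_zero_of_pos hx)

theorem hasDerivAt_const_div_ofReal (a : ℂ) {x : ℝ} (hx : 0 < x) :
    HasDerivAt (fun x : ℝ => a / (x : ℂ)) (-a / (x : ℂ) ^ 2) x := by
  have h : HasDerivAt (fun z : ℂ => a / z) (a * (-((x : ℂ) ^ 2)⁻¹)) (x : ℂ) := by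
    simp only [div_eq_mul_inv]
    exact (hasDerivAt_inv (ofReal_ne_zero_of_pos hx)).const_mul a
  refine h.comp_ofReal.congr_deriv ?_
  ring

theorem hasDerivAt_u0Deriv (m k : ℂ) {x : ℝ} (hx : 0 < x) :
    HasDerivAt (u0Deriv m k) (freePotential m k x * u0 m k x) x := by
  have hx0 := ofReal_ne_zero_of_pos hx
  have h := ((hasDerivAt_const_div_ofReal (1 / 2 + m) hx).mul (hasDerivAt_u0 m k hx)).add
    ((hasDerivAt_u0 (m + 1) k hx).const_mul (k ^ 2 / 2))
  refine h.congr_deriv ?_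
  have hr := u0_recurrence m k hx
  have e : u0Deriv (m + 1) k x =
      (1 / 2 + (m + 1)) / x * u0 (m + 1) k x + k ^ 2 / 2 * u0 (m + 2) k x := by
    rw [u0Deriv, show m + 1 + 1 = m + 2 by ring]
  rw [e]
  simp only [u0Deriv, freePotential]
  linear_combination (-k ^ 2) * hr

/-- The extra term comes from differentiating `m²/x²` in `m`. In the combination of orders `N` and
`-N` that forms the Macdonald function these terms cancel. -/
theorem hasDerivAt_u0OrderDeriv (m k : ℂ) {x : ℝ} (hx : 0 < x) :
    HasDerivAt (u0OrderDeriv m k)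
      (freePotential m k x * u0Order m k x + 2 * m / (x : ℂ) ^ 2 * u0 m k x) x := by
  have hx0 := ofReal_ne_zero_of_pos hx
  have h := (((hasDerivAt_const_div_ofReal (1 / 2 + m) hx).mul (hasDerivAt_u0Order m k hx)).add
    ((hasDerivAt_const_div_ofReal 1 hx).mul (hasDerivAt_u0 m k hx))).add
    ((hasDerivAt_u0Order (m + 1) k hx).const_mul (k ^ 2 / 2))
  have h' : HasDerivAt (u0OrderDeriv m k) _ x :=
    h.congr_of_eventuallyEq (Eventually.of_forall fun y => by
      simp only [u0OrderDeriv, Pi.add_apply, Pi.mul_apply]; ring)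
  refine h'.congr_deriv ?_
  have hr := u0Order_recurrence m k hx
  have e : u0OrderDeriv (m + 1) k x = (1 / 2 + (m + 1)) / x * u0Order (m + 1) k x +
      u0 (m + 1) k x / x + k ^ 2 / 2 * u0Order (m + 2) k x := by
    rw [u0OrderDeriv, show m + 1 + 1 = m + 2 by ring]
  rw [e]
  simp only [u0OrderDeriv, u0Deriv, freePotential]
  linear_combination (-k ^ 2) * hr

theorem u0_wronskian (m k : ℂ) {x : ℝ} (hx : 0 < x) :
    u0 (-m) k x * u0Deriv m k x - u0Deriv (-m) k x * u0 m k x =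
      2 * Complex.sin (Real.pi * m) / Real.pi := by
  have hx0 := ofReal_ne_zero_of_pos hx
  rw [← hypF_wronskian m (k ^ 2 * (x : ℂ) ^ 2 / 4)]
  simp only [u0Deriv, u0, cpow_add_one_of_pos hx]
  have := cpow_mul_cpow_neg_of_pos hx m
  have e : (x : ℂ) ^ (1 / 2 + -m) * (x : ℂ) ^ (1 / 2 + m) / x = 1 := by
    rw [this, div_self hx0]
  set w := k ^ 2 * (x : ℂ) ^ 2 / 4
  have e2 : 2 * w = k ^ 2 / 2 * x * x := by simp only [w]; ring
  rw [e2]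
  linear_combination (2 * m * (hypF (-m) w * hypF m w)) * e +
    (k ^ 2 / 2 * x * (hypF (-m) w * hypF (m + 1) w - hypF (-m + 1) w * hypF m w)) * this

/-- At integer order the two power-type solutions are dependent, so the second solution must come
from the derivative in the order. -/
theorem u0_neg_natCast (N : ℕ) (k : ℂ) {x : ℝ} (hx : 0 < x) :
    u0 (-N) k x = (k / 2) ^ (2 * N) * u0 N k x := by
  have hx0 := ofReal_ne_zero_of_pos hx
  simp only [u0, hypF_neg_natCast]
  have e : (x : ℂ) ^ (1 / 2 + (N : ℂ)) = (x : ℂ) ^ (1 / 2 + -(N : ℂ)) * (x : ℂ) ^ (2 * N) := by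
    rw [← Complex.cpow_natCast (x : ℂ) (2 * N), ← Complex.cpow_add _ _ hx0]
    congr 1; push_cast; ring
  rw [e, show k ^ 2 * (x : ℂ) ^ 2 / 4 = (k / 2) ^ 2 * (x : ℂ) ^ 2 by ring, mul_pow, ← pow_mul,
    ← pow_mul]
  ring


/-! ### Orders of growth at the origin. -/

section Order

variable {f g : ℝ → ℂ} {s t : ℝ}

theorem isBigO_rpow_rpow (h : t ≤ s) :
    (fun x : ℝ => x ^ s) =O[𝓝[>] (0 : ℝ)] fun x : ℝ => x ^ t := by
  refine IsBigO.of_bound 1 ?_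
  filter_upwards [Ioc_mem_nhdsGT one_pos] with x hx
  rw [Real.norm_of_nonneg (Real.rpow_nonneg hx.1.le _),
    Real.norm_of_nonneg (Real.rpow_nonneg hx.1.le _), one_mul]
  exact Real.rpow_le_rpow_of_exponent_ge hx.1 hx.2 h

theorem isBigO_rpow_mul {r : ℝ} (hf : f =O[𝓝[>] (0 : ℝ)] fun x : ℝ => x ^ s)
    (hg : g =O[𝓝[>] (0 : ℝ)] fun x : ℝ => x ^ t) (hr : r ≤ s + t) :
    (fun x => f x * g x) =O[𝓝[>] (0 : ℝ)] fun x : ℝ => x ^ r := by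
  refine ((hf.mul hg).congr' EventuallyEq.rfl ?_).trans (isBigO_rpow_rpow hr)
  filter_upwards [self_mem_nhdsWithin] with x hx
  rw [Real.rpow_add hx]

theorem isBigO_ofReal_cpow (m : ℂ) :
    (fun x : ℝ => (x : ℂ) ^ m) =O[𝓝[>] (0 : ℝ)] fun x : ℝ => x ^ m.re := by
  refine IsBigO.of_bound 1 ?_
  filter_upwards [self_mem_nhdsWithin] with x hx
  rw [Complex.norm_cpow_eq_rpow_re_of_pos hx, one_mul]
  exact le_abs_self _

theorem isBigO_const_div (a : ℂ) :
    (fun x : ℝ => a / (x : ℂ)) =O[𝓝[>] (0 : ℝ)] fun x : ℝ => x ^ (-1 : ℝ) := by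
  refine IsBigO.of_bound ‖a‖ ?_
  filter_upwards [self_mem_nhdsWithin] with x hx
  have hx : 0 < x := hx
  rw [norm_div, Complex.norm_of_nonneg hx.le, Real.rpow_neg_one, norm_inv,
    Real.norm_of_nonneg hx.le, div_eq_mul_inv]

/-- Crude, but losing a whole power is harmless: the logarithm occurs only for orders `N ≥ 1`, where
it multiplies functions of order `x^{1/2+N}` or better and only `x^{1/2-N}` is needed. -/
theorem isBigO_log :
    (fun x : ℝ => Complex.log x) =O[𝓝[>] (0 : ℝ)] fun x : ℝ => x ^ (-1 : ℝ) := by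
  refine IsBigO.congr' (f₁ := fun x : ℝ => ((Real.log x : ℝ) : ℂ)) ?_ ?_ EventuallyEq.rfl
  · refine IsBigO.of_norm_left ?_
    simp only [Complex.norm_real]
    exact (isLittleO_log_rpow_nhdsGT_zero (by norm_num : (-1 : ℝ) < 0)).isBigO.norm_left
  · filter_upwards [self_mem_nhdsWithin] with x hx
    exact Complex.ofReal_log (le_of_lt hx)

theorem isBigO_comp_sq (k : ℂ) {F : ℂ → ℂ} (hF : ContinuousAt F 0) :
    (fun x : ℝ => F (k ^ 2 * (x : ℂ) ^ 2 / 4)) =O[𝓝[>] (0 : ℝ)] fun x : ℝ => x ^ (0 : ℝ) := by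
  have h : Tendsto (fun x : ℝ => F (k ^ 2 * (x : ℂ) ^ 2 / 4)) (𝓝 0) (𝓝 (F 0)) := by
    refine hF.tendsto.comp ?_
    have : Continuous fun x : ℝ => k ^ 2 * (x : ℂ) ^ 2 / 4 := by fun_prop
    simpa using this.tendsto 0
  simpa using (h.mono_left nhdsWithin_le_nhds).isBigO_one ℝ

theorem u0_isBigO (m k : ℂ) :
    u0 m k =O[𝓝[>] (0 : ℝ)] fun x : ℝ => x ^ (1 / 2 + m.re) :=
  isBigO_rpow_mul (isBigO_ofReal_cpow _)
    (isBigO_comp_sq k (hasDerivAt_hypF m 0).continuousAt) (by simp)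

theorem u0Deriv_isBigO (m k : ℂ) :
    u0Deriv m k =O[𝓝[>] (0 : ℝ)] fun x : ℝ => x ^ (-1 / 2 + m.re) := by
  refine (isBigO_rpow_mul (isBigO_const_div _) (u0_isBigO m k) (by linarith)).add ?_
  exact ((u0_isBigO (m + 1) k).trans (isBigO_rpow_rpow (by simp; linarith))).const_mul_left _

theorem u0Order_eq (m k : ℂ) (x : ℝ) : u0Order m k x = Complex.log x * u0 m k x +
    (x : ℂ) ^ (1 / 2 + m) * hypFOrder m (k ^ 2 * (x : ℂ) ^ 2 / 4) := by
  simp only [u0Order, u0]; ring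

/-- The exponent `s` is kept apart from `1/2 + Re m` because for `m = -N` the function `u0` is of
the better order `x^{1/2+N}`. -/
theorem u0Order_isBigO (m k : ℂ) (h : u0 m k =O[𝓝[>] (0 : ℝ)] fun x : ℝ => x ^ s)
    (ht1 : t ≤ s - 1) (ht2 : t ≤ 1 / 2 + m.re) :
    u0Order m k =O[𝓝[>] (0 : ℝ)] fun x : ℝ => x ^ t := by
  rw [funext (u0Order_eq m k)]
  refine (isBigO_rpow_mul isBigO_log h (by linarith)).add ?_
  exact isBigO_rpow_mul (isBigO_ofReal_cpow _)
    (isBigO_comp_sq k (hasDerivAt_hypFOrder m 0).continuousAt) (by simpa using ht2)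

end Order

/-! ### The Bessel fundamental system: zero energy, non-integer order, integer order. -/

theorem FundamentalSystem.of_isBigO {ρ : ℝ} {V u v u' v' : ℝ → ℂ} (nonneg : 0 ≤ ρ)
    (hV : ContinuousOn V (Ioi 0)) (hu : ∀ x : ℝ, 0 < x → HasDerivAt u (u' x) x)
    (hv : ∀ x : ℝ, 0 < x → HasDerivAt v (v' x) x)
    (hu' : ∀ x : ℝ, 0 < x → HasDerivAt u' (V x * u x) x)
    (hv' : ∀ x : ℝ, 0 < x → HasDerivAt v' (V x * v x) x)
    (hw : ∀ x : ℝ, 0 < x → v x * u' x - v' x * u x = 1)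
    (bu : u =O[𝓝[>] (0 : ℝ)] fun x : ℝ => x ^ (1 / 2 + ρ))
    (bu' : u' =O[𝓝[>] (0 : ℝ)] fun x : ℝ => x ^ (-1 / 2 + ρ))
    (bv : v =O[𝓝[>] (0 : ℝ)] fun x : ℝ => x ^ (1 / 2 - ρ))
    (bv' : v' =O[𝓝[>] (0 : ℝ)] fun x : ℝ => x ^ (-1 / 2 - ρ)) :
    FundamentalSystem ρ V u v u' v' := by
  refine ⟨nonneg, hV, hu, hv, hu', hv', hw, fun X => ?_⟩
  have hc : ∀ {f f' : ℝ → ℂ}, (∀ x : ℝ, 0 < x → HasDerivAt f (f' x) x) →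
      ContinuousOn f (Ioi 0) := fun h x hx => (h x hx).continuousAt.continuousWithinAt
  obtain ⟨C1, h1, b1⟩ := exists_bound_of_isBigO (hc hu) bu X
  obtain ⟨C2, h2, b2⟩ := exists_bound_of_isBigO (hc hu') bu' X
  obtain ⟨C3, h3, b3⟩ := exists_bound_of_isBigO (hc hv) bv X
  obtain ⟨C4, h4, b4⟩ := exists_bound_of_isBigO (hc hv') bv' X
  refine ⟨C1 + C2 + C3 + C4, by positivity, fun x hx => ⟨(b1 x hx).trans ?_, (b2 x hx).trans ?_,
    (b3 x hx).trans ?_, (b4 x hx).trans ?_⟩⟩ <;>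
  exact mul_le_mul_of_nonneg_right (by linarith) (Real.rpow_nonneg hx.1.le _)

theorem freePotential_neg (m k : ℂ) (x : ℝ) : freePotential (-m) k x = freePotential m k x := by
  simp [freePotential]

theorem fundamentalSystem_zero {m : ℂ} (hm : 0 ≤ m.re) (hm0 : m ≠ 0) :
    ∃ v' : ℝ → ℂ, FundamentalSystem m.re (freePotential m 0) (u0 m 0) (v0 m 0) (u0Deriv m 0) v' := by
  have hv0 : v0 m 0 = fun x : ℝ => Complex.Gamma m / 2 * (x : ℂ) ^ (1 / 2 - m) := by
    funext x; simp only [v0, if_true]; ring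
  refine ⟨fun x => (1 / 2 - m) / x * v0 m 0 x, .of_isBigO hm (continuousOn_freePotential m 0)
    (fun x hx => hasDerivAt_u0 m 0 hx) (fun x hx => ?_) (fun x hx => hasDerivAt_u0Deriv m 0 hx)
    (fun x hx => ?_) (fun x hx => ?_) (u0_isBigO m 0) (u0Deriv_isBigO m 0) ?_ ?_⟩
  · rw [hv0]
    refine ((hasDerivAt_ofReal_cpow (1 / 2 - m) hx).const_mul (Complex.Gamma m / 2)).congr_deriv ?_
    ring
  · have hd : HasDerivAt (v0 m 0) ((1 / 2 - m) / x * v0 m 0 x) x := by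
      rw [hv0]
      refine ((hasDerivAt_ofReal_cpow (1 / 2 - m) hx).const_mul
        (Complex.Gamma m / 2)).congr_deriv ?_
      ring
    refine ((hasDerivAt_const_div_ofReal (1 / 2 - m) hx).mul hd).congr_deriv ?_
    simp only [freePotential]
    ring
  · have hx0 := ofReal_ne_zero_of_pos hx
    have h1 := cpow_mul_cpow_neg_of_pos hx m
    have h2 : Complex.Gamma (m + 1) ≠ 0 := Complex.Gamma_ne_zero_of_re_pos (by simp; linarith)
    have h3 := Complex.Gamma_add_one m hm0
    rw [h3] at h2
    have hu : u0 m 0 x = (x : ℂ) ^ (1 / 2 + m) * (m * Complex.Gamma m)⁻¹ := by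
      simp [u0, hypF_zero, h3]
    have e : u0Deriv m 0 x = (1 / 2 + m) / x * u0 m 0 x := by simp [u0Deriv]
    simp only [e, hu, hv0]
    rw [← sub_eq_add_neg] at h1
    have h4 : m * Complex.Gamma m * (m * Complex.Gamma m)⁻¹ = 1 := mul_inv_cancel₀ h2
    have h5 : (x : ℂ) / x = 1 := div_self hx0
    linear_combination (m * Complex.Gamma m * (m * Complex.Gamma m)⁻¹ / x) * h1 +
      (m * Complex.Gamma m * (m * Complex.Gamma m)⁻¹) * h5 + h4
  · rw [hv0]
    exact (isBigO_ofReal_cpow (1 / 2 - m)).const_mul_left _ |>.trans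
      (isBigO_rpow_rpow (by simp))
  · rw [hv0]
    refine isBigO_rpow_mul (isBigO_const_div _)
      ((isBigO_ofReal_cpow (1 / 2 - m)).const_mul_left _) ?_
    simp; linarith

/-- The multiple of `u0 m k` contained in `v0` drops out of the Wronskian, and the prefactor `π / (2
sin πm)` normalizes what remains to `1`. -/
theorem fundamentalSystem_nonInt {m k : ℂ} (hm : 0 ≤ m.re) (hk : k ≠ 0)
    (hmi : ¬∃ N : ℤ, m = N) :
    ∃ v' : ℝ → ℂ, FundamentalSystem m.re (freePotential m k) (u0 m k) (v0 m k) (u0Deriv m k) v' := by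
  have hs : Complex.sin (Real.pi * m) ≠ 0 := by
    rw [Complex.sin_ne_zero_iff]
    intro N h
    refine hmi ⟨N, ?_⟩
    have : (Real.pi : ℂ) ≠ 0 := Complex.ofReal_ne_zero.2 Real.pi_ne_zero
    rw [mul_comm (N : ℂ)] at h
    exact mul_left_cancel₀ this h
  have hpi : (Real.pi : ℂ) ≠ 0 := Complex.ofReal_ne_zero.2 Real.pi_ne_zero
  set c := (Real.pi : ℂ) / (2 * Complex.sin (Real.pi * m)) with hc
  set a := (k / 2) ^ (2 * m) with ha
  have hv0 : v0 m k = fun x : ℝ => c * (u0 (-m) k x - a * u0 m k x) := by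
    funext x; simp only [v0, if_neg hk, if_neg hmi, v0NonInt, hc, ha]
  rw [hv0]
  refine ⟨fun x => c * (u0Deriv (-m) k x - a * u0Deriv m k x),
    .of_isBigO hm (continuousOn_freePotential m k) (fun x hx => hasDerivAt_u0 m k hx)
    (fun x hx => ?_) (fun x hx => hasDerivAt_u0Deriv m k hx)
    (fun x hx => ?_) (fun x hx => ?_) (u0_isBigO m k) (u0Deriv_isBigO m k) ?_ ?_⟩
  · exact ((hasDerivAt_u0 (-m) k hx).sub ((hasDerivAt_u0 m k hx).const_mul a)).const_mul c
  · refine (((hasDerivAt_u0Deriv (-m) k hx).sub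
      ((hasDerivAt_u0Deriv m k hx).const_mul a)).const_mul c).congr_deriv ?_
    rw [freePotential_neg]; ring
  · have h1 := u0_wronskian m k hx
    have h2 : c * (2 * Complex.sin (Real.pi * m) / Real.pi) = 1 := by rw [hc]; field_simp
    linear_combination c * h1 + h2
  · refine (IsBigO.sub ?_ ?_).const_mul_left c
    · exact (u0_isBigO (-m) k).trans (isBigO_rpow_rpow (by simp))
    · exact ((u0_isBigO m k).trans (isBigO_rpow_rpow (by linarith))).const_mul_left a
  · refine (IsBigO.sub ?_ ?_).const_mul_left c
    · exact (u0Deriv_isBigO (-m) k).trans (isBigO_rpow_rpow (by simp [sub_eq_add_neg]))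
    · exact ((u0Deriv_isBigO m k).trans (isBigO_rpow_rpow (by linarith))).const_mul_left a

/-- L'Hôpital in the order: numerator and sine both vanish at `N`, so `v0` is the order derivative
`n` of the numerator over `2 cos πN`. Its equation and Wronskian come from differentiating in the
order. -/
theorem fundamentalSystem_natCast {N : ℕ} {k : ℂ} (hN : 1 ≤ N) (hk : k ≠ 0) :
    ∃ v' : ℝ → ℂ, FundamentalSystem N (freePotential N k) (u0 N k) (v0 N k) (u0Deriv N k) v' := by
  have hN1 : (1 : ℝ) ≤ N := by exact_mod_cast hN
  have hpi : (Real.pi : ℂ) ≠ 0 := Complex.ofReal_ne_zero.2 Real.pi_ne_zero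
  have hk2 : k / 2 ≠ 0 := div_ne_zero hk two_ne_zero
  set a := (k / 2) ^ (2 * (N : ℂ)) with ha
  set L := Complex.log (k / 2) with hL
  set c := Complex.cos (Real.pi * N) with hc
  have hsin : Complex.sin (Real.pi * N) = 0 := by
    rw [mul_comm]; exact_mod_cast Complex.sin_nat_mul_pi N
  have hc0 : c ≠ 0 := by
    intro h0
    have := Complex.sin_sq_add_cos_sq (Real.pi * (N : ℂ))
    rw [hsin, ← hc, h0] at this
    norm_num at this
  have hrel : ∀ x : ℝ, 0 < x → u0 (-N) k x = a * u0 N k x := by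
    intro x hx
    rw [u0_neg_natCast N k hx, ha, show 2 * (N : ℂ) = ((2 * N : ℕ) : ℂ) by push_cast; ring,
      Complex.cpow_natCast]
  have hrel' : ∀ x : ℝ, 0 < x → u0Deriv (-N) k x = a * u0Deriv N k x := by
    intro x hx
    refine (hasDerivAt_u0 (-N) k hx).unique
      (((hasDerivAt_u0 N k hx).const_mul a).congr_of_eventuallyEq ?_)
    filter_upwards [Ioi_mem_nhds hx] with y hy
    exact hrel y hy
  have ha' : ∀ μ : ℂ, HasDerivAt (fun μ : ℂ => (k / 2) ^ (2 * μ)) ((k / 2) ^ (2 * μ) * L * 2) μ := by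
    intro μ
    refine (((hasDerivAt_id μ).const_mul 2).const_cpow (Or.inl hk2)).congr_deriv ?_
    simp [hL]
  -- the derivatives with respect to the order of the numerator in the Macdonald function
  set n : ℝ → ℂ := fun x => -u0Order (-N) k x - (a * L * 2 * u0 N k x + a * u0Order N k x) with hn
  set n' : ℝ → ℂ := fun x =>
    -u0OrderDeriv (-N) k x - (a * L * 2 * u0Deriv N k x + a * u0OrderDeriv N k x) with hn'
  have hnum : ∀ x : ℝ, 0 < x →
      HasDerivAt (fun μ : ℂ => u0 (-μ) k x - (k / 2) ^ (2 * μ) * u0 μ k x) (n x) N := by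
    intro x hx
    have h1 : HasDerivAt (fun μ : ℂ => u0 (-μ) k x) (u0Order (-N) k x * -1) (N : ℂ) :=
      (hasDerivAt_u0_order (-N) k hx).comp (N : ℂ) (hasDerivAt_neg (N : ℂ))
    refine (h1.sub ((ha' N).mul (hasDerivAt_u0_order N k hx))).congr_deriv ?_
    simp only [hn]; ring
  have hnum' : ∀ x : ℝ, 0 < x →
      HasDerivAt (fun μ : ℂ => u0Deriv (-μ) k x - (k / 2) ^ (2 * μ) * u0Deriv μ k x) (n' x) N := by
    intro x hx
    have h1 : HasDerivAt (fun μ : ℂ => u0Deriv (-μ) k x) (u0OrderDeriv (-N) k x * -1) (N : ℂ) :=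
      (hasDerivAt_u0Deriv_order (-N) k hx).comp (N : ℂ) (hasDerivAt_neg (N : ℂ))
    refine (h1.sub ((ha' N).mul (hasDerivAt_u0Deriv_order N k hx))).congr_deriv ?_
    simp only [hn']; ring
  have hsin' : HasDerivAt (fun μ : ℂ => Complex.sin (Real.pi * μ)) (c * Real.pi) (N : ℂ) := by
    have := (((hasDerivAt_id (N : ℂ)).const_mul (Real.pi : ℂ))).csin
    simpa [hc] using this
  have hv0 : ∀ x : ℝ, 0 < x → v0 N k x = n x / (2 * c) := by
    intro x hx
    have hint : ∃ M : ℤ, (N : ℂ) = M := ⟨N, by simp⟩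
    rw [v0, if_neg hk, if_pos hint]
    refine Tendsto.limUnder_eq ?_
    -- The limit of the quotient is the quotient of the limits of the two difference quotients.
    have t1 := (hasDerivAt_iff_tendsto_slope.1 (hnum x hx))
    have t2 := (hasDerivAt_iff_tendsto_slope.1 hsin')
    have t3 := (t1.div t2 (mul_ne_zero hc0 hpi)).const_mul ((Real.pi : ℂ) / 2)
    have e : (Real.pi : ℂ) / 2 * (n x / (c * Real.pi)) = n x / (2 * c) := by field_simp
    rw [e] at t3
    refine t3.congr' ?_
    filter_upwards [self_mem_nhdsWithin] with μ hμ
    have hμ : μ - N ≠ 0 := sub_ne_zero.2 hμ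
    simp only [Pi.div_apply, slope_def_field, v0NonInt, hsin, sub_zero]
    rw [hrel x hx, ← ha, sub_self, sub_zero, div_div_div_cancel_right₀ hμ]
    ring
  have bneg : u0 (-N) k =O[𝓝[>] (0 : ℝ)] fun x : ℝ => x ^ (1 / 2 + (N : ℝ)) := by
    have h1 := (u0_isBigO N k).const_mul_left a
    rw [Complex.natCast_re] at h1
    refine h1.congr' ?_ EventuallyEq.rfl
    filter_upwards [self_mem_nhdsWithin] with x hx
    exact (hrel x hx).symm
  have bO_neg : u0Order (-N) k =O[𝓝[>] (0 : ℝ)] fun x : ℝ => x ^ (1 / 2 - (N : ℝ)) :=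
    u0Order_isBigO _ k bneg (by linarith) (by simp [sub_eq_add_neg])
  have bOD : ∀ {m : ℂ} {s t : ℝ}, u0 m k =O[𝓝[>] (0 : ℝ)] (fun x : ℝ => x ^ s) →
      u0Order m k =O[𝓝[>] (0 : ℝ)] (fun x : ℝ => x ^ t) → -(1 / 2) - (N : ℝ) ≤ s - 1 →
      -(1 / 2) - (N : ℝ) ≤ t - 1 → -(1 / 2) - (N : ℝ) ≤ 1 / 2 + m.re →
      u0OrderDeriv m k =O[𝓝[>] (0 : ℝ)] fun x : ℝ => x ^ (-(1 / 2) - (N : ℝ)) := by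
    intro m s t h1 h2 hs ht hm
    have e : u0OrderDeriv m k = fun x => (1 / 2 + m) / x * u0Order m k x + 1 / x * u0 m k x +
        k ^ 2 / 2 * u0Order (m + 1) k x := by
      funext x; simp only [u0OrderDeriv]; ring
    rw [e]
    refine ((isBigO_rpow_mul (isBigO_const_div _) h2 (by linarith)).add
      (isBigO_rpow_mul (isBigO_const_div _) h1 (by linarith))).add ?_
    refine (u0Order_isBigO _ k (u0_isBigO (m + 1) k) ?_ ?_).const_mul_left _ <;>
    · simp only [Complex.add_re, Complex.one_re]; linarith
  -- Differentiate the Wronskian identity in the order at `N`. The numerator and its `x`-derivative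
  -- vanish there, so the order derivatives of `u0` and `u0Deriv` outside them do not contribute.
  have hw : ∀ x : ℝ, 0 < x → n x * u0Deriv N k x - n' x * u0 N k x = 2 * c := by
    intro x hx
    have h1 := ((hnum x hx).mul (hasDerivAt_u0Deriv_order N k hx)).sub
      ((hnum' x hx).mul (hasDerivAt_u0_order N k hx))
    have h2 := (hsin'.const_mul 2).div_const (Real.pi : ℂ)
    have h3 := h1.unique (h2.congr_of_eventuallyEq (Eventually.of_forall fun μ => by
      simp only [Pi.sub_apply, Pi.mul_apply]
      rw [← u0_wronskian μ k hx]; ring))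
    rw [hrel x hx, hrel' x hx, ← ha] at h3
    have h4 : 2 * (c * (Real.pi : ℂ)) / Real.pi = 2 * c := by field_simp
    rw [h4] at h3
    linear_combination h3
  refine ⟨fun x => n' x / (2 * c), .of_isBigO (by positivity) (continuousOn_freePotential _ k)
    (fun x hx => hasDerivAt_u0 _ k hx) (fun x hx => ?_) (fun x hx => hasDerivAt_u0Deriv _ k hx)
    (fun x hx => ?_) (fun x hx => ?_) ?_ ?_ ?_ ?_⟩
  · have h : HasDerivAt n (n' x) x :=
      (hasDerivAt_u0Order (-N) k hx).neg.sub (((hasDerivAt_u0 N k hx).const_mul (a * L * 2)).add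
        ((hasDerivAt_u0Order N k hx).const_mul a))
    refine (h.div_const (2 * c)).congr_of_eventuallyEq ?_
    filter_upwards [Ioi_mem_nhds hx] with y hy
    exact hv0 y hy
  · have h := ((hasDerivAt_u0OrderDeriv (-N) k hx).neg.sub
      (((hasDerivAt_u0Deriv N k hx).const_mul (a * L * 2)).add
        ((hasDerivAt_u0OrderDeriv N k hx).const_mul a))).div_const (2 * c)
    refine h.congr_deriv ?_
    rw [hv0 x hx, freePotential_neg, hrel x hx]
    simp only [hn]
    ring
  · rw [hv0 x hx]
    have := hw x hx
    field_simp
    linear_combination this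
  · exact_mod_cast u0_isBigO N k
  · exact_mod_cast u0Deriv_isBigO N k
  · have h : n =O[𝓝[>] (0 : ℝ)] fun x : ℝ => x ^ (1 / 2 - (N : ℝ)) := by
      refine bO_neg.neg_left.sub ((IsBigO.const_mul_left ?_ _).add (IsBigO.const_mul_left ?_ _))
      · exact (u0_isBigO N k).trans (isBigO_rpow_rpow (by simp; linarith))
      · exact u0Order_isBigO _ k (u0_isBigO N k) (by simp; linarith) (by simp; linarith)
    refine (h.const_mul_left (2 * c)⁻¹).congr' ?_ EventuallyEq.rfl
    filter_upwards [self_mem_nhdsWithin] with x hx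
    rw [hv0 x hx, div_eq_inv_mul]
  · have h : n' =O[𝓝[>] (0 : ℝ)] fun x : ℝ => x ^ (-(1 / 2) - (N : ℝ)) := by
      refine (bOD bneg bO_neg ?_ ?_ ?_).neg_left.sub
        ((IsBigO.const_mul_left ?_ _).add (IsBigO.const_mul_left (bOD (u0_isBigO N k)
          (u0Order_isBigO _ k (u0_isBigO N k) le_rfl ?_) ?_ ?_ ?_) _))
      · linarith
      · linarith
      · simp
      · exact (u0Deriv_isBigO N k).trans (isBigO_rpow_rpow (by simp; linarith))
      all_goals simp <;> linarith
    simp only [div_eq_inv_mul]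
    refine (h.const_mul_left (2 * c)⁻¹).congr_right fun x => ?_
    norm_num

/-- The unperturbed solutions form a fundamental system. -/
theorem exists_fundamentalSystem {m : ℂ} (hm : 0 ≤ m.re) (hm0 : m ≠ 0) (k : ℂ) :
    ∃ v' : ℝ → ℂ,
      FundamentalSystem m.re (freePotential m k) (u0 m k) (v0 m k) (u0Deriv m k) v' := by
  by_cases hk : k = 0
  · rw [hk]; exact fundamentalSystem_zero hm hm0
  by_cases hmi : ∃ N : ℤ, m = N
  · obtain ⟨N, rfl⟩ := hmi
    rw [Complex.intCast_re] at hm ⊢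
    have hN : 0 ≤ N := by exact_mod_cast hm
    lift N to ℕ using hN
    have h := fundamentalSystem_natCast (N := N) (k := k)
      (Nat.one_le_iff_ne_zero.2 (by rintro rfl; simp at hm0)) hk
    simpa using h
  · exact fundamentalSystem_nonInt hm hk hmi


/-! ### The potential class, and eigensolutions as integrated equations. -/

section Potential

variable {ε : ℝ} {Q : ℝ → ℂ}

theorem PotentialClass.integrableOn_Ioc (hQ : Q ∈ PotentialClass ε) :
    IntegrableOn (fun y : ℝ => y ^ (1 - ε) * ‖Q y‖) (Ioc 0 1) := by
  rw [integrableOn_Ioc_iff_integrableOn_Ioo]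
  exact hQ.2

theorem PotentialClass.integrableOn_mul_norm (hε : 0 ≤ ε) (hQ : Q ∈ PotentialClass ε) (X : ℝ) :
    IntegrableOn (fun y : ℝ => y * ‖Q y‖) (Ioc 0 X) := by
  have h1 : IntegrableOn (fun y : ℝ => y ^ (1 : ℝ) * ‖Q y‖) (Ioc 0 1) := by
    refine (PotentialClass.integrableOn_Ioc hQ).mono' (AEStronglyMeasurable.mul
      (((continuousOn_rpow_Ioi 1).mono Ioc_subset_Ioi_self).aestronglyMeasurable
        measurableSet_Ioc) (hQ.1.aestronglyMeasurable.mono_measure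
        (Measure.restrict_mono Ioc_subset_Ioi_self le_rfl)).norm) ?_
    filter_upwards [ae_restrict_mem measurableSet_Ioc] with y hy
    rw [Real.norm_of_nonneg (mul_nonneg (Real.rpow_nonneg hy.1.le _) (norm_nonneg _))]
    exact mul_le_mul_of_nonneg_right
      (Real.rpow_le_rpow_of_exponent_ge hy.1 hy.2 (by linarith)) (norm_nonneg _)
  simpa using integrableOn_rpow_mul_norm hQ.1 h1 X

end Potential

section Eigensolutions

variable {m k : ℂ} {Q f D : ℝ → ℂ}

/-- The equation is stated with `deriv (deriv f)`, which is meaningful only where `deriv f` is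
differentiable. Absolute continuity gives bounded variation and hence differentiability almost
everywhere. -/
theorem IsEigensolution.solvesWith (hf : IsEigensolution m k Q f)
    (hQ : LocallyIntegrableOn Q (Ioi 0)) :
    SolvesWith (freePotential m k) (fun x => -(Q x * f x)) f (deriv f) := by
  obtain ⟨⟨hd, hac⟩, heq⟩ := hf
  have hfc : ContinuousOn f (Ioi 0) := fun x hx => (hd x hx).continuousAt.continuousWithinAt
  have hdc : ContinuousOn (deriv f) (Ioi 0) := by
    intro x hx
    have hx : 0 < x := hx
    have h1 := (hac (x / 2) (2 * x) (half_pos hx) (by linarith)).continuousOn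
    refine (h1.continuousAt ?_).continuousWithinAt
    rw [uIcc_of_le (by linarith)]
    exact Icc_mem_nhds (by linarith) (by linarith)
  refine ⟨.of_hasDerivAt (fun x hx => (hd x hx).hasDerivAt) hdc,
    .of_absolutelyContinuousOnInterval ?_ hac ?_⟩
  · exact (((continuousOn_freePotential m k).mul hfc).locallyIntegrableOn measurableSet_Ioi).sub
      (hQ.mul_continuousOn hfc isOpen_Ioi.isLocallyClosed).neg
  · have hdiff : ∀ᵐ x : ℝ, 0 < x → DifferentiableAt ℝ (deriv f) x := by
      refine ae_pos_of_forall_Icc fun a b ha hab => ?_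
      have := (hac a b ha hab).boundedVariationOn.ae_differentiableAt_of_mem_uIcc
      rwa [uIcc_of_le hab] at this
    filter_upwards [hdiff, heq] with x h1 h2 hx
    refine (h1 hx).hasDerivAt.congr_deriv ?_
    have := h2 hx
    simp only [freePotential]
    linear_combination -this

theorem SolvesWith.isEigensolution
    (h : SolvesWith (freePotential m k) (fun x => -(Q x * f x)) f D) :
    IsEigensolution m k Q f := by
  have hD : EqOn D (deriv f) (Ioi 0) := fun x hx => (h.hasDerivAt hx).deriv.symm
  refine ⟨⟨fun x hx => (h.hasDerivAt hx).differentiableAt, fun a b ha hab => ?_⟩, ?_⟩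
  · have hb := ha.trans_le hab
    exact absolutelyContinuousOnInterval_congr (h.2.absolutelyContinuousOnInterval ha hb)
      (hD.mono (uIcc_subset_Ioi ha hb))
  · filter_upwards [h.2.ae_hasDerivAt] with x hx hx0
    have h1 : HasDerivAt (deriv f) _ x := (hx hx0).congr_of_eventuallyEq (by
      filter_upwards [Ioi_mem_nhds hx0] with y hy
      exact (hD hy).symm)
    rw [h1.deriv]
    simp only [freePotential]
    ring

end Eigensolutions

/-! ### From integral kernels to the operators with variable limits. -/

section Kernels

variable {m k : ℂ} {Q f g : ℝ → ℂ}

theorem twoSidedKernelOn_integrable {x : ℝ} (hx : x ∈ Ioc (0 : ℝ) 1)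
    (hu : IntegrableOn (fun y => u0 m k y * (Q y * f y)) (Ioc 0 x))
    (hv : IntegrableOn (fun y => v0 m k y * (Q y * f y)) (Ioc x 1)) :
    GreenQDefinedAt (twoSidedKernelOn 1 m k) Q f x ∧
      greenQ (twoSidedKernelOn 1 m k) Q f x = twoSidedOp (u0 m k) (v0 m k) Q f x := by
  set F : ℝ → ℂ := fun y => twoSidedKernelOn 1 m k x y * (Q y * f y) with hF
  have e1 : EqOn (fun y => v0 m k x * (u0 m k y * (Q y * f y))) F (Ioc 0 x) := by
    intro y hy
    simp only [hF, twoSidedKernelOn, twoSidedKernel, if_pos hy.2,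
      if_pos (And.intro hx.2 (hy.2.trans hx.2))]
    ring
  have e2 : EqOn (fun y => u0 m k x * (v0 m k y * (Q y * f y))) F (Ioc x 1) := by
    intro y hy
    simp only [hF, twoSidedKernelOn, twoSidedKernel, if_neg (not_le.2 hy.1),
      if_pos (And.intro hx.2 hy.2)]
    ring
  have e3 : EqOn (fun _ => (0 : ℂ)) F (Ioi 1) := by
    intro y hy
    simp only [hF, twoSidedKernelOn, if_neg (fun h : x ≤ 1 ∧ y ≤ 1 => not_le.2 hy h.2), zero_mul]
  have i1 : IntegrableOn F (Ioc 0 x) :=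
    IntegrableOn.congr_fun (Integrable.const_mul hu _) e1 measurableSet_Ioc
  have i2 : IntegrableOn F (Ioc x 1) :=
    IntegrableOn.congr_fun (Integrable.const_mul hv _) e2 measurableSet_Ioc
  have i3 : IntegrableOn F (Ioi 1) := IntegrableOn.congr_fun integrableOn_zero e3 measurableSet_Ioi
  have i12 : IntegrableOn F (Ioc 0 1) := by
    rw [← Ioc_union_Ioc_eq_Ioc hx.1.le hx.2]; exact i1.union i2
  have hIoi : Ioi (0 : ℝ) = Ioc 0 1 ∪ Ioi 1 := (Ioc_union_Ioi_eq_Ioi zero_le_one).symm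
  refine ⟨by rw [GreenQDefinedAt, hIoi]; exact i12.union i3, ?_⟩
  have hdisj : Disjoint (Ioc (0 : ℝ) 1) (Ioi 1) :=
    disjoint_left.2 fun y h1 h2 => not_lt.2 h1.2 h2
  have hdisj' : Disjoint (Ioc (0 : ℝ) x) (Ioc x 1) :=
    disjoint_left.2 fun y h1 h2 => not_lt.2 h1.2 h2.1
  rw [greenQ, hIoi, setIntegral_union hdisj measurableSet_Ioi i12 i3,
    ← Ioc_union_Ioc_eq_Ioc hx.1.le hx.2, setIntegral_union hdisj' measurableSet_Ioc i1 i2,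
    ← setIntegral_congr_fun measurableSet_Ioc e1, ← setIntegral_congr_fun measurableSet_Ioc e2,
    ← setIntegral_congr_fun measurableSet_Ioi e3, integral_const_mul, integral_const_mul,
    integral_zero, add_zero, twoSidedOp, intervalIntegral.integral_of_le hx.1.le,
    intervalIntegral.integral_of_le hx.2]

theorem twoSidedKernelOn_definedAt_of_one_lt {x : ℝ} (hx : 1 < x) :
    GreenQDefinedAt (twoSidedKernelOn 1 m k) Q f x := by
  have : (fun y => twoSidedKernelOn 1 m k x y * (Q y * f y)) = fun _ => 0 := by
    funext y
    simp only [twoSidedKernelOn, if_neg (fun h : x ≤ 1 ∧ y ≤ 1 => not_le.2 hx h.1), zero_mul]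
  rw [GreenQDefinedAt, this]
  exact integrableOn_zero

/-- The compressed kernel ignores values beyond `1`. There the iterates and their extensions
`extIter` may differ without affecting the next iterate on `]0,1]`. -/
theorem twoSidedKernelOn_mul_congr (h : EqOn f g (Ioc 0 1)) (x : ℝ) :
    EqOn (fun y => twoSidedKernelOn 1 m k x y * (Q y * f y))
      (fun y => twoSidedKernelOn 1 m k x y * (Q y * g y)) (Ioi 0) := by
  intro y hy
  by_cases hy1 : y ≤ 1
  · simp only [h ⟨hy, hy1⟩]
  · simp only [twoSidedKernelOn, if_neg (fun h : x ≤ 1 ∧ y ≤ 1 => hy1 h.2), zero_mul]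

theorem forwardKernel_integrable {x : ℝ} (hx : 0 < x)
    (hu : IntegrableOn (fun y => u0 m k y * (Q y * f y)) (Ioc 0 x))
    (hv : IntegrableOn (fun y => v0 m k y * (Q y * f y)) (Ioc 0 x)) :
    GreenQDefinedAt (forwardKernel m k) Q f x ∧
      greenQ (forwardKernel m k) Q f x = forwardOp (u0 m k) (v0 m k) (fun y => Q y * f y) x := by
  set F : ℝ → ℂ := fun y => forwardKernel m k x y * (Q y * f y) with hF
  have e1 : EqOn (fun y => v0 m k x * (u0 m k y * (Q y * f y)) -
      u0 m k x * (v0 m k y * (Q y * f y))) F (Ioc 0 x) := by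
    intro y hy
    simp only [hF, forwardKernel, if_pos hy.2]
    ring
  have e2 : EqOn (fun _ => (0 : ℂ)) F (Ioi x) := by
    intro y hy
    simp only [hF, forwardKernel, if_neg (not_le.2 (mem_Ioi.1 hy)), zero_mul]
  have hu' := Integrable.const_mul hu (v0 m k x)
  have hv' := Integrable.const_mul hv (u0 m k x)
  have i1 : IntegrableOn F (Ioc 0 x) :=
    IntegrableOn.congr_fun (hu'.sub hv') e1 measurableSet_Ioc
  have i2 : IntegrableOn F (Ioi x) := IntegrableOn.congr_fun integrableOn_zero e2 measurableSet_Ioi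
  have hIoi : Ioi (0 : ℝ) = Ioc 0 x ∪ Ioi x := (Ioc_union_Ioi_eq_Ioi hx.le).symm
  refine ⟨by rw [GreenQDefinedAt, hIoi]; exact i1.union i2, ?_⟩
  have hdisj : Disjoint (Ioc (0 : ℝ) x) (Ioi x) :=
    disjoint_left.2 fun y h1 h2 => not_lt.2 h1.2 h2
  rw [greenQ, hIoi, setIntegral_union hdisj measurableSet_Ioi i1 i2,
    ← setIntegral_congr_fun measurableSet_Ioc e1, ← setIntegral_congr_fun measurableSet_Ioi e2,
    integral_sub hu' hv', integral_const_mul, integral_const_mul,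
    integral_zero, add_zero, forwardOp, intervalIntegral.integral_of_le hx.le,
    intervalIntegral.integral_of_le hx.le]

theorem forwardKernel_mul_congr {x : ℝ} (hx : x ≤ 1) (h : EqOn f g (Ioc 0 1)) :
    EqOn (fun y => forwardKernel m k x y * (Q y * f y))
      (fun y => forwardKernel m k x y * (Q y * g y)) (Ioi 0) := by
  intro y hy
  by_cases hy1 : y ≤ x
  · simp only [h ⟨hy, hy1.trans hx⟩]
  · simp only [forwardKernel, if_neg hy1, zero_mul]

theorem GreenQDefinedAt.congr {G : ℝ → ℝ → ℂ} {x : ℝ} (h : GreenQDefinedAt G Q f x)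
    (hfg : EqOn (fun y => G x y * (Q y * f y)) (fun y => G x y * (Q y * g y)) (Ioi 0)) :
    GreenQDefinedAt G Q g x :=
  IntegrableOn.congr_fun h hfg measurableSet_Ioi

theorem greenQ_congr {G : ℝ → ℝ → ℂ} {x : ℝ}
    (hfg : EqOn (fun y => G x y * (Q y * f y)) (fun y => G x y * (Q y * g y)) (Ioi 0)) :
    greenQ G Q f x = greenQ G Q g x :=
  setIntegral_congr_fun measurableSet_Ioi hfg

end Kernels

/-! ### Iterates of the two-sided operator, the truncated series and its residual. -/

section Iterates

/-- The iterates `(G Q)^j u⁰_{-m}` of the two-sided Green operator, extended to `]0,∞[` so that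
they solve the unperturbed equation with inhomogeneity given by `Q` times their predecessor. -/
noncomputable def extIter (m k : ℂ) (Q : ℝ → ℂ) (j : ℕ) : ℝ → ℂ :=
  (twoSidedOp (u0 m k) (v0 m k) Q)^[j] (u0 (-m) k)

/-- The extension of the truncated series to `]0,∞[`. -/
noncomputable def extTrunc (m k : ℂ) (Q : ℝ → ℂ) (n : ℕ) (x : ℝ) : ℂ :=
  ∑ j ∈ Finset.range (n + 1), (-1) ^ j * extIter m k Q j x

theorem extIter_succ (m k : ℂ) (Q : ℝ → ℂ) (j : ℕ) :
    extIter m k Q (j + 1) = twoSidedOp (u0 m k) (v0 m k) Q (extIter m k Q j) :=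
  Function.iterate_succ_apply' _ _ _

theorem iter_succ (m k : ℂ) (Q : ℝ → ℂ) (j : ℕ) :
    iter m k Q (j + 1) = greenQ (twoSidedKernelOn 1 m k) Q (iter m k Q j) :=
  Function.iterate_succ_apply' _ _ _

theorem trunc_eq_sum_iter (m k : ℂ) (Q : ℝ → ℂ) (n : ℕ) (x : ℝ) :
    trunc m k Q n x = ∑ j ∈ Finset.range (n + 1), (-1) ^ j * iter m k Q j x := by
  have h : ∀ j, (fun f : ℝ → ℂ => -greenQ (twoSidedKernelOn 1 m k) Q f)^[j] (u0 (-m) k) =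
      fun x => (-1) ^ j * iter m k Q j x := by
    intro j
    induction j with
    | zero => funext x; simp [iter]
    | succ j ih =>
      rw [Function.iterate_succ_apply', ih, iter_succ]
      funext x
      simp only [Pi.neg_apply, greenQ]
      rw [← integral_const_mul, ← integral_neg]
      congr 1
      funext y
      ring
  simp only [trunc, h]

theorem le_rpow_of_le_rpow_add {M x s a b : ℝ} (hx : x ∈ Ioc (0 : ℝ) 1) (ha : 0 ≤ a)
    (h : b ≤ M * x ^ (s + a)) : b ≤ |M| * x ^ s := by
  refine h.trans ((mul_le_mul_of_nonneg_right (le_abs_self M)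
    (Real.rpow_nonneg hx.1.le _)).trans ?_)
  exact mul_le_mul_of_nonneg_left
    (Real.rpow_le_rpow_of_exponent_ge hx.1 hx.2 (by linarith)) (abs_nonneg M)

variable {m k : ℂ} {Q : ℝ → ℂ} {ε : ℝ}

/-- Start from `u_{-m} = O(x^{1/2-Re m})` and gain `ε` per step, saturating at the order of `u`. -/
theorem extIter_bound (hm : 0 ≤ m.re) (hm0 : m ≠ 0) (hε : 0 ≤ ε) (hQ : Q ∈ PotentialClass ε)
    (j : ℕ) : ContinuousOn (extIter m k Q j) (Ioi 0) ∧ ∃ M : ℝ, ∀ x ∈ Ioc (0 : ℝ) 1,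
      ‖extIter m k Q j x‖ ≤ M * x ^ (1 / 2 - m.re + min (j * ε) (2 * m.re)) := by
  obtain ⟨v', S⟩ := exists_fundamentalSystem hm hm0 k
  induction j with
  | zero =>
    have hc : ContinuousOn (u0 (-m) k) (Ioi 0) :=
      fun x hx => (hasDerivAt_u0 (-m) k hx).continuousAt.continuousWithinAt
    refine ⟨hc, ?_⟩
    obtain ⟨M, -, hM⟩ := exists_bound_of_isBigO hc (u0_isBigO (-m) k) 1
    refine ⟨M, fun x hx => (hM x hx).trans_eq ?_⟩
    have : min (((0 : ℕ) : ℝ) * ε) (2 * m.re) = 0 := by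
      rw [Nat.cast_zero, zero_mul]; exact min_eq_left (by linarith)
    rw [this, Complex.neg_re, add_zero, sub_eq_add_neg]
  | succ j ih =>
    obtain ⟨hc, M, hM⟩ := ih
    have ha : 0 ≤ min ((j : ℝ) * ε) (2 * m.re) := le_min (by positivity) (by linarith)
    rw [extIter_succ]
    refine ⟨?_, ?_⟩
    · obtain ⟨D, hD⟩ := S.solvesWith_twoSidedOp hQ.1 (PotentialClass.integrableOn_mul_norm hε hQ) hc
        (fun x hx => le_rpow_of_le_rpow_add hx ha (hM x hx))
      exact hD.continuousOn
    · refine S.norm_twoSidedOp_le (PotentialClass.integrableOn_Ioc hQ) hM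
        (le_min (by positivity) (by linarith)) ?_ (min_le_right _ _)
      push_cast
      rw [← min_add_add_right, add_one_mul]
      exact min_le_min le_rfl (by linarith)

theorem extIter_weak_bound (hm : 0 ≤ m.re) (hm0 : m ≠ 0) (hε : 0 ≤ ε) (hQ : Q ∈ PotentialClass ε)
    (j : ℕ) : ∃ M : ℝ, ∀ x ∈ Ioc (0 : ℝ) 1, ‖extIter m k Q j x‖ ≤ M * x ^ (1 / 2 - m.re) := by
  obtain ⟨-, M, hM⟩ := extIter_bound (k := k) hm hm0 hε hQ j
  exact ⟨|M|, fun x hx => le_rpow_of_le_rpow_add hx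
    (le_min (by positivity) (by linarith)) (hM x hx)⟩

theorem extIter_greenQ (hm : 0 ≤ m.re) (hm0 : m ≠ 0) (hε : 0 ≤ ε) (hQ : Q ∈ PotentialClass ε)
    (j : ℕ) {x : ℝ} (hx : x ∈ Ioc (0 : ℝ) 1) :
    GreenQDefinedAt (twoSidedKernelOn 1 m k) Q (extIter m k Q j) x ∧
      greenQ (twoSidedKernelOn 1 m k) Q (extIter m k Q j) x = extIter m k Q (j + 1) x := by
  obtain ⟨v', S⟩ := exists_fundamentalSystem hm hm0 k
  have hc := (extIter_bound (k := k) hm hm0 hε hQ j).1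
  obtain ⟨M, hM⟩ := extIter_weak_bound (k := k) hm hm0 hε hQ j
  rw [extIter_succ]
  refine twoSidedKernelOn_integrable hx
    (S.integrableOn_u_mul_mul hQ.1 (PotentialClass.integrableOn_mul_norm hε hQ) hc hM x) ?_
  have hl := (hQ.1.mul_continuousOn hc isOpen_Ioi.isLocallyClosed).continuousOn_mul
    S.continuousOn_v isOpen_Ioi.isLocallyClosed
  exact (hl.integrableOn_compact_subset (fun y hy => hx.1.trans_le hy.1)
    (isCompact_Icc (a := x) (b := 1))).mono_set Ioc_subset_Icc_self

theorem extIter_eqOn_iter (hm : 0 ≤ m.re) (hm0 : m ≠ 0) (hε : 0 ≤ ε) (hQ : Q ∈ PotentialClass ε)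
    (j : ℕ) : EqOn (extIter m k Q j) (iter m k Q j) (Ioc 0 1) := by
  induction j with
  | zero => exact fun x _ => rfl
  | succ j ih =>
    intro x hx
    rw [← (extIter_greenQ hm hm0 hε hQ j hx).2, iter_succ]
    exact greenQ_congr (twoSidedKernelOn_mul_congr ih x)

theorem extTrunc_eqOn_trunc (hm : 0 ≤ m.re) (hm0 : m ≠ 0) (hε : 0 ≤ ε)
    (hQ : Q ∈ PotentialClass ε) (n : ℕ) : EqOn (extTrunc m k Q n) (trunc m k Q n) (Ioc 0 1) := by
  intro x hx
  rw [trunc_eq_sum_iter, extTrunc]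
  exact Finset.sum_congr rfl fun j _ => by rw [extIter_eqOn_iter hm hm0 hε hQ j hx]

theorem extTrunc_bound (hm : 0 ≤ m.re) (hm0 : m ≠ 0) (hε : 0 ≤ ε) (hQ : Q ∈ PotentialClass ε)
    (n : ℕ) : ∃ M : ℝ, ∀ x ∈ Ioc (0 : ℝ) 1, ‖extTrunc m k Q n x‖ ≤ M * x ^ (1 / 2 - m.re) := by
  choose M hM using extIter_weak_bound (k := k) hm hm0 hε hQ
  refine ⟨∑ j ∈ Finset.range (n + 1), M j, fun x hx => ?_⟩
  rw [Finset.sum_mul]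
  refine norm_sum_le_of_le _ fun j _ => ?_
  rw [norm_mul, norm_pow, norm_neg, norm_one, one_pow, one_mul]
  exact hM j x hx

/-- Telescoping: the new iterate solves the free equation with source `Q` times the old one, so it
cancels the previous residual and leaves the next. -/
theorem solvesWith_extTrunc (hm : 0 ≤ m.re) (hm0 : m ≠ 0) (hε : 0 ≤ ε)
    (hQ : Q ∈ PotentialClass ε) (n : ℕ) :
    ∃ D : ℝ → ℂ, SolvesWith (freePotential m k)
      (fun x => -(Q x * extTrunc m k Q n x) + (-1) ^ n * (Q x * extIter m k Q n x))
      (extTrunc m k Q n) D := by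
  obtain ⟨v', S⟩ := exists_fundamentalSystem hm hm0 k
  induction n with
  | zero =>
    refine ⟨u0Deriv (-m) k, .of_hasDerivAt (fun x hx => ?_) ?_, .of_hasDerivAt (fun x hx => ?_) ?_⟩
    · refine (hasDerivAt_u0 (-m) k hx).congr_of_eventuallyEq (Eventually.of_forall fun y => ?_)
      simp [extTrunc, extIter]
    · exact fun x hx => (hasDerivAt_u0Deriv (-m) k hx).continuousAt.continuousWithinAt
    · refine (hasDerivAt_u0Deriv (-m) k hx).congr_deriv ?_
      simp [extTrunc, extIter, freePotential_neg]
    · simp only [extTrunc, extIter]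
      simp only [zero_add, Finset.range_one, Finset.sum_singleton, pow_zero, one_mul,
        Function.iterate_zero, id, neg_add_cancel, sub_zero]
      exact (continuousOn_freePotential m k).mul
        fun x hx => (hasDerivAt_u0 (-m) k hx).continuousAt.continuousWithinAt
  | succ n ih =>
    obtain ⟨D, hD⟩ := ih
    obtain ⟨M, hM⟩ := extIter_weak_bound (k := k) hm hm0 hε hQ n
    obtain ⟨E, hE⟩ := S.solvesWith_twoSidedOp hQ.1 (PotentialClass.integrableOn_mul_norm hε hQ)
      (extIter_bound (k := k) hm hm0 hε hQ n).1 hM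
    have hs : ∀ x, extTrunc m k Q (n + 1) x =
        extTrunc m k Q n x + (-1) ^ (n + 1) * extIter m k Q (n + 1) x := fun x =>
      Finset.sum_range_succ _ _
    refine ⟨_, (hD.add (hE.const_mul ((-1) ^ (n + 1)))).congr (fun x _ => ?_) (fun x _ => ?_)⟩
    · simp only [hs]; ring
    · simp only [hs, extIter_succ]

theorem admissible_mul_extIter (hm : 0 ≤ m.re) (hm0 : m ≠ 0) (hε : 0 ≤ ε)
    (hQ : Q ∈ PotentialClass ε) {n : ℕ} (hn : m.re ≤ ε / 2 * ((n : ℝ) + 1)) :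
    Admissible m.re (fun x => Q x * extIter m k Q n x) := by
  obtain ⟨hc, M, hM⟩ := extIter_bound (k := k) hm hm0 hε hQ n
  have hl := hQ.1.mul_continuousOn hc isOpen_Ioi.isLocallyClosed
  have hM0 : 0 ≤ M := by simpa using (norm_nonneg _).trans (hM 1 ⟨one_pos, le_rfl⟩)
  have hs : Ioc (0 : ℝ) 1 ⊆ Ioi 0 := Ioc_subset_Ioi_self
  refine ⟨hl, ((PotentialClass.integrableOn_Ioc hQ).const_mul M).mono' ?_ ?_⟩
  · exact (((continuousOn_rpow_Ioi _).mono hs).aestronglyMeasurable measurableSet_Ioc).mul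
      (hl.aestronglyMeasurable.mono_measure (Measure.restrict_mono hs le_rfl)).norm
  · filter_upwards [ae_restrict_mem measurableSet_Ioc] with y hy
    have h0 : 0 ≤ y ^ (1 / 2 - m.re) := Real.rpow_nonneg hy.1.le _
    rw [Real.norm_of_nonneg (mul_nonneg h0 (norm_nonneg _)), norm_mul]
    -- The condition on `n` is used here, as `2 Re m - ε ≤ nε`; the other branch of the minimum uses
    -- only `ε ≥ 0`.
    have e : y ^ (1 / 2 - m.re) * y ^ (1 / 2 - m.re + min (n * ε) (2 * m.re)) ≤ y ^ (1 - ε) := by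
      rw [← Real.rpow_add hy.1]
      refine Real.rpow_le_rpow_of_exponent_ge hy.1 hy.2 ?_
      have : 2 * m.re - ε ≤ min (n * ε) (2 * m.re) := le_min (by linarith) (by linarith)
      linarith
    calc y ^ (1 / 2 - m.re) * (‖Q y‖ * ‖extIter m k Q n y‖)
        ≤ y ^ (1 / 2 - m.re) * (‖Q y‖ *
          (M * y ^ (1 / 2 - m.re + min (n * ε) (2 * m.re)))) := by
          gcongr; exact hM y hy
      _ = M * ((y ^ (1 / 2 - m.re) * y ^ (1 / 2 - m.re + min (n * ε) (2 * m.re))) * ‖Q y‖) := by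
          ring
      _ ≤ M * (y ^ (1 - ε) * ‖Q y‖) := by gcongr

/-- The weight and the bound multiply to `y^{1-2ρ}`, integrable at `0` because `ρ < 1`. -/
theorem admissible_of_bound {f : ℝ → ℂ} {ρ M : ℝ} (hρ : ρ < 1) (hf : ContinuousOn f (Ioi 0))
    (hM : ∀ x ∈ Ioc (0 : ℝ) 1, ‖f x‖ ≤ M * x ^ (1 / 2 - ρ)) : Admissible ρ f := by
  have hs : Ioc (0 : ℝ) 1 ⊆ Ioi 0 := Ioc_subset_Ioi_self
  have hi : IntegrableOn (fun y : ℝ => y ^ (1 - 2 * ρ)) (Ioc 0 1) :=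
    (intervalIntegrable_iff_integrableOn_Ioc_of_le zero_le_one).1
      (intervalIntegral.intervalIntegrable_rpow' (by linarith))
  refine ⟨hf.locallyIntegrableOn measurableSet_Ioi, (hi.const_mul M).mono' ?_ ?_⟩
  · exact (((continuousOn_rpow_Ioi _).mono hs).mul (hf.mono hs).norm).aestronglyMeasurable
      measurableSet_Ioc
  · filter_upwards [ae_restrict_mem measurableSet_Ioc] with y hy
    have h0 : 0 ≤ y ^ (1 / 2 - ρ) := Real.rpow_nonneg hy.1.le _
    rw [Real.norm_of_nonneg (mul_nonneg h0 (norm_nonneg _))]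
    calc y ^ (1 / 2 - ρ) * ‖f y‖ ≤ y ^ (1 / 2 - ρ) * (M * y ^ (1 / 2 - ρ)) := by
          gcongr; exact hM y hy
      _ = M * (y ^ (1 / 2 - ρ) * y ^ (1 / 2 - ρ)) := by ring
      _ = _ := by rw [← Real.rpow_add hy.1]; ring_nf

end Iterates


/-! ### Existence, uniqueness and the resolvent formula. -/

section Main

variable {m k : ℂ} {Q : ℝ → ℂ} {ε : ℝ}

theorem forwardOp_const_mul (u v p : ℝ → ℂ) (c : ℂ) (x : ℝ) :
    forwardOp u v (fun y => c * p y) x = c * forwardOp u v p x := by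
  simp only [forwardOp, mul_left_comm _ c, intervalIntegral.integral_const_mul]
  ring

theorem eqOn_of_agreesNearZero (hm : 0 ≤ m.re) (hm0 : m ≠ 0) (hε : 0 ≤ ε)
    (hQ : Q ∈ PotentialClass ε) {f g T : ℝ → ℂ} (hf : IsEigensolution m k Q f)
    (hg : IsEigensolution m k Q g) (hfT : AgreesNearZero m f T) (hgT : AgreesNearZero m g T) :
    EqOn f g (Ioi 0) := by
  obtain ⟨v', S⟩ := exists_fundamentalSystem hm hm0 k
  have hd : SolvesWith (freePotential m k) (fun x => -(Q x * (f x + -1 * g x)))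
      (fun x => f x + -1 * g x) (fun x => deriv f x + -1 * deriv g x) :=
    ((hf.solvesWith hQ.1).add ((hg.solvesWith hQ.1).const_mul (-1))).congr
      (fun x _ => by ring) (fun _ _ => rfl)
  have h1 : (fun x => f x + -1 * g x) =o[𝓝[>] (0 : ℝ)] fun x : ℝ => x ^ (1 / 2 + m.re) :=
    (hfT.1.sub hgT.1).congr_left fun x => by ring
  have h2 : (fun x => deriv f x + -1 * deriv g x) =o[𝓝[>] (0 : ℝ)]
      fun x : ℝ => x ^ (-1 / 2 + m.re) :=
    (hfT.2.sub hgT.2).congr_left fun x => by ring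
  intro x hx
  have := S.eq_zero_of_isLittleO hQ.1 (PotentialClass.integrableOn_mul_norm hε hQ) hd h1 h2 hx
  linear_combination this

/-- Existence of the solution asymptotic to a truncated series, possibly for another parameter. -/
theorem exists_eigensolution (hm : 0 ≤ m.re) (hm0 : m ≠ 0) (hε : 0 ≤ ε)
    (hQ : Q ∈ PotentialClass ε) {n : ℕ} (hn : m.re ≤ ε / 2 * ((n : ℝ) + 1)) {k' : ℂ}
    (hk' : k' = k ∨ m.re < 1) :
    ∃ r : ℝ → ℂ, IsEigensolution m k Q (fun x => extTrunc m k' Q n x + r x) ∧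
      AgreesNearZero m (fun x => extTrunc m k' Q n x + r x) (trunc m k' Q n) ∧
      ContinuousOn r (Ioi 0) ∧ (∃ M : ℝ, ∀ x ∈ Ioc (0 : ℝ) 1, ‖r x‖ ≤ M * x ^ (1 / 2 + m.re)) ∧
      ∀ x : ℝ, 0 < x → r x + forwardOp (u0 m k) (v0 m k) (fun y => Q y * r y) x =
        forwardOp (u0 m k) (v0 m k) (fun y => (-1) ^ (n + 1) * (Q y * extIter m k' Q n y) +
          (k' ^ 2 - k ^ 2) * extTrunc m k' Q n y) x := by
  obtain ⟨v', S⟩ := exists_fundamentalSystem hm hm0 k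
  obtain ⟨D, hD⟩ := solvesWith_extTrunc (k := k') hm hm0 hε hQ n
  -- The free potentials for `k'` and `k` differ by a constant, which moves to the right-hand side
  -- as a multiple of the series.
  have hT : SolvesWith (freePotential m k)
      (fun x => -(Q x * extTrunc m k' Q n x) + (-1) ^ n * (Q x * extIter m k' Q n x) +
        (k ^ 2 - k' ^ 2) * extTrunc m k' Q n x) (extTrunc m k' Q n) D :=
    ⟨hD.1, hD.2.congr (fun x _ => by simp only [freePotential]; ring) (fun _ _ => rfl)⟩
  have hadm : Admissible m.re (fun y => (-1) ^ (n + 1) * (Q y * extIter m k' Q n y) +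
      (k' ^ 2 - k ^ 2) * extTrunc m k' Q n y) := by
    have h1 := (admissible_mul_extIter (k := k') hm hm0 hε hQ hn).const_mul ((-1) ^ (n + 1))
    rcases hk' with rfl | hlt
    · simpa using h1
    · obtain ⟨M, hM⟩ := extTrunc_bound (k := k') hm hm0 hε hQ n
      exact h1.add ((admissible_of_bound hlt hT.continuousOn hM).const_mul _)
  obtain ⟨r, Dr, h1, h2, h3, h4, h5, h6⟩ := S.exists_correction hQ.1
    (PotentialClass.integrableOn_mul_norm hε hQ) hT hadm (fun x _ => by ring)
  refine ⟨r, h1.isEigensolution, ⟨?_, ?_⟩, h4, h5, h6⟩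
  · refine h2.congr' ?_ EventuallyEq.rfl
    filter_upwards [Ioc_mem_nhdsGT one_pos] with x hx
    rw [← extTrunc_eqOn_trunc hm hm0 hε hQ n hx]; ring
  · refine h3.congr' ?_ EventuallyEq.rfl
    filter_upwards [Ioo_mem_nhdsGT one_pos] with x hx
    -- Derivatives agree only where the functions agree on a neighbourhood, hence the open interval:
    -- the truncated series may jump at `1`.
    have e : trunc m k' Q n =ᶠ[𝓝 x] extTrunc m k' Q n := by
      filter_upwards [Ioo_mem_nhds hx.1 hx.2] with y hy
      exact (extTrunc_eqOn_trunc hm hm0 hε hQ n ⟨hy.1, hy.2.le⟩).symm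
    rw [e.deriv_eq, (h1.hasDerivAt hx.1).deriv, (hT.hasDerivAt hx.1).deriv]
    ring

theorem differentiableAt_trunc (hm : 0 ≤ m.re) (hm0 : m ≠ 0) (hε : 0 ≤ ε)
    (hQ : Q ∈ PotentialClass ε) (n : ℕ) {x : ℝ} (hx : x ∈ Ioo (0 : ℝ) 1) :
    DifferentiableAt ℝ (trunc m k Q n) x := by
  obtain ⟨D, hD⟩ := solvesWith_extTrunc (k := k) hm hm0 hε hQ n
  refine (hD.hasDerivAt hx.1).differentiableAt.congr_of_eventuallyEq ?_
  filter_upwards [Ioo_mem_nhds hx.1 hx.2] with y hy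
  exact (extTrunc_eqOn_trunc hm hm0 hε hQ n ⟨hy.1, hy.2.le⟩).symm

theorem greenQDefinedAt_iter (hm : 0 ≤ m.re) (hm0 : m ≠ 0) (hε : 0 ≤ ε)
    (hQ : Q ∈ PotentialClass ε) (j : ℕ) {x : ℝ} (hx : 0 < x) :
    GreenQDefinedAt (twoSidedKernelOn 1 m k) Q (iter m k Q j) x := by
  rcases le_or_gt x 1 with hx1 | hx1
  · exact (extIter_greenQ hm hm0 hε hQ j ⟨hx, hx1⟩).1.congr
      (twoSidedKernelOn_mul_congr (extIter_eqOn_iter hm hm0 hε hQ j) x)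
  · exact twoSidedKernelOn_definedAt_of_one_lt hx1

theorem forwardKernel_iter (hm : 0 ≤ m.re) (hm0 : m ≠ 0) (hε : 0 ≤ ε)
    (hQ : Q ∈ PotentialClass ε) {n : ℕ} (hn : m.re ≤ ε / 2 * ((n : ℝ) + 1)) {x : ℝ}
    (hx : x ∈ Ioc (0 : ℝ) 1) :
    GreenQDefinedAt (forwardKernel m k) Q (iter m k Q n) x ∧
      greenQ (forwardKernel m k) Q (iter m k Q n) x =
        forwardOp (u0 m k) (v0 m k) (fun y => Q y * extIter m k Q n y) x := by
  obtain ⟨v', S⟩ := exists_fundamentalSystem hm hm0 k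
  have hadm := admissible_mul_extIter (k := k) hm hm0 hε hQ hn
  have h := forwardKernel_integrable hx.1 (S.integrableOn_u_mul hadm x) (S.integrableOn_v_mul hadm x)
  have hc := forwardKernel_mul_congr (m := m) (k := k) (Q := Q) hx.2
    (extIter_eqOn_iter (k := k) hm hm0 hε hQ n)
  exact ⟨h.1.congr hc, by rw [← greenQ_congr hc, h.2]⟩

/-- Competitors in the uniqueness of the resolvent are only measurable with a bound almost
everywhere, so continuity of `s` is not available. -/
theorem integrableOn_mul_mul_of_ae {w s : ℝ → ℂ} {ρ K C x : ℝ} (hε : 0 ≤ ε)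
    (hQ : Q ∈ PotentialClass ε) (hw : ContinuousOn w (Ioi 0))
    (hK : ∀ y ∈ Ioc 0 x, ‖w y‖ ≤ K * y ^ (1 / 2 - ρ))
    (hs : AEStronglyMeasurable s (volume.restrict (Ioc 0 x)))
    (hC : ∀ᵐ y ∂volume.restrict (Ioc 0 x), ‖s y‖ ≤ C * y ^ (1 / 2 + ρ)) :
    IntegrableOn (fun y => w y * (Q y * s y)) (Ioc 0 x) := by
  have hsub : Ioc 0 x ⊆ Ioi 0 := Ioc_subset_Ioi_self
  refine ((PotentialClass.integrableOn_mul_norm hε hQ x).const_mul (K * C)).mono'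
    (((hw.mono hsub).aestronglyMeasurable measurableSet_Ioc).mul
      ((hQ.1.aestronglyMeasurable.mono_measure (Measure.restrict_mono hsub le_rfl)).mul hs)) ?_
  filter_upwards [ae_restrict_mem measurableSet_Ioc, hC] with y hy hyC
  have e : y ^ (1 / 2 - ρ) * y ^ (1 / 2 + ρ) = y := by
    rw [← Real.rpow_add hy.1]; ring_nf; exact Real.rpow_one y
  have hK0 : 0 ≤ K * y ^ (1 / 2 - ρ) := (norm_nonneg _).trans (hK y hy)
  rw [norm_mul, norm_mul]
  calc ‖w y‖ * (‖Q y‖ * ‖s y‖) ≤ (K * y ^ (1 / 2 - ρ)) * (‖Q y‖ * (C * y ^ (1 / 2 + ρ))) := by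
        gcongr
        exact hK y hy
    _ = K * C * ((y ^ (1 / 2 - ρ) * y ^ (1 / 2 + ρ)) * ‖Q y‖) := by ring
    _ = _ := by rw [e]

theorem FundamentalSystem.exists_norm_u_le {ρ : ℝ} {V u v u' v' : ℝ → ℂ}
    (S : FundamentalSystem ρ V u v u' v') (X : ℝ) :
    ∃ K : ℝ, ∀ y ∈ Ioc 0 X, ‖u y‖ ≤ K * y ^ (1 / 2 - ρ) := by
  obtain ⟨C, hC, h⟩ := S.bound X
  refine ⟨C * X ^ (2 * ρ), fun y hy => (h y hy).1.trans ?_⟩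
  rw [mul_assoc]
  exact mul_le_mul_of_nonneg_left (rpow_half_add_le S.nonneg hy.1 hy.2) hC

/-- Two weighted bounded solutions of the forward Volterra equation coincide. -/
theorem IsForwardResolvent.eqOn (hm : 0 ≤ m.re) (hm0 : m ≠ 0) (hε : 0 ≤ ε)
    (hQ : Q ∈ PotentialClass ε) {F r s : ℝ → ℂ} (hr : IsForwardResolvent m k Q F r)
    (hs : IsForwardResolvent m k Q F s) : EqOn s r (Ioo 0 1) := by
  obtain ⟨v', S⟩ := exists_fundamentalSystem hm hm0 k
  obtain ⟨K, hK⟩ := S.exists_norm_u_le 1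
  obtain ⟨C, -, hC⟩ := S.bound 1
  have key : ∀ {f : ℝ → ℂ}, IsForwardResolvent m k Q F f → ∀ x ∈ Ioo (0 : ℝ) 1,
      IntegrableOn (fun y => u0 m k y * (Q y * f y)) (Ioc 0 x) ∧
      IntegrableOn (fun y => v0 m k y * (Q y * f y)) (Ioc 0 x) ∧
      f x + forwardOp (u0 m k) (v0 m k) (fun y => Q y * f y) x = F x := by
    rintro f ⟨hf1, ⟨M, hf2⟩, hf3⟩ x hx
    have hsub : Ioc 0 x ⊆ Ioo 0 1 := Ioc_subset_Ioo_right hx.2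
    have hf1' := hf1.mono_measure (Measure.restrict_mono hsub le_rfl)
    have hf2' := ae_restrict_of_ae_restrict_of_subset hsub hf2
    have hu := integrableOn_mul_mul_of_ae hε hQ S.continuousOn_u
      (fun y hy => hK y ⟨hy.1, hy.2.trans hx.2.le⟩) hf1' hf2'
    have hv := integrableOn_mul_mul_of_ae hε hQ S.continuousOn_v
      (fun y hy => (hC y ⟨hy.1, hy.2.trans hx.2.le⟩).2.2.1) hf1' hf2'
    refine ⟨hu, hv, ?_⟩
    rw [← (forwardKernel_integrable hx.1 hu hv).2]
    exact hf3 x hx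
  obtain ⟨Mr, hMr⟩ := hr.2.1
  obtain ⟨Ms, hMs⟩ := hs.2.1
  have hzero := S.eq_zero_of_eq_neg_forwardOp (PotentialClass.integrableOn_mul_norm hε hQ)
    (X := 1) (M := Ms + Mr) (d := fun x => s x - r x) (by
      filter_upwards [hMr, hMs] with y h1 h2
      rw [add_mul]
      exact (norm_sub_le _ _).trans (add_le_add h2 h1)) (by
      intro x hx
      obtain ⟨u1, v1, e1⟩ := key hr x hx
      obtain ⟨u2, v2, e2⟩ := key hs x hx
      have hi : ∀ {f : ℝ → ℂ}, IntegrableOn f (Ioc 0 x) → IntervalIntegrable f volume 0 x :=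
        fun h => (intervalIntegrable_iff_integrableOn_Ioc_of_le hx.1.le).2 h
      have e3 : forwardOp (u0 m k) (v0 m k) (fun y => Q y * (s y - r y)) x =
          forwardOp (u0 m k) (v0 m k) (fun y => Q y * s y) x -
            forwardOp (u0 m k) (v0 m k) (fun y => Q y * r y) x := by
        simp only [forwardOp, mul_sub]
        rw [intervalIntegral.integral_sub (hi u2) (hi u1),
          intervalIntegral.integral_sub (hi v2) (hi v1)]
        ring
      rw [e3]
      linear_combination e2 - e1)
  intro x hx
  exact sub_eq_zero.1 (hzero x hx)

end Main

end PerturbedBessel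

open PerturbedBessel in
theorem mainTheorem7 (m k : ℂ) (hm : 0 ≤ m.re) (hm0 : m ≠ 0) (hk : 0 ≤ k.re)
    (ε : ℝ) (hε : 0 ≤ ε) (Q : ℝ → ℂ) (hQ : Q ∈ PotentialClass ε)
    (n : ℕ) (hn : m.re ≤ ε / 2 * ((n : ℝ) + 1)) :
    -- the integrals that define the truncated series and the formula for the solution converge,
    -- and the truncated series is differentiable on `]0,1[`
    ((∀ (j : ℕ) (x : ℝ), 0 < x →
        GreenQDefinedAt (twoSidedKernelOn 1 m k) Q (iter m k Q j) x) ∧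
      (∀ x ∈ Set.Ioo (0 : ℝ) 1, GreenQDefinedAt (forwardKernel m k) Q (iter m k Q n) x) ∧
      (∀ x ∈ Set.Ioo (0 : ℝ) 1, DifferentiableAt ℝ (trunc m k Q n) x)) ∧
    -- the solution, its uniqueness and the formula for it
    (∃ g : ℝ → ℂ, (IsEigensolution m k Q g ∧ AgreesNearZero m g (trunc m k Q n)) ∧
      (∀ h : ℝ → ℂ, IsEigensolution m k Q h → AgreesNearZero m h (trunc m k Q n) →
        Set.EqOn h g (Set.Ioi 0)) ∧
      ∃ r : ℝ → ℂ,
        IsForwardResolvent m k Q (greenQ (forwardKernel m k) Q (iter m k Q n)) r ∧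
        (∀ s : ℝ → ℂ,
          IsForwardResolvent m k Q (greenQ (forwardKernel m k) Q (iter m k Q n)) s →
            Set.EqOn s r (Set.Ioo 0 1)) ∧
        ∀ x ∈ Set.Ioo (0 : ℝ) 1, g x = trunc m k Q n x + (-1) ^ (n + 1) * r x) ∧
    -- for `Re m < 1` the parameter of the truncated series may be any other one, in particular `0`
    (m.re < 1 → ∀ k' : ℂ, 0 ≤ k'.re →
      ∃ g : ℝ → ℂ, (IsEigensolution m k Q g ∧ AgreesNearZero m g (trunc m k' Q n)) ∧
        ∀ h : ℝ → ℂ, IsEigensolution m k Q h → AgreesNearZero m h (trunc m k' Q n) →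
          Set.EqOn h g (Set.Ioi 0)) := by
  refine ⟨⟨fun j x hx => greenQDefinedAt_iter hm hm0 hε hQ j hx,
    fun x hx => (forwardKernel_iter hm hm0 hε hQ hn ⟨hx.1, hx.2.le⟩).1,
    fun x hx => differentiableAt_trunc hm hm0 hε hQ n hx⟩, ?_, ?_⟩
  · obtain ⟨r, h1, h2, hrc, ⟨M, hM⟩, hr⟩ :=
      exists_eigensolution (k := k) hm hm0 hε hQ hn (Or.inl rfl)
    -- The correction `r` already contains the sign of the residual. The resolvent of the statement
    -- is `(-1)^(n+1) r`, and squaring the sign recovers `r`.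
    have hsq : ((-1 : ℂ) ^ (n + 1)) * (-1) ^ (n + 1) = 1 := by
      rw [← mul_pow]; norm_num
    have hnorm : ‖((-1 : ℂ) ^ (n + 1))‖ = 1 := by simp
    have hres : IsForwardResolvent m k Q (greenQ (forwardKernel m k) Q (iter m k Q n))
        (fun x => (-1) ^ (n + 1) * r x) := by
      obtain ⟨v', S⟩ := exists_fundamentalSystem hm hm0 k
      refine ⟨?_, ⟨M, ?_⟩, fun x hx => ?_⟩
      · exact ((continuousOn_const.mul hrc).mono Ioo_subset_Ioi_self).aestronglyMeasurable
          measurableSet_Ioo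
      · filter_upwards [ae_restrict_mem measurableSet_Ioo] with x hx
        rw [norm_mul, hnorm, one_mul]
        exact hM x ⟨hx.1, hx.2.le⟩
      · have hadm : Admissible m.re (fun y => Q y * ((-1) ^ (n + 1) * r y)) :=
          FundamentalSystem.admissible_mul hQ.1 (PotentialClass.integrableOn_mul_norm hε hQ)
            (continuousOn_const.mul hrc) (M := M) fun y hy => by
              rw [norm_mul, hnorm, one_mul]; exact hM y hy
        rw [(forwardKernel_integrable hx.1 (S.integrableOn_u_mul hadm x)
          (S.integrableOn_v_mul hadm x)).2,
          (forwardKernel_iter hm hm0 hε hQ hn ⟨hx.1, hx.2.le⟩).2]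
        have h3 := hr x hx.1
        simp only [sub_self, zero_mul, add_zero, forwardOp_const_mul] at h3
        simp only [mul_left_comm _ ((-1 : ℂ) ^ (n + 1)), forwardOp_const_mul]
        linear_combination (-1) ^ (n + 1) * h3 +
          forwardOp (u0 m k) (v0 m k) (fun y => Q y * extIter m k Q n y) x * hsq
    refine ⟨_, ⟨h1, h2⟩, fun h hh hhT => eqOn_of_agreesNearZero hm hm0 hε hQ hh h1 hhT h2,
      _, hres, fun s hs => hres.eqOn hm hm0 hε hQ hs, fun x hx => ?_⟩
    rw [extTrunc_eqOn_trunc hm hm0 hε hQ n ⟨hx.1, hx.2.le⟩]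
    linear_combination (-r x) * hsq
  · intro hlt k' _
    obtain ⟨r, h1, h2, -⟩ := exists_eigensolution (k := k) (k' := k') hm hm0 hε hQ hn (Or.inr hlt)
    exact ⟨_, ⟨h1, h2⟩, fun h hh hhT => eqOn_of_agreesNearZero hm hm0 hε hQ hh h1 hhT h2⟩
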